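/- Let $B^n\subset\mathbb R^n$ be the Euclidean unit ball, $\mathbb S^n\subset\mathbb R^n\times\mathbb R$ the unit sphere, and for $a\in(0,\pi/2)$ let $$\varphi_a:B^n\to\mathbb S^n,\qquad \varphi_a(x)=\Big(\sin a\,\frac{x}{|x|},\ \cos a\Big).$$ Let $(r,n,a)$ be one of $$\Big(3,\,7,\,\tfrac12\arccos\tfrac{2\sqrt{10}-11}{9}\Big),\qquad \Big(4,\,9,\,\tfrac12\arccos\tfrac{\sqrt{105}-19}{16}\Big),\qquad \Big(5,\,11,\,\tfrac12\arccos\tfrac{6\sqrt6-29}{25}\Big);$$ these are the cases, for $3\le r\le 5$, in which $\varphi_a$ is a proper (that is, not harmonic) weakly $r$-harmonic, equivalently weakly $ES$-$r$-harmonic, map. Then $\varphi_a$ is unstable for both the $r$-energy $E_r$ and the Eells--Sampson $r$-energy $E_r^{ES}$. Here, for $\varphi\in W^{r,2}(B^n,\mathbb S^n)$ with tension field $\tau(\varphi)$, pull-back connection $\nabla^\varphi$ on $\varphi^{-1}T\mathbb S^n$ and rough Laplacian $\overline\Delta=-\sum_i\nabla^\varphi_{e_i}\nabla^\varphi_{e_i}$,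 $$E_{2s}(\varphi)=\tfrac12\int_{B^n}|\overline\Delta^{\,s-1}\tau(\varphi)|^2\,dV,\qquad E_{2s+1}(\varphi)=\tfrac12\int_{B^n}\sum_{j=1}^n|\nabla^\varphi_{e_j}\overline\Delta^{\,s-1}\tau(\varphi)|^2\,dV,$$ $$E_r^{ES}(\varphi)=\tfrac12\int_{B^n}|(d^*+d)^r\varphi|^2\,dV .$$ A critical point $\varphi_0\in W^{r,2}(B^n,\mathbb S^n)$ of $F\in\{E_r,E_r^{ES}\}$ is \emph{stable} if $\frac{d^2}{ds^2}F(\varphi_s)\big|_{s=0}\ge 0$ for every smooth variation $\varphi_s$ ($s\ge 0$ small) of $\varphi_0$ along which this derivative exists, through maps $\varphi_s\in W^{r,2}(B^n,\mathbb S^n)$ such that $\nabla^k(\varphi_s-\varphi_0)|_{\partial B^n}=0$ in the sense of traces for $0\le k\le r-1$; smooth means that $s\mapsto\varphi_s$ is a $C^\infty$ curve in $W^{r,2}(B^n,\mathbb R^{n+1})$. It is \emph{unstable} if it is not stable. -/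

import Mathlib

open MeasureTheory Filter Topology Set
open scoped ENNReal ContDiff

noncomputable section

namespace PolyEnergy

/-- Euclidean space `ℝⁿ`. -/
abbrev E (n : ℕ) : Type := EuclideanSpace ℝ (Fin n)

/-- Lebesgue measure on the open unit ball `Bⁿ`. -/
def ballMeasure (n : ℕ) : Measure (E n) := volume.restrict (Metric.ball 0 1)

/-- `g` is the weak partial derivative `∂f/∂xᵢ` on the open unit ball. -/
def IsWeakDeriv {n m : ℕ} (i : Fin n) (f g : E n → E m) : Prop :=
  LocallyIntegrableOn f (Metric.ball 0 1) ∧ LocallyIntegrableOn g (Metric.ball 0 1) ∧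
  ∀ η : E n → ℝ, ContDiff ℝ ∞ η → HasCompactSupport η → tsupport η ⊆ Metric.ball 0 1 →
    ∫ x, (fderiv ℝ η x (EuclideanSpace.single i 1)) • f x ∂(ballMeasure n)
      = -∫ x, η x • g x ∂(ballMeasure n)

open Classical in
/-- The weak partial derivative `∂f/∂xᵢ` on the unit ball (unique up to null sets;
the junk value is `0` where no weak derivative exists). -/
def weakDeriv {n m : ℕ} (i : Fin n) (f : E n → E m) : E n → E m :=
  if h : ∃ g, IsWeakDeriv i f g then h.choose else 0

/-! ### Sobolev spaces -/

/-- `f ∈ W^{k,2}(Bⁿ, ℝᵐ)`. -/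
def MemSobolev {n m : ℕ} : ℕ → (E n → E m) → Prop
  | 0, f => MemLp f 2 (ballMeasure n)
  | k + 1, f => MemLp f 2 (ballMeasure n) ∧ ∀ i, ∃ g, IsWeakDeriv i f g ∧ MemSobolev k g

/-- The `W^{k,2}(Bⁿ)` norm (up to equivalence: the sum of the `L²` norms of all iterated weak
derivatives of order at most `k`). It is meant for elements of `W^{k,2}`. -/
def sobolevNorm {n m : ℕ} : ℕ → (E n → E m) → ℝ≥0∞
  | 0, f => eLpNorm f 2 (ballMeasure n)
  | k + 1, f => eLpNorm f 2 (ballMeasure n) + ∑ i, sobolevNorm k (weakDeriv i f)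

/-- `u ∈ W^{1,2}(Bⁿ, ℝᵐ)` has trace `g` on the unit sphere `∂Bⁿ`: it is the `W^{1,2}` limit of
functions smooth up to the boundary whose boundary values converge to `g` in `L²(∂Bⁿ)`
(for the surface measure). -/
def HasTrace {n m : ℕ} (u : E n → E m) (g : Metric.sphere (0 : E n) 1 → E m) : Prop :=
  ∃ v : ℕ → E n → E m, (∀ j, ContDiff ℝ ∞ (v j)) ∧
    Tendsto (fun j => sobolevNorm 1 (v j - u)) atTop (𝓝 0) ∧
    Tendsto (fun j => eLpNorm (fun y : Metric.sphere (0 : E n) 1 => v j y - g y) 2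
      (volume : Measure (E n)).toSphere) atTop (𝓝 0)

/-- All weak derivatives of `u` of order at most `k - 1` have zero trace on `∂Bⁿ`. -/
def ZeroTraces {n m : ℕ} : ℕ → (E n → E m) → Prop
  | 0, _ => True
  | k + 1, u => HasTrace u 0 ∧ ∀ i, ZeroTraces k (weakDeriv i u)

/-- `φ ∈ W^{r,2}(Bⁿ, 𝕊ⁿ)`. -/
def MemSobolevSphere {n : ℕ} (r : ℕ) (φ : E n → E (n + 1)) : Prop :=
  MemSobolev r φ ∧ ∀ᵐ x ∂(ballMeasure n), φ x ∈ Metric.sphere (0 : E (n + 1)) 1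

/-- `φ ∈ W^{r,2}_{φ₀}(Bⁿ, 𝕊ⁿ)`. -/
def MemSobolevSphereBdry {n : ℕ} (r : ℕ) (φ₀ φ : E n → E (n + 1)) : Prop :=
  MemSobolevSphere r φ ∧ ZeroTraces r (φ - φ₀)

/-! ### Calculus on the pull-back bundle and the energy functionals -/

/-- Orthogonal projection of `v ∈ ℝᵐ` to the tangent space of the unit sphere at `y`. -/
def tanProj {m : ℕ} (y v : E m) : E m := v - (inner ℝ y v) • y

/-- The pull-back connection: `∇^φ_{eᵢ} V`, for a section `V` of `φ⁻¹ T𝕊ⁿ` seen as an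
`ℝⁿ⁺¹`-valued function, is the tangential part of `∂V/∂xᵢ`. -/
def cov {n m : ℕ} (φ : E n → E m) (i : Fin n) (V : E n → E m) : E n → E m :=
  fun x => tanProj (φ x) (weakDeriv i V x)

/-- The tension field `τ(φ) = trace ∇dφ`. -/
def tension {n m : ℕ} (φ : E n → E m) : E n → E m :=
  fun x => ∑ i, cov φ i (weakDeriv i φ) x

/-- The rough Laplacian `- ∑ᵢ ∇^φ_{eᵢ} ∇^φ_{eᵢ} V` (the domain is flat). -/
def roughLap {n m : ℕ} (φ : E n → E m) (V : E n → E m) : E n → E m :=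
  fun x => -∑ i, cov φ i (cov φ i V) x

/-- The `r`-energy `E_r(φ)`, `r ≥ 2`: with `s = r / 2` it is `½ ∫ |Δ̄^{s-1} τ|²` for `r = 2s` and
`½ ∫ ∑ⱼ |∇_{eⱼ} Δ̄^{s-1} τ|²` for `r = 2s + 1`. -/
def rEnergy {n : ℕ} (r : ℕ) (φ : E n → E (n + 1)) : ℝ :=
  if Even r then
    (1 / 2) * ∫ x, ‖((roughLap φ)^[r / 2 - 1] (tension φ)) x‖ ^ 2 ∂(ballMeasure n)
  else
    (1 / 2) * ∫ x, ∑ j, ‖cov φ j ((roughLap φ)^[r / 2 - 1] (tension φ)) x‖ ^ 2 ∂(ballMeasure n)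

/-- Forms of mixed degree with values in the pull-back bundle, through their components
`θ p I = θ_p(e_{I 0}, …, e_{I (p-1)})`. -/
abbrev MixedForm (n m : ℕ) : Type := (p : ℕ) → (Fin p → Fin n) → E n → E m

/-- Exterior covariant derivative of a `p`-form. -/
def extD {n m p : ℕ} (φ : E n → E m) (θ : (Fin p → Fin n) → E n → E m) :
    (Fin (p + 1) → Fin n) → E n → E m :=
  fun I x => ∑ j : Fin (p + 1), (-1 : ℝ) ^ (j : ℕ) • cov φ (I j) (θ (fun i => I (j.succAbove i))) x

/-- Codifferential of a `(p + 1)`-form. -/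
def coD {n m p : ℕ} (φ : E n → E m) (θ : (Fin (p + 1) → Fin n) → E n → E m) :
    (Fin p → Fin n) → E n → E m :=
  fun I x => -∑ k, cov φ k (θ (Fin.cons k I)) x

/-- The operator `d* + d` on forms of mixed degree (`d*` is zero on `0`-forms). -/
def dStarAddD {n m : ℕ} (φ : E n → E m) (θ : MixedForm n m) : MixedForm n m
  | 0 => coD φ (θ 1)
  | p + 1 => coD φ (θ (p + 2)) + extD φ (θ p)

/-- The differential `dφ`, a `1`-form. -/
def diffForm {n m : ℕ} (φ : E n → E m) : MixedForm n m
  | 1 => fun I => weakDeriv (I 0) φ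
  | _ => 0

/-- `|θ|² = ∑_p ∑_{i₁ < … < i_p} |θ(e_{i₁}, …, e_{i_p})|²`; the inner sum is written over all
`p`-tuples of indices, with the factor `1 / p!`. -/
def normSqForm {n m : ℕ} (θ : MixedForm n m) (x : E n) : ℝ :=
  ∑ p ∈ Finset.range (n + 1), (1 / (p.factorial : ℝ)) * ∑ I : Fin p → Fin n, ‖θ p I x‖ ^ 2

/-- The Eells–Sampson `r`-energy `½ ∫ |(d* + d)^r φ|²`, `r ≥ 1`. Its first factor gives `dφ`,
because `d*` vanishes on `φ`. -/
def esEnergy {n : ℕ} (r : ℕ) (φ : E n → E (n + 1)) : ℝ :=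
  (1 / 2) * ∫ x, normSqForm ((dStarAddD φ)^[r - 1] (diffForm φ)) x ∂(ballMeasure n)

/-! ### Stability -/

/-- A smooth variation `φ_s`, `0 ≤ s < ε`, of `φ₀` through maps in `W^{r,2}_{φ₀}(Bⁿ, 𝕊ⁿ)`.
Smooth: `s ↦ φ_s` is a `C^∞` curve in `W^{r,2}(Bⁿ, ℝⁿ⁺¹)`; `D k s` is its `k`-th derivative. -/
def IsVariation {n : ℕ} (r : ℕ) (φ₀ : E n → E (n + 1)) (ε : ℝ) (φ : ℝ → E n → E (n + 1)) : Prop :=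
  0 < ε ∧ φ 0 =ᵐ[ballMeasure n] φ₀ ∧
  (∀ s ∈ Ico 0 ε, MemSobolevSphereBdry r φ₀ (φ s)) ∧
  ∃ D : ℕ → ℝ → E n → E (n + 1), D 0 = φ ∧
    ∀ k, ∀ s ∈ Ico 0 ε, MemSobolev r (D k s) ∧
      Tendsto (fun t => sobolevNorm r ((t - s)⁻¹ • (D k t - D k s) - D (k + 1) s))
        (𝓝[Ico 0 ε \ {s}] s) (𝓝 0)

/-- A critical point `φ₀ ∈ W^{r,2}(Bⁿ, 𝕊ⁿ)` of the functional `F` is stable if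
`d²/ds² F(φ_s) |_{s = 0} ≥ 0` for each variation `φ_s` of `φ₀` through maps in `W^{r,2}_{φ₀}`
along which this second derivative exists. Here `F₁ s` is the first derivative at `s`
and `F₂` is the second derivative at `0`. -/
def IsStable {n : ℕ} (r : ℕ) (F : (E n → E (n + 1)) → ℝ) (φ₀ : E n → E (n + 1)) : Prop :=
  ∀ (ε : ℝ) (φ : ℝ → E n → E (n + 1)), IsVariation r φ₀ ε φ →
    ∀ (F₁ : ℝ → ℝ) (F₂ : ℝ),
      (∀ s ∈ Ico 0 ε, HasDerivWithinAt (fun t => F (φ t)) (F₁ s) (Ico 0 ε) s) →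
      HasDerivWithinAt F₁ F₂ (Ico 0 ε) 0 → 0 ≤ F₂

/-- The map `φ_a : Bⁿ → 𝕊ⁿ ⊂ ℝⁿ × ℝ`, `x ↦ (sin a · x / |x|, cos a)`
(the value at the origin is irrelevant). -/
def phi (n : ℕ) (a : ℝ) : E n → E (n + 1) :=
  fun x => WithLp.toLp 2
    (Fin.snoc (α := fun _ => ℝ) (fun i : Fin n => Real.sin a * (x i / ‖x‖)) (Real.cos a))

end PolyEnergy

end

/-!
The map `phi n a` is unstable because a rotationally symmetric variation, concentrated on a long
annulus around the origin, decreases the energy to second order.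

**The variation.** A rotationally symmetric map is given by its latitude `θ` as a function of
`t = log |x|` (`symMap`); `phi n a` has constant latitude `a`. It is varied to
`θ_s(t) = a + s e^{-t/2} χ(εt)`, where `χ` is a cut-off function supported in `[-2, -1]` (`lat`).
Since `n = 2r + 1`, the factor `e^{-t/2} = |x|^{-(n - 2r)/2}` makes the second variation invariant
under dilations of `x`, that is, under translations of `t`. If the second variation has a negative
density on the profile `e^{-t/2}` itself, then it is negative for small `ε`: in the variable
`u = εt` all derivatives of `χ` carry a factor `ε`. Because the variation is supported in an annulus
away from the origin and from the boundary, it is a smooth curve in every Sobolev space and leaves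
the traces unchanged (`isVariation_of_annular`).

**Weak derivatives.** All fields that occur are smooth off the origin and homogeneous of degree `-k`
near the origin (`IsHom`). For `k + 1 < n` the classical derivative of such a field is its weak
derivative on the whole ball (`IsHom.isWeakDeriv`). The chosen weak derivative of a function depends
only on its almost everywhere class (`weakDeriv_congr`), so that iterated covariant derivatives can
be computed up to null sets.

**The energies.** With `ν` the unit field along `symMap θ` in the direction of increasing latitude,
`yᵢ = xᵢ / |x|` and `tᵢ` the part of `eᵢ` orthogonal to `x`, the forms with components `F ν`,
`p yᵢ ν + q tᵢ`, `w (yᵢ tⱼ - yⱼ tᵢ)` in degrees `0, 1, 2` and zero in higher degrees are preserved by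
`d* + d` (`dStarAddD_symForm`). Hence both energies are one-dimensional integrals of densities which
are found by iterating explicit differential operators in `t`. A profile of weight `k` is written
`e^{-kt} G(ε, s e^{-t/2}, εt)` (`prof`); the derivative in `t` then acts on functions of
`(ε, σ, u)` by `hatD`.

**The sign.** By `energy_second_deriv` the second derivative of the energy at `s = 0` is a positive
multiple of `∫ ∂²G/∂σ² (ε, 0, u) du`, where `G` is the rescaled density. It depends continuously on
`ε`, and at `ε = 0` it equals `2 c₂ ∫ χ²`, where `c₂` is computed by propagating Taylor expansions of
order two in `σ` (`HasJet`), on which `hatD` acts diagonally (`not_isStable_of_density`). In the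
three cases `c₂` is a polynomial in `cos 2a` with a negative value.
-/

noncomputable section

namespace PolyEnergy

/-- The classical partial derivative `∂f/∂xᵢ`. -/
def pd {n : ℕ} {F : Type*} [NormedAddCommGroup F] [NormedSpace ℝ F] (i : Fin n) (f : E n → F) :
    E n → F :=
  fun x => fderiv ℝ f x (EuclideanSpace.single i 1)

/-- `f` is smooth off the origin and homogeneous of degree `-k` near the origin. The value of `f`
at the origin plays no role. -/
def IsHom {n : ℕ} {F : Type*} [NormedAddCommGroup F] [NormedSpace ℝ F] (k : ℕ) (f : E n → F) :
    Prop :=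
  (∀ x ≠ 0, ContDiffAt ℝ ∞ f x) ∧
    ∃ δ > 0, ∀ x ≠ 0, ‖x‖ < δ → ∀ t : ℝ, 0 < t → t ≤ 1 → t ^ k • f (t • x) = f x

section Hom

variable {n : ℕ} {F : Type*} [NormedAddCommGroup F] [NormedSpace ℝ F] {k l : ℕ} {f g : E n → F}

lemma IsHom.pd (hf : IsHom k f) (i : Fin n) : IsHom (k + 1) (pd i f) := by
  obtain ⟨h1, δ, hδ, h2⟩ := hf
  refine ⟨fun x hx => ?_, δ, hδ, fun x hx hxδ t ht ht1 => ?_⟩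
  · have := (h1 x hx).fderiv_right (m := ∞) (by simp)
    exact this.clm_apply contDiffAt_const
  · have hev : (fun y => t ^ k • f (t • y)) =ᶠ[𝓝 x] f := by
      filter_upwards [isOpen_ne.mem_nhds hx,
        (isOpen_lt continuous_norm continuous_const).mem_nhds hxδ]
        with y hy hyδ using h2 y hy hyδ t ht ht1
    have htx : t • x ≠ 0 := smul_ne_zero ht.ne' hx
    have hd : HasFDerivAt f (fderiv ℝ f (t • x)) (t • x) :=
      ((h1 _ htx).differentiableAt (by simp)).hasFDerivAt
    have hc : HasFDerivAt (fun y : E n => t • y) (t • ContinuousLinearMap.id ℝ (E n)) x :=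
      (hasFDerivAt_id x).const_smul t
    have h3 := ((hd.comp x hc).const_smul (t ^ k)).congr_of_eventuallyEq hev.symm
    simp only [PolyEnergy.pd, h3.fderiv]
    simp [smul_smul, pow_succ]

lemma IsHom.bound (hf : IsHom k f) : ∃ C, 0 ≤ C ∧ ∀ x ≠ 0, ‖x‖ ≤ 1 → ‖f x‖ ≤ C * (‖x‖ ^ k)⁻¹ := by
  obtain ⟨h1, δ, hδ, h2⟩ := hf
  set δ' := min (δ / 2) 1 with hδ'
  have hδ'0 : 0 < δ' := by positivity
  have hδ'1 : δ' < δ := lt_of_le_of_lt (min_le_left _ _) (by linarith)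
  have hK : IsCompact (Metric.closedBall (0 : E n) 1 ∩ {x | δ' ≤ ‖x‖}) :=
    (isCompact_closedBall _ _).inter_right (isClosed_le continuous_const continuous_norm)
  have hK0 : ∀ x ∈ Metric.closedBall (0 : E n) 1 ∩ {x | δ' ≤ ‖x‖}, x ≠ 0 := by
    rintro x hx rfl
    have := hx.2
    simp only [mem_ofPred_eq, norm_zero] at this
    linarith
  obtain ⟨C, hC⟩ := hK.exists_bound_of_continuousOn (f := f) (fun x hx =>
    (h1 x (hK0 x hx)).continuousAt.continuousWithinAt)
  have hC' : ∀ x, ‖x‖ ≤ 1 → δ' ≤ ‖x‖ → ‖f x‖ ≤ max C 0 := fun x hx hx' =>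
    (hC x ⟨by simpa using hx, hx'⟩).trans (le_max_left _ _)
  refine ⟨max C 0, le_max_right _ _, fun x hx hx1 => ?_⟩
  have hx0 : 0 < ‖x‖ := norm_pos_iff.2 hx
  have hone : 1 ≤ (‖x‖ ^ k)⁻¹ := (one_le_inv₀ (by positivity)).2 (pow_le_one₀ hx0.le hx1)
  rcases le_total δ' ‖x‖ with h | h
  · exact (hC' x hx1 h).trans (le_mul_of_one_le_right (le_max_right _ _) hone)
  · -- scale `x` out to the sphere of radius `δ'`
    set t := ‖x‖ / δ' with ht
    have ht0 : 0 < t := by positivity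
    have ht1 : t ≤ 1 := (div_le_one hδ'0).2 h
    have hy : ‖t⁻¹ • x‖ = δ' := by
      rw [norm_smul, Real.norm_of_nonneg (by positivity), ht]; field_simp
    have h3 := h2 (t⁻¹ • x) (smul_ne_zero (by positivity) hx) (by rw [hy]; exact hδ'1) t ht0 ht1
    rw [smul_smul, mul_inv_cancel₀ ht0.ne', one_smul] at h3
    have h4 := hC' (t⁻¹ • x) (by rw [hy]; exact min_le_right _ _) hy.ge
    rw [← h3, norm_smul, Real.norm_of_nonneg (by positivity)] at h4
    rw [← div_eq_mul_inv, le_div_iff₀ (by positivity)]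
    refine le_trans ?_ h4
    rw [mul_comm]
    gcongr
    rw [ht, le_div_iff₀ hδ'0]
    exact mul_le_of_le_one_right hx0.le (min_le_right _ _)

lemma IsHom.aestronglyMeasurable (hn : 0 < n) (hf : IsHom k f) (μ : Measure (E n))
    (hμ : μ ≪ volume) : AEStronglyMeasurable f μ := by
  have : Nonempty (Fin n) := ⟨⟨0, hn⟩⟩
  have hc : ContinuousOn f {0}ᶜ := fun x hx => (hf.1 x hx).continuousAt.continuousWithinAt
  have h1 := hc.aestronglyMeasurable (μ := μ) (measurableSet_singleton (0 : E n)).compl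
  have h2 : μ.restrict {0}ᶜ = μ := by
    rw [Measure.restrict_eq_self_of_ae_mem]
    have : μ {(0 : E n)} = 0 := hμ (by simp)
    rw [ae_iff]; simpa using this
  rwa [h2] at h1

lemma ballMeasure_ac (n : ℕ) : ballMeasure n ≪ volume := Measure.absolutelyContinuous_of_le
  Measure.restrict_le_self

instance (n : ℕ) : IsFiniteMeasure (ballMeasure n) :=
  ⟨by simp only [ballMeasure, Measure.restrict_apply_univ]; exact measure_ball_lt_top⟩

lemma ae_ball_ne_zero {n : ℕ} (hn : 0 < n) :
    ∀ᵐ x ∂(ballMeasure n), x ≠ 0 ∧ x ∈ Metric.ball (0 : E n) 1 := by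
  have : Nonempty (Fin n) := ⟨⟨0, hn⟩⟩
  have h1 : ∀ᵐ x ∂(ballMeasure n), x ≠ 0 :=
    (ballMeasure_ac n).ae_le (Measure.ae_ne volume 0)
  have h2 : ∀ᵐ x ∂(ballMeasure n), x ∈ Metric.ball (0 : E n) 1 :=
    ae_restrict_mem Metric.isOpen_ball.measurableSet
  filter_upwards [h1, h2] with x a b using ⟨a, b⟩

lemma integrable_norm_pow_inv {n k : ℕ} (hk : k < n) :
    Integrable (fun x : E n => (‖x‖ ^ k)⁻¹) (ballMeasure n) := by
  have : Nonempty (Fin n) := ⟨⟨0, by omega⟩⟩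
  have := (integrableOn_fun_norm_addHaar (volume : Measure (E n)) (f := fun y : ℝ => (y ^ k)⁻¹)
    (r := 1)).2 ?_
  · exact this
  · have hc : IntegrableOn (fun y : ℝ => y ^ (n - 1 - k)) (Ioo 0 1) :=
      ((continuous_id.pow _).integrableOn_Icc (a := (0 : ℝ)) (b := 1)).mono_set Ioo_subset_Icc_self
    refine hc.congr_fun (fun y hy => ?_) measurableSet_Ioo
    simp only [finrank_euclideanSpace, Fintype.card_fin, smul_eq_mul]
    rw [pow_sub₀ y hy.1.ne' (by omega)]

lemma IsHom.integrable (hf : IsHom k f) (hk : k < n) : Integrable f (ballMeasure n) := by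
  obtain ⟨C, -, hC⟩ := hf.bound
  refine ((integrable_norm_pow_inv hk).const_mul C).mono'
    (hf.aestronglyMeasurable (by omega) _ (ballMeasure_ac n)) ?_
  filter_upwards [ae_ball_ne_zero (by omega : 0 < n)] with x hx
  exact hC x hx.1 (mem_ball_zero_iff.1 hx.2).le

lemma IsHom.memLp_two (hf : IsHom k f) (hk : 2 * k < n) : MemLp f 2 (ballMeasure n) := by
  obtain ⟨C, -, hC⟩ := hf.bound
  rw [memLp_two_iff_integrable_sq_norm (hf.aestronglyMeasurable (by omega) _ (ballMeasure_ac n))]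
  refine ((integrable_norm_pow_inv hk).const_mul (C ^ 2)).mono'
    ((hf.aestronglyMeasurable (by omega) _ (ballMeasure_ac n)).norm.pow 2) ?_
  filter_upwards [ae_ball_ne_zero (by omega : 0 < n)] with x hx
  have := hC x hx.1 (mem_ball_zero_iff.1 hx.2).le
  rw [Real.norm_of_nonneg (by positivity)]
  calc ‖f x‖ ^ 2 ≤ (C * (‖x‖ ^ k)⁻¹) ^ 2 := by gcongr
    _ = C ^ 2 * (‖x‖ ^ (2 * k))⁻¹ := by
      rw [mul_pow, ← inv_pow, ← inv_pow, ← pow_mul, mul_comm 2 k, inv_pow]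

lemma IsHom.add (hf : IsHom k f) (hg : IsHom k g) : IsHom k (fun x => f x + g x) := by
  obtain ⟨a1, δ, hδ, a2⟩ := hf
  obtain ⟨b1, ε, hε, b2⟩ := hg
  refine ⟨fun x hx => (a1 x hx).add (b1 x hx), min δ ε, lt_min hδ hε, fun x hx hxd t h0 h1 => ?_⟩
  rw [smul_add, a2 x hx (hxd.trans_le (min_le_left _ _)) t h0 h1,
    b2 x hx (hxd.trans_le (min_le_right _ _)) t h0 h1]

lemma IsHom.smul {c : E n → ℝ} (hc : IsHom l c) (hf : IsHom k f) :
    IsHom (l + k) (fun x => c x • f x) := by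
  obtain ⟨a1, δ, hδ, a2⟩ := hc
  obtain ⟨b1, ε, hε, b2⟩ := hf
  refine ⟨fun x hx => (a1 x hx).smul (b1 x hx), min δ ε, lt_min hδ hε, fun x hx hxd t h0 h1 => ?_⟩
  simp only [← a2 x hx (hxd.trans_le (min_le_left _ _)) t h0 h1,
    ← b2 x hx (hxd.trans_le (min_le_right _ _)) t h0 h1, pow_add, smul_smul, smul_eq_mul]
  congr 1; ring

lemma IsHom.sub (hf : IsHom k f) (hg : IsHom k g) : IsHom k (fun x => f x - g x) := by
  obtain ⟨a1, δ, hδ, a2⟩ := hf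
  obtain ⟨b1, ε, hε, b2⟩ := hg
  refine ⟨fun x hx => (a1 x hx).sub (b1 x hx), min δ ε, lt_min hδ hε, fun x hx hxd t h0 h1 => ?_⟩
  rw [smul_sub, a2 x hx (hxd.trans_le (min_le_left _ _)) t h0 h1,
    b2 x hx (hxd.trans_le (min_le_right _ _)) t h0 h1]

lemma IsHom.const (v : F) : IsHom 0 (fun _ : E n => v) :=
  ⟨fun _ _ => contDiffAt_const, 1, one_pos, fun x _ _ t _ _ => by simp⟩

/-- A function that is smooth off the origin and vanishes near the origin is homogeneous of every
degree there. -/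
lemma IsHom.of_eventually_zero (h1 : ∀ x ≠ 0, ContDiffAt ℝ ∞ f x) (h2 : ∀ᶠ x in 𝓝 0, f x = 0)
    (k : ℕ) : IsHom k f := by
  obtain ⟨δ, hδ, h⟩ := Metric.eventually_nhds_iff.1 h2
  refine ⟨h1, δ, hδ, fun x _ hxd t h0 ht => ?_⟩
  have hx : f x = 0 := h (by simpa using hxd)
  have : ‖t • x‖ < δ := by
    rw [norm_smul, Real.norm_of_nonneg h0.le]
    exact (mul_le_of_le_one_left (norm_nonneg _) ht).trans_lt hxd
  rw [h (by simpa using this), hx, smul_zero]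

end Hom

/-! ### Weak derivatives -/

section Weak

variable {n m : ℕ} {i : Fin n} {f g : E n → E m}

lemma LocallyIntegrableOn.congr_ball {f g : E n → E m} (h : f =ᵐ[ballMeasure n] g)
    (hf : LocallyIntegrableOn f (Metric.ball 0 1)) : LocallyIntegrableOn g (Metric.ball 0 1) := by
  rw [locallyIntegrableOn_iff Metric.isOpen_ball.isLocallyClosed] at hf ⊢
  intro K hK hKc
  exact (hf K hK hKc).congr (ae_mono (Measure.restrict_mono hK le_rfl) h)

/-- A test function times a locally integrable function is integrable. -/
lemma integrable_test_smul {η : E n → ℝ} (h1 : Continuous η) (h2 : HasCompactSupport η)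
    (h3 : tsupport η ⊆ Metric.ball 0 1) {u : E n → E m}
    (hu : LocallyIntegrableOn u (Metric.ball 0 1)) : Integrable (fun x => η x • u x) := by
  have hu' : IntegrableOn u (tsupport η) :=
    (locallyIntegrableOn_iff Metric.isOpen_ball.isLocallyClosed).1 hu _ h3 h2
  have := hu'.continuousOn_smul h1.continuousOn h2
  rwa [integrableOn_iff_integrable_of_support_subset] at this
  intro x hx
  exact subset_tsupport η fun h => hx (by simp only [h, zero_smul])

lemma integral_ball_eq {η : E n → ℝ} (h3 : tsupport η ⊆ Metric.ball 0 1) (u : E n → E m) :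
    ∫ x, η x • u x ∂(ballMeasure n) = ∫ x, η x • u x := by
  refine setIntegral_eq_integral_of_forall_compl_eq_zero fun x hx => ?_
  rw [image_eq_zero_of_notMem_tsupport fun hx' => hx (h3 hx'), zero_smul]

lemma IsWeakDeriv.congr {f' g' : E n → E m} (h : f =ᵐ[ballMeasure n] f')
    (h' : g =ᵐ[ballMeasure n] g') (hf : IsWeakDeriv i f g) : IsWeakDeriv i f' g' := by
  refine ⟨LocallyIntegrableOn.congr_ball h hf.1, LocallyIntegrableOn.congr_ball h' hf.2.1,
    fun η h1 h2 h3 => ?_⟩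
  have e1 : (fun x => fderiv ℝ η x (EuclideanSpace.single i 1) • f x) =ᵐ[ballMeasure n]
      fun x => fderiv ℝ η x (EuclideanSpace.single i 1) • f' x :=
    h.mono fun x hx => by simp only [hx]
  have e2 : (fun x => η x • g x) =ᵐ[ballMeasure n] fun x => η x • g' x :=
    h'.mono fun x hx => by simp only [hx]
  rw [← integral_congr_ae e1, ← integral_congr_ae e2]
  exact hf.2.2 η h1 h2 h3

/-- The chosen weak derivative depends only on the almost everywhere class of the function. -/
lemma weakDeriv_congr (h : f =ᵐ[ballMeasure n] g) : weakDeriv i f = weakDeriv i g := by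
  have : IsWeakDeriv i f = IsWeakDeriv i g := by
    funext u
    exact propext ⟨fun hu => hu.congr h .rfl, fun hu => hu.congr h.symm .rfl⟩
  unfold weakDeriv
  rw [this]

lemma IsWeakDeriv.unique {g' : E n → E m} (h : IsWeakDeriv i f g) (h' : IsWeakDeriv i f g') :
    g =ᵐ[ballMeasure n] g' := by
  have h0 : LocallyIntegrableOn (fun x => g x - g' x) (Metric.ball 0 1) (volume : Measure (E n)) :=
    h.2.1.sub h'.2.1
  have key := Metric.isOpen_ball.ae_eq_zero_of_integral_contDiff_smul_eq_zero h0 ?_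
  · rw [Filter.EventuallyEq, ballMeasure, ae_restrict_iff' Metric.isOpen_ball.measurableSet]
    filter_upwards [key] with x hx hx' using sub_eq_zero.1 (hx hx')
  · intro η h1 h2 h3
    have e := (h.2.2 η h1 h2 h3).symm.trans (h'.2.2 η h1 h2 h3)
    rw [neg_inj, integral_ball_eq h3, integral_ball_eq h3] at e
    simp only [smul_sub]
    rw [integral_sub (integrable_test_smul h1.continuous h2 h3 h.2.1)
      (integrable_test_smul h1.continuous h2 h3 h'.2.1), e, sub_self]

lemma IsWeakDeriv.weakDeriv_ae_eq (h : IsWeakDeriv i f g) : weakDeriv i f =ᵐ[ballMeasure n] g := by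
  have hex : ∃ g, IsWeakDeriv i f g := ⟨g, h⟩
  have : IsWeakDeriv i f (weakDeriv i f) := by
    rw [weakDeriv, dif_pos hex]; exact hex.choose_spec
  exact this.unique h

lemma IsHom.inv_norm : IsHom 1 (fun x : E n => ‖x‖⁻¹) := by
  refine ⟨fun x hx => (contDiffAt_norm ℝ hx).inv (norm_ne_zero_iff.2 hx), 1, one_pos,
    fun x hx _ t h0 _ => ?_⟩
  simp only [norm_smul, Real.norm_of_nonneg h0.le, pow_one, smul_eq_mul]
  field_simp

/-- Off the origin the classical derivative of a function of moderate growth is its weak derivative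
on the whole ball: test functions are cut off near the origin, and the error vanishes in the limit
because a point has zero capacity. -/
lemma IsHom.isWeakDeriv {k : ℕ} (hf : IsHom k f) (hk : k + 1 < n) (i : Fin n) :
    IsWeakDeriv i f (PolyEnergy.pd i f) := by
  have hfi : Integrable f (ballMeasure n) := hf.integrable (by omega)
  have hgi : Integrable (PolyEnergy.pd i f) (ballMeasure n) := (hf.pd i).integrable hk
  have hfl : LocallyIntegrableOn f (Metric.ball 0 1) :=
    IntegrableOn.locallyIntegrableOn (μ := volume) hfi
  have hgl : LocallyIntegrableOn (PolyEnergy.pd i f) (Metric.ball 0 1) :=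
    IntegrableOn.locallyIntegrableOn (μ := volume) hgi
  refine ⟨hfl, hgl, fun η h1 h2 h3 => ?_⟩
  let ψ : ContDiffBump (0 : E n) := ⟨1, 2, one_pos, one_lt_two⟩
  have hψ : ContDiff ℝ ∞ ψ := ψ.contDiff
  set e : E n := EuclideanSpace.single i 1 with he
  -- the cut-off functions and their derivatives
  let c : ℕ → E n → ℝ := fun j x => 1 - ψ (((j : ℝ) + 1) • x)
  have hc : ∀ j, ContDiff ℝ ∞ (c j) := fun j =>
    contDiff_const.sub (hψ.comp (contDiff_id.const_smul _))
  have hc' : ∀ j x, fderiv ℝ (c j) x e = -(((j : ℝ) + 1) * fderiv ℝ ψ (((j : ℝ) + 1) • x) e) := by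
    intro j x
    have hd : HasFDerivAt (fun y : E n => ((j : ℝ) + 1) • y)
      (((j : ℝ) + 1) • ContinuousLinearMap.id ℝ (E n)) x := (hasFDerivAt_id x).fun_const_smul _
    have := (((hψ.differentiable (by simp)) (((j : ℝ) + 1) • x)).hasFDerivAt.comp x hd).const_sub 1
    have h2 : fderiv ℝ (c j) x = _ := this.fderiv
    rw [h2]; simp
  have hη' : ∀ j x, fderiv ℝ (fun y => η y * c j y) x e
      = fderiv ℝ η x e * c j x + η x * fderiv ℝ (c j) x e := by
    intro j x
    rw [fderiv_fun_mul (h1.differentiable (by simp) x) ((hc j).differentiable (by simp) x)]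
    simp; ring
  have hcz : ∀ x : E n, x ≠ 0 → ∀ᶠ j : ℕ in atTop, 2 < ‖((j : ℝ) + 1) • x‖ := by
    intro x hx
    have : Tendsto (fun j : ℕ => ((j : ℝ) + 1) * ‖x‖) atTop atTop :=
      (tendsto_atTop_add_const_right _ _ tendsto_natCast_atTop_atTop).atTop_mul_const
        (norm_pos_iff.2 hx)
    filter_upwards [this.eventually_gt_atTop 2] with j hj
    rwa [norm_smul, Real.norm_of_nonneg (by positivity)]
  have hψ0 : ∀ y : E n, 2 < ‖y‖ → ψ =ᶠ[𝓝 y] 0 := fun y hy => by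
    filter_upwards [(isOpen_lt continuous_const continuous_norm).mem_nhds hy] with z hz
    refine ψ.zero_of_le_dist ?_
    simpa using (le_of_lt hz : (2 : ℝ) ≤ ‖z‖)
  obtain ⟨Cη, hCη⟩ := h1.continuous.bounded_above_of_compact_support h2
  have hη'c : Continuous fun x => fderiv ℝ η x e :=
    (h1.continuous_fderiv (by simp)).clm_apply continuous_const
  obtain ⟨Cη', hCη'⟩ := hη'c.bounded_above_of_compact_support (h2.fderiv_apply (𝕜 := ℝ) e)
  have hψ'c : Continuous fun x : E n => ‖x‖ * fderiv ℝ ψ x e :=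
    continuous_norm.mul ((hψ.continuous_fderiv (by simp)).clm_apply continuous_const)
  obtain ⟨Cψ, hCψ⟩ := hψ'c.bounded_above_of_compact_support
    ((ψ.hasCompactSupport.fderiv_apply (𝕜 := ℝ) e).mul_left)
  have hc1 : ∀ j x, ‖c j x‖ ≤ 1 := fun j x => by
    rw [Real.norm_eq_abs, abs_le]
    have a1 := ψ.nonneg (x := ((j : ℝ) + 1) • x)
    have a2 := ψ.le_one (x := ((j : ℝ) + 1) • x)
    constructor <;> simp only [c] <;> linarith
  have hc2 : ∀ j x, x ≠ 0 → ‖fderiv ℝ (c j) x e‖ ≤ Cψ * ‖x‖⁻¹ := fun j x hx => by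
    have := hCψ (((j : ℝ) + 1) • x)
    rw [hc', norm_neg, ← div_eq_mul_inv, le_div_iff₀ (norm_pos_iff.2 hx)]
    refine le_trans (le_of_eq ?_) this
    rw [norm_smul, norm_mul, norm_mul, norm_mul, norm_norm, norm_norm]; ring
  have hsupp : ∀ j, tsupport (fun y => η y * c j y) ⊆ tsupport η := fun j =>
    closure_mono (Function.support_mul_subset_left _ _)
  have hsuppd : ∀ j, tsupport (fun x => fderiv ℝ (fun y => η y * c j y) x e) ⊆ tsupport η :=
    fun j => (closure_minimal (fun x hx => by
      by_contra hx'
      refine hx ?_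
      have := notMem_tsupport_iff_eventuallyEq.1 (fun h => hx' (hsupp j h))
      simp [this.fderiv_eq]) (isClosed_tsupport _))
  have hsm : ∀ j, ContDiff ℝ ∞ (fun y => η y * c j y) := fun j => h1.mul (hc j)
  have hcs : ∀ j, HasCompactSupport (fun y => η y * c j y) := fun j => h2.mul_right
  -- away from the origin the classical integration by parts applies
  have key : ∀ j, ∫ x, (η x * c j x) • PolyEnergy.pd i f x ∂(ballMeasure n)
      = -∫ x, (fderiv ℝ (fun y => η y * c j y) x e) • f x ∂(ballMeasure n) := by
    intro j
    have s1 := (hsupp j).trans h3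
    have s2 := (hsuppd j).trans h3
    have hcc : Continuous fun x => fderiv ℝ (fun y => η y * c j y) x e :=
      ((hsm j).continuous_fderiv (by simp)).clm_apply continuous_const
    rw [integral_ball_eq s1, integral_ball_eq s2]
    refine integral_smul_fderiv_eq_neg_fderiv_smul_of_integrable
      (integrable_test_smul hcc ((hcs j).fderiv_apply (𝕜 := ℝ) e) s2 hfl)
      (integrable_test_smul (hsm j).continuous (hcs j) s1 hgl)
      (integrable_test_smul (hsm j).continuous (hcs j) s1 hfl)
      (fun x _ => (hsm j).differentiable (by simp) x) (fun x hx => ?_)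
    refine (hf.1 x ?_).differentiableAt (by simp)
    rintro rfl
    refine notMem_tsupport_iff_eventuallyEq.2 ?_ hx
    have hcont : Tendsto (fun y : E n => ((j : ℝ) + 1) • y) (𝓝 0) (𝓝 0) := by
      have : Continuous fun y : E n => ((j : ℝ) + 1) • y := by fun_prop
      simpa using this.tendsto 0
    filter_upwards [hcont.eventually ψ.eventuallyEq_one] with y hy
    simp only [Pi.one_apply] at hy
    simp [c, hy]
  have hne := ae_ball_ne_zero (by omega : 0 < n)
  have lim1 : Tendsto (fun j => ∫ x, (η x * c j x) • PolyEnergy.pd i f x ∂(ballMeasure n)) atTop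
      (𝓝 (∫ x, η x • PolyEnergy.pd i f x ∂(ballMeasure n))) := by
    refine tendsto_integral_of_dominated_convergence
      (fun x => Cη * ‖PolyEnergy.pd i f x‖) (fun j => ?_)
      (hgi.norm.const_mul _) (fun j => ?_) ?_
    · exact (hsm j).continuous.aestronglyMeasurable.smul hgi.1
    · refine Eventually.of_forall fun x => ?_
      rw [norm_smul, norm_mul]
      gcongr
      exact (mul_le_of_le_one_right (norm_nonneg _) (hc1 j x)).trans (hCη x)
    · filter_upwards [hne] with x hx
      refine tendsto_const_nhds.congr' ?_
      filter_upwards [hcz x hx.1] with j hj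
      simp [c, (hψ0 _ hj).self_of_nhds]
  have lim2 : Tendsto (fun j => ∫ x, (fderiv ℝ (fun y => η y * c j y) x e) • f x ∂(ballMeasure n))
      atTop (𝓝 (∫ x, (fderiv ℝ η x e) • f x ∂(ballMeasure n))) := by
    have hfk : Integrable (fun x => ‖x‖⁻¹ • f x) (ballMeasure n) :=
      (IsHom.inv_norm.smul hf).integrable (by omega)
    refine tendsto_integral_of_dominated_convergence
      (fun x => Cη' * ‖f x‖ + Cη * Cψ * ‖‖x‖⁻¹ • f x‖) (fun j => ?_)
      ((hfi.norm.const_mul _).add (hfk.norm.const_mul _)) (fun j => ?_) ?_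
    · exact (((hsm j).continuous_fderiv (by simp)).clm_apply
        continuous_const).aestronglyMeasurable.smul hfi.1
    · filter_upwards [hne] with x hx
      rw [hη', add_smul, norm_smul ‖x‖⁻¹, norm_inv, norm_norm]
      refine (norm_add_le _ _).trans ?_
      rw [norm_smul, norm_smul, norm_mul, norm_mul]
      refine add_le_add ?_ ?_
      · gcongr
        exact (mul_le_of_le_one_right (norm_nonneg _) (hc1 j x)).trans (hCη' x)
      · rw [← mul_assoc, mul_assoc Cη]
        gcongr
        · exact (norm_nonneg _).trans (hCη x)
        · exact hCη x
        · exact hc2 j x hx.1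
    · filter_upwards [hne] with x hx
      refine tendsto_const_nhds.congr' ?_
      filter_upwards [hcz x hx.1] with j hj
      rw [hη', hc', (hψ0 _ hj).fderiv_eq]
      simp [c, (hψ0 _ hj).self_of_nhds]
  have := tendsto_nhds_unique (lim1.congr key) lim2.neg
  rw [this, neg_neg]

lemma IsHom.weakDeriv_ae_eq {k : ℕ} (hf : IsHom k f) (hk : k + 1 < n) (i : Fin n) :
    weakDeriv i f =ᵐ[ballMeasure n] PolyEnergy.pd i f :=
  (hf.isWeakDeriv hk i).weakDeriv_ae_eq

lemma IsHom.memSobolev {r : ℕ} : ∀ {k : ℕ} {f : E n → E m}, IsHom k f → 2 * (k + r) < n →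
    MemSobolev r f := by
  induction r with
  | zero => exact fun hf hk => hf.memLp_two (by omega)
  | succ r ih =>
    exact fun hf hk => ⟨hf.memLp_two (by omega), fun i =>
      ⟨_, hf.isWeakDeriv (by omega) i, ih (hf.pd i) (by omega)⟩⟩

end Weak

/-! ### Smooth functions supported in an annulus -/

section Annulus

variable {n m : ℕ} {ρ₀ ρ₁ : ℝ}

/-- `f` is smooth and vanishes outside the annulus `ρ₀ ≤ |x| ≤ ρ₁`. -/
def IsAnnular {F : Type*} [NormedAddCommGroup F] [NormedSpace ℝ F] (ρ₀ ρ₁ : ℝ) (f : E n → F) :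
    Prop :=
  ContDiff ℝ ∞ f ∧ ∀ x, ‖x‖ ∉ Icc ρ₀ ρ₁ → f x = 0

lemma isOpen_annulus_compl (n : ℕ) (ρ₀ ρ₁ : ℝ) : IsOpen {x : E n | ‖x‖ ∉ Icc ρ₀ ρ₁} :=
  (isClosed_Icc.preimage continuous_norm).isOpen_compl

lemma IsAnnular.pd {f : E n → E m} (hf : IsAnnular ρ₀ ρ₁ f) (i : Fin n) :
    IsAnnular ρ₀ ρ₁ (pd i f) := by
  refine ⟨(hf.1.fderiv_right (by simp)).clm_apply contDiff_const, fun x hx => ?_⟩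
  have : f =ᶠ[𝓝 x] 0 := by
    filter_upwards [(isOpen_annulus_compl n ρ₀ ρ₁).mem_nhds hx] with y hy using hf.2 y hy
  simp [PolyEnergy.pd, this.fderiv_eq]

lemma IsAnnular.isHom {f : E n → E m} (h0 : 0 < ρ₀) (hf : IsAnnular ρ₀ ρ₁ f) (k : ℕ) :
    IsHom k f := by
  refine IsHom.of_eventually_zero (fun x _ => hf.1.contDiffAt) ?_ k
  filter_upwards [(isOpen_lt continuous_norm continuous_const).mem_nhds
    (by simpa using h0 : (0 : E n) ∈ {x : E n | ‖x‖ < ρ₀})] with x hx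
  exact hf.2 x fun h => absurd h.1 (not_le.2 hx)

lemma IsAnnular.weakDeriv_ae_eq {f : E n → E m} (h0 : 0 < ρ₀) (hn : 1 < n)
    (hf : IsAnnular ρ₀ ρ₁ f) (i : Fin n) : weakDeriv i f =ᵐ[ballMeasure n] PolyEnergy.pd i f :=
  (hf.isHom h0 0).weakDeriv_ae_eq hn i

lemma sobolevNorm_congr {k : ℕ} {f g : E n → E m} (h : f =ᵐ[ballMeasure n] g) :
    sobolevNorm k f = sobolevNorm k g := by
  cases k with
  | zero => exact eLpNorm_congr_ae h
  | succ k => simp only [sobolevNorm, eLpNorm_congr_ae h, weakDeriv_congr h]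

lemma weakDeriv_zero (hn : 1 < n) (i : Fin n) :
    weakDeriv i (0 : E n → E m) =ᵐ[ballMeasure n] 0 := by
  have : IsAnnular (1 / 2) (1 / 2) (0 : E n → E m) := ⟨contDiff_const, fun _ _ => rfl⟩
  refine (this.weakDeriv_ae_eq (by norm_num) hn i).trans (Eventually.of_forall fun x => ?_)
  simp [PolyEnergy.pd]

lemma sobolevNorm_zero (hn : 1 < n) (k : ℕ) : sobolevNorm k (0 : E n → E m) = 0 := by
  induction k with
  | zero => simp [sobolevNorm]
  | succ k ih => simp [sobolevNorm, sobolevNorm_congr (weakDeriv_zero hn _), ih]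

lemma IsAnnular.zeroTraces (h0 : 0 < ρ₀) (h1 : ρ₁ < 1) (hn : 1 < n) (r : ℕ) :
    ∀ {f u : E n → E m}, IsAnnular ρ₀ ρ₁ f → u =ᵐ[ballMeasure n] f → ZeroTraces r u := by
  induction r with
  | zero => exact fun _ _ => trivial
  | succ r ih =>
    intro f u hf hu
    refine ⟨⟨fun _ => f, fun _ => hf.1, ?_, ?_⟩, fun i => ih (hf.pd i) ?_⟩
    · have : f - u =ᵐ[ballMeasure n] 0 := hu.mono fun x hx => by simp [hx]
      simp [sobolevNorm_congr this, sobolevNorm_zero hn]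
    · have : ∀ y : Metric.sphere (0 : E n) 1, f y = 0 := fun y => hf.2 _ fun h => by
        have := h.2
        rw [mem_sphere_zero_iff_norm.1 y.2] at this
        linarith
      simp [this]
    · rw [weakDeriv_congr hu]
      exact hf.weakDeriv_ae_eq h0 hn i

end Annulus

/-! ### Smooth curves of maps -/

section Curve

variable {n m : ℕ} {ρ₀ ρ₁ : ℝ}

/-- The partial derivative in the curve parameter. -/
def pds (Ψ : ℝ × E n → E m) : ℝ × E n → E m := fun p => fderiv ℝ Ψ p (1, 0)

/-- The partial derivative in the `i`-th space variable, at fixed curve parameter. -/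
def pdx (i : Fin n) (Ψ : ℝ × E n → E m) : ℝ × E n → E m :=
  fun p => fderiv ℝ Ψ p (0, EuclideanSpace.single i 1)

/-- A smooth curve of functions which vanish outside the annulus `ρ₀ ≤ |x| ≤ ρ₁`. -/
def IsAnnularCurve (ρ₀ ρ₁ : ℝ) (Ψ : ℝ × E n → E m) : Prop :=
  ContDiff ℝ ∞ Ψ ∧ ∀ s x, ‖x‖ ∉ Icc ρ₀ ρ₁ → Ψ (s, x) = 0

lemma IsAnnularCurve.fderiv_apply {Ψ : ℝ × E n → E m} (h : IsAnnularCurve ρ₀ ρ₁ Ψ)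
    (v : ℝ × E n) : IsAnnularCurve ρ₀ ρ₁ (fun p => fderiv ℝ Ψ p v) := by
  refine ⟨(h.1.fderiv_right (by simp)).clm_apply contDiff_const, fun s x hx => ?_⟩
  have : Ψ =ᶠ[𝓝 (s, x)] 0 := by
    filter_upwards [((isOpen_annulus_compl n ρ₀ ρ₁).preimage continuous_snd).mem_nhds hx]
      with y hy using h.2 y.1 y.2 hy
  simp [this.fderiv_eq]

lemma IsAnnularCurve.slice {Ψ : ℝ × E n → E m} (h : IsAnnularCurve ρ₀ ρ₁ Ψ) (s : ℝ) :
    IsAnnular ρ₀ ρ₁ (fun x => Ψ (s, x)) :=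
  ⟨h.1.comp (contDiff_const.prodMk contDiff_id), fun x hx => h.2 s x hx⟩

lemma IsAnnularCurve.hasDerivAt {Ψ : ℝ × E n → E m} (h : IsAnnularCurve ρ₀ ρ₁ Ψ) (s : ℝ)
    (x : E n) : HasDerivAt (fun t => Ψ (t, x)) (pds Ψ (s, x)) s := by
  have h1 : HasDerivAt (fun t : ℝ => (t, x)) ((1 : ℝ), (0 : E n)) s :=
    (hasDerivAt_id s).prodMk (hasDerivAt_const s x)
  exact ((h.1.differentiable (by simp)) (s, x)).hasFDerivAt.comp_hasDerivAt s h1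

lemma IsAnnularCurve.pd_slice {Ψ : ℝ × E n → E m} (h : IsAnnularCurve ρ₀ ρ₁ Ψ) (s : ℝ)
    (x : E n) (i : Fin n) : pd i (fun y => Ψ (s, y)) x = pdx i Ψ (s, x) := by
  have h1 : HasFDerivAt (fun y : E n => (s, y)) (ContinuousLinearMap.inr ℝ ℝ (E n)) x :=
    hasFDerivAt_prodMk_right s x
  have h2 := ((h.1.differentiable (by simp)) (s, x)).hasFDerivAt.comp x h1
  have h3 : fderiv ℝ (fun y => Ψ (s, y)) x = _ := h2.fderiv
  rw [pd, h3]; rfl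

lemma fderiv_fderiv_comm {Ψ : ℝ × E n → E m} (h : ContDiff ℝ ∞ Ψ) (p v w : ℝ × E n) :
    fderiv ℝ (fun q => fderiv ℝ Ψ q v) p w = fderiv ℝ (fun q => fderiv ℝ Ψ q w) p v := by
  have hd : DifferentiableAt ℝ (fderiv ℝ Ψ) p :=
    ((h.fderiv_right (m := ∞) (by simp)).differentiable (by simp)) p
  have hs : IsSymmSndFDerivAt ℝ Ψ p := (contDiff_infty.1 h 2).contDiffAt.isSymmSndFDerivAt
    (by simp)
  have e : ∀ u z : ℝ × E n, fderiv ℝ (fun q => fderiv ℝ Ψ q u) p z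
      = fderiv ℝ (fderiv ℝ Ψ) p z u := fun u z => by
    rw [fderiv_clm_apply hd (differentiableAt_const u)]; simp
  rw [e, e, hs.eq]

/-- The error in the difference quotient of a curve. -/
def diffErr (Ψ : ℝ × E n → E m) (s t : ℝ) : E n → E m :=
  fun x => (t - s)⁻¹ • (Ψ (t, x) - Ψ (s, x)) - pds Ψ (s, x)

lemma IsAnnularCurve.diffErr_isAnnular {Ψ : ℝ × E n → E m} (h : IsAnnularCurve ρ₀ ρ₁ Ψ)
    (s t : ℝ) : IsAnnular ρ₀ ρ₁ (diffErr Ψ s t) := by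
  have a := h.slice t
  have b := h.slice s
  have c := (h.fderiv_apply (1, 0)).slice s
  refine ⟨((a.1.sub b.1).const_smul _).sub c.1, fun x hx => ?_⟩
  have := c.2 x hx
  simp only [diffErr, pds, a.2 x hx, b.2 x hx, this]; simp

lemma IsAnnularCurve.pd_diffErr {Ψ : ℝ × E n → E m} (h : IsAnnularCurve ρ₀ ρ₁ Ψ)
    (s t : ℝ) (i : Fin n) : pd i (diffErr Ψ s t) = diffErr (pdx i Ψ) s t := by
  funext x
  have a := h.slice t
  have b := h.slice s
  have c := (h.fderiv_apply (1, 0)).slice s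
  have da := (a.1.differentiable (by simp)) x
  have db := (b.1.differentiable (by simp)) x
  have dc := (c.1.differentiable (by simp)) x
  have e1 : pd i (diffErr Ψ s t) x
      = (t - s)⁻¹ • (pd i (fun y => Ψ (t, y)) x - pd i (fun y => Ψ (s, y)) x)
        - pd i (fun y => pds Ψ (s, y)) x := by
    have := (((da.hasFDerivAt.sub db.hasFDerivAt).const_smul (t - s)⁻¹).sub dc.hasFDerivAt).fderiv
    have h3 : fderiv ℝ (diffErr Ψ s t) x = _ := this
    simp only [pd, h3]; simp; rfl
  have e2 : pd i (fun y => pds Ψ (s, y)) x = pds (pdx i Ψ) (s, x) := by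
    have := (h.fderiv_apply (1, 0)).pd_slice s x i
    simp only [pds] at this ⊢
    rw [this]
    exact fderiv_fderiv_comm h.1 _ _ _
  rw [e1, e2, h.pd_slice, h.pd_slice]; rfl

lemma IsAnnularCurve.exists_diffErr_le {Ψ : ℝ × E n → E m} (h : IsAnnularCurve ρ₀ ρ₁ Ψ) (s : ℝ) :
    ∃ C, ∀ t, |t - s| ≤ 1 → t ≠ s → ∀ x, ‖diffErr Ψ s t x‖ ≤ C * |t - s| := by
  have h' : IsAnnularCurve ρ₀ ρ₁ (pds Ψ) := h.fderiv_apply (1, 0)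
  have h'' : IsAnnularCurve ρ₀ ρ₁ (pds (pds Ψ)) := h'.fderiv_apply (1, 0)
  obtain ⟨C, hC⟩ := (isCompact_Icc.prod
    (isCompact_closedBall (0 : E n) ρ₁)).exists_bound_of_continuousOn
    (s := Icc (s - 1) (s + 1) ×ˢ Metric.closedBall (0 : E n) ρ₁) h''.1.continuous.continuousOn
  refine ⟨max C 0, fun t ht hts x => ?_⟩
  have hC' : ∀ u ∈ Icc (s - 1) (s + 1), ‖pds (pds Ψ) (u, x)‖ ≤ max C 0 := by
    intro u hu
    by_cases hx : ‖x‖ ∈ Icc ρ₀ ρ₁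
    · exact (hC (u, x) ⟨hu, by simpa using hx.2⟩).trans (le_max_left _ _)
    · rw [h''.2 u x hx, norm_zero]; exact le_max_right _ _
  have hconv : Convex ℝ (uIcc s t) := convex_uIcc s t
  have hsub : uIcc s t ⊆ Icc (s - 1) (s + 1) := by
    rw [abs_le] at ht
    exact uIcc_subset_Icc ⟨by linarith, by linarith⟩ ⟨by linarith, by linarith⟩
  have b1 : ∀ u ∈ uIcc s t, ‖pds Ψ (u, x) - pds Ψ (s, x)‖ ≤ max C 0 * |t - s| := by
    intro u hu
    have := hconv.norm_image_sub_le_of_norm_hasDerivWithin_le (f := fun u => pds Ψ (u, x))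
      (f' := fun u => pds (pds Ψ) (u, x)) (fun v _ => (h'.hasDerivAt v x).hasDerivWithinAt)
      (fun v hv => hC' v (hsub hv)) left_mem_uIcc hu
    refine this.trans ?_
    exact mul_le_mul_of_nonneg_left (abs_sub_left_of_mem_uIcc hu) (le_max_right _ _)
  have b2 := hconv.norm_image_sub_le_of_norm_hasDerivWithin_le
    (f := fun u => Ψ (u, x) - u • pds Ψ (s, x)) (f' := fun u => pds Ψ (u, x) - pds Ψ (s, x))
    (fun v _ => ((h.hasDerivAt v x).sub (by
      simpa using (hasDerivAt_id v).smul_const (pds Ψ (s, x)))).hasDerivWithinAt)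
      b1 left_mem_uIcc right_mem_uIcc
  have hne : t - s ≠ 0 := sub_ne_zero.2 hts
  have e : diffErr Ψ s t x
      = (t - s)⁻¹ • ((Ψ (t, x) - t • pds Ψ (s, x)) - (Ψ (s, x) - s • pds Ψ (s, x))) := by
    have : pds Ψ (s, x) = (t - s)⁻¹ • ((t - s) • pds Ψ (s, x)) := by
      rw [smul_smul, inv_mul_cancel₀ hne, one_smul]
    rw [diffErr]
    nth_rewrite 1 [this]
    rw [← smul_sub]; congr 1; rw [sub_smul]; abel
  rw [e, norm_smul, norm_inv]
  rw [inv_mul_le_iff₀ (norm_pos_iff.2 hne)]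
  refine b2.trans (le_of_eq ?_)
  rw [Real.norm_eq_abs]; ring

/-- Difference quotients converge in every Sobolev norm: space derivatives commute with the passage
to the error term, so that the uniform bound applies to all of them. -/
lemma IsAnnularCurve.tendsto_sobolevNorm_diffErr (h0 : 0 < ρ₀) (hn : 1 < n) (s : ℝ) (r : ℕ) :
    ∀ {Ψ : ℝ × E n → E m}, IsAnnularCurve ρ₀ ρ₁ Ψ →
      Tendsto (fun t => sobolevNorm r (diffErr Ψ s t)) (𝓝[≠] s) (𝓝 0) := by
  have base : ∀ {Ψ : ℝ × E n → E m}, IsAnnularCurve ρ₀ ρ₁ Ψ →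
      Tendsto (fun t => eLpNorm (diffErr Ψ s t) 2 (ballMeasure n)) (𝓝[≠] s) (𝓝 0) := by
    intro Ψ h
    obtain ⟨C, hC⟩ := h.exists_diffErr_le s
    have hlim : Tendsto (fun t => ballMeasure n univ ^ (2 : ℝ≥0∞).toReal⁻¹ *
        ENNReal.ofReal (C * |t - s|)) (𝓝[≠] s) (𝓝 0) := by
      have h1 : Tendsto (fun t => C * |t - s|) (𝓝[≠] s) (𝓝 0) := by
        have : Continuous fun t => C * |t - s| := by fun_prop
        simpa using (this.tendsto s).mono_left nhdsWithin_le_nhds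
      have h2 := (ENNReal.continuous_ofReal.tendsto 0).comp h1
      rw [ENNReal.ofReal_zero] at h2
      have := ENNReal.Tendsto.const_mul (a := ballMeasure n univ ^ (2 : ℝ≥0∞).toReal⁻¹) h2
        (Or.inr (ENNReal.rpow_ne_top_of_nonneg (by simp) (measure_ne_top _ _)))
      simpa using this
    refine tendsto_of_tendsto_of_tendsto_of_le_of_le' tendsto_const_nhds hlim
      (Eventually.of_forall fun _ => zero_le) ?_
    have hev : ∀ᶠ t in 𝓝[≠] s, |t - s| ≤ 1 := by
      refine nhdsWithin_le_nhds ?_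
      filter_upwards [Metric.ball_mem_nhds s one_pos] with t ht
      rw [Metric.mem_ball, Real.dist_eq] at ht
      exact ht.le
    filter_upwards [hev, self_mem_nhdsWithin] with t ht hts
    exact eLpNorm_le_of_ae_bound (Eventually.of_forall fun x => hC t ht hts x)
  induction r with
  | zero => exact fun h => base h
  | succ r ih =>
    intro Ψ h
    have : ∀ t, sobolevNorm (r + 1) (diffErr Ψ s t) = eLpNorm (diffErr Ψ s t) 2 (ballMeasure n)
        + ∑ i, sobolevNorm r (diffErr (pdx i Ψ) s t) := fun t => by
      simp only [sobolevNorm]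
      congr 1
      refine Finset.sum_congr rfl fun i _ => ?_
      rw [sobolevNorm_congr ((h.diffErr_isAnnular s t).weakDeriv_ae_eq h0 hn i), h.pd_diffErr]
    simp only [this]
    have := (base h).add (tendsto_finsetSum Finset.univ fun i _ => ih (Ψ := pdx i Ψ)
      (h.fderiv_apply (0, EuclideanSpace.single i 1)))
    simpa using this

lemma IsAnnularCurve.iterate {Ψ : ℝ × E n → E m} (h : IsAnnularCurve ρ₀ ρ₁ Ψ) (k : ℕ) :
    IsAnnularCurve ρ₀ ρ₁ (pds^[k] Ψ) := by
  induction k with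
  | zero => exact h
  | succ k ih => rw [Function.iterate_succ_apply']; exact ih.fderiv_apply (1, 0)

/-- Sphere-valued maps that differ from `φ 0` by a smooth curve of functions supported in an annulus
form a smooth variation of `φ 0`. -/
lemma isVariation_of_annular {r : ℕ} {φ : ℝ → E n → E (n + 1)} (h0 : 0 < ρ₀) (h1 : ρ₁ < 1)
    (hn : 1 < n) (hr : 2 * r < n) (hφ : IsHom 0 (φ 0))
    (hΨ : IsAnnularCurve ρ₀ ρ₁ (fun p : ℝ × E n => φ p.1 p.2 - φ 0 p.2))
    (hS : ∀ s, ∀ x ≠ 0, φ s x ∈ Metric.sphere (0 : E (n + 1)) 1) :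
    IsVariation r (φ 0) 1 φ := by
  set Ψ : ℝ × E n → E (n + 1) := fun p => φ p.1 p.2 - φ 0 p.2 with hΨdef
  have hsl : ∀ s, IsAnnular ρ₀ ρ₁ (φ s - φ 0) := fun s => hΨ.slice s
  have hhom : ∀ s, IsHom 0 (φ s) := fun s => by
    have := hφ.add ((hsl s).isHom h0 0)
    simpa using this
  refine ⟨one_pos, .rfl, fun s _ => ⟨⟨(hhom s).memSobolev (by omega), ?_⟩,
    (hsl s).zeroTraces h0 h1 hn r .rfl⟩, ?_⟩
  · filter_upwards [ae_ball_ne_zero (by omega : 0 < n)] with x hx using hS s x hx.1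
  · refine ⟨fun k => if k = 0 then φ else fun s x => pds^[k] Ψ (s, x), by simp,
      fun k s hs => ⟨?_, ?_⟩⟩
    · by_cases hk : k = 0
      · simpa [hk] using (hhom s).memSobolev (by omega)
      · simpa [hk] using (((hΨ.iterate k).slice s).isHom h0 0).memSobolev (by omega)
    · have := ((hΨ.iterate k).tendsto_sobolevNorm_diffErr h0 hn s r).mono_left
        (nhdsWithin_mono s (fun t ht => ht.2) : 𝓝[Ico 0 1 \ {s}] s ≤ 𝓝[≠] s)
      refine this.congr fun t => ?_
      congr 1
      funext x
      have e : pds^[k + 1] Ψ (s, x) = pds (pds^[k] Ψ) (s, x) := by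
        rw [Function.iterate_succ_apply']
      by_cases hk : k = 0
      · subst hk
        simp [diffErr, hΨdef]
      · simp [diffErr, hk, ← e]

end Curve

/-! ### Radial frames -/

section Frame

variable {n : ℕ}

/-- The inclusion `ℝⁿ → ℝⁿ × ℝ = ℝⁿ⁺¹`. -/
def incl (n : ℕ) : E n →L[ℝ] E (n + 1) :=
  LinearMap.toContinuousLinearMap
    { toFun := fun v => WithLp.toLp 2 (Fin.snoc (α := fun _ => ℝ) (fun i => v i) 0)
      map_add' := fun v w => by
        ext i; refine Fin.lastCases ?_ (fun j => ?_) i <;> simp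
      map_smul' := fun c v => by
        ext i; refine Fin.lastCases ?_ (fun j => ?_) i <;> simp }

lemma incl_castSucc (v : E n) (i : Fin n) : incl n v i.castSucc = v i := by
  simp [incl]

lemma incl_last (v : E n) : incl n v (Fin.last n) = 0 := by
  simp [incl]

/-- The north pole `(0, 1)`. -/
def pole (n : ℕ) : E (n + 1) := EuclideanSpace.single (Fin.last n) 1

lemma inner_incl (v w : E n) : inner ℝ (incl n v) (incl n w) = inner ℝ v w := by
  simp [PiLp.inner_apply, Fin.sum_univ_castSucc, incl_castSucc, incl_last]

lemma inner_incl_pole (v : E n) : inner ℝ (incl n v) (pole n) = 0 := by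
  simp [pole, EuclideanSpace.inner_single_right, incl_last]

lemma inner_pole_incl (v : E n) : inner ℝ (pole n) (incl n v) = 0 := by
  rw [real_inner_comm, inner_incl_pole]

lemma inner_pole_pole : inner ℝ (pole n) (pole n) = (1 : ℝ) := by
  simp [pole]

/-- `log |x|`, the radial variable in which homogeneous functions are exponentials. -/
def ell (x : E n) : ℝ := Real.log ‖x‖

/-- The components `xᵢ / |x|`. -/
def yc (i : Fin n) (x : E n) : ℝ := ‖x‖⁻¹ * x i

/-- The field `x / |x|`, in `ℝⁿ⁺¹`. -/
def Yv (x : E n) : E (n + 1) := incl n (‖x‖⁻¹ • x)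

/-- The part of the coordinate field `eᵢ` orthogonal to the radial direction, in `ℝⁿ⁺¹`. -/
def tv (i : Fin n) (x : E n) : E (n + 1) := incl n (EuclideanSpace.single i 1) - yc i x • Yv x

/-- The rotationally symmetric map with latitude `θ (log |x|)`. -/
def symMap (θ : ℝ → ℝ) (x : E n) : E (n + 1) :=
  Real.sin (θ (ell x)) • Yv x + Real.cos (θ (ell x)) • pole n

/-- The unit tangent field along `symMap θ` in the direction of increasing latitude. -/
def nu (θ : ℝ → ℝ) (x : E n) : E (n + 1) :=
  Real.cos (θ (ell x)) • Yv x - Real.sin (θ (ell x)) • pole n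

/-- The Kronecker symbol. -/
def krd (i j : Fin n) : ℝ := if i = j then 1 else 0

lemma exp_neg_ell {x : E n} (hx : x ≠ 0) : Real.exp (-ell x) = ‖x‖⁻¹ := by
  rw [Real.exp_neg, ell, Real.exp_log (norm_pos_iff.2 hx)]

lemma sum_yc_sq {x : E n} (hx : x ≠ 0) : ∑ i, yc i x * yc i x = 1 := by
  have h : ‖x‖ ^ 2 = ∑ i, x i * x i := by
    rw [EuclideanSpace.norm_sq_eq]
    exact Finset.sum_congr rfl fun i _ => by rw [Real.norm_eq_abs, sq_abs, sq]
  have h0 : ‖x‖ ≠ 0 := norm_ne_zero_iff.2 hx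
  calc ∑ i, yc i x * yc i x = (‖x‖ ^ 2)⁻¹ * ∑ i, x i * x i := by
        rw [Finset.mul_sum]
        exact Finset.sum_congr rfl fun i _ => by simp only [yc]; field_simp
    _ = 1 := by rw [← h]; field_simp

lemma sum_yc_smul_incl (x : E n) :
    ∑ i, yc i x • incl n (EuclideanSpace.single i 1) = Yv x := by
  simp only [← map_smul, ← map_sum, Yv]
  congr 1
  ext j
  simp [yc, Pi.single_apply]

lemma sum_yc_smul_tv {x : E n} (hx : x ≠ 0) : ∑ i, yc i x • tv i x = 0 := by
  simp only [tv, smul_sub, Finset.sum_sub_distrib, sum_yc_smul_incl, smul_smul, ← Finset.sum_smul,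
    sum_yc_sq hx, one_smul, sub_self]

lemma inner_Yv_Yv {x : E n} (hx : x ≠ 0) : inner ℝ (Yv x) (Yv x) = (1 : ℝ) := by
  have h0 : ‖x‖ ≠ 0 := norm_ne_zero_iff.2 hx
  rw [Yv, inner_incl, real_inner_self_eq_norm_sq, norm_smul, norm_inv, norm_norm,
    inv_mul_cancel₀ h0, one_pow]

lemma inner_Yv_incl (x : E n) (i : Fin n) :
    inner ℝ (Yv x) (incl n (EuclideanSpace.single i 1)) = yc i x := by
  rw [Yv, inner_incl, EuclideanSpace.inner_single_right]; simp [yc]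

lemma inner_Yv_tv {x : E n} (hx : x ≠ 0) (i : Fin n) : inner ℝ (Yv x) (tv i x) = 0 := by
  rw [tv, inner_sub_right, inner_smul_right, inner_Yv_Yv hx, inner_Yv_incl]; ring

lemma inner_pole_Yv (x : E n) : inner ℝ (pole n) (Yv x) = 0 := inner_pole_incl _

lemma inner_Yv_pole (x : E n) : inner ℝ (Yv x) (pole n) = 0 := inner_incl_pole _

lemma inner_pole_tv (x : E n) (i : Fin n) : inner ℝ (pole n) (tv i x) = 0 := by
  rw [tv, inner_sub_right, inner_smul_right, inner_pole_Yv, inner_pole_incl]; ring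

lemma inner_tv_tv {x : E n} (hx : x ≠ 0) (i j : Fin n) :
    inner ℝ (tv i x) (tv j x) = krd i j - yc i x * yc j x := by
  have h1 : inner ℝ (tv i x) (tv j x) = inner ℝ (incl n (EuclideanSpace.single i 1)) (tv j x) := by
    rw [tv, inner_sub_left, inner_smul_left, inner_Yv_tv hx]; simp
  rw [h1, tv, inner_sub_right, inner_smul_right, inner_incl, EuclideanSpace.inner_single_left,
    real_inner_comm, inner_Yv_incl]
  simp [krd]; ring

lemma symMap_inner_self {x : E n} (hx : x ≠ 0) (θ : ℝ → ℝ) :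
    inner ℝ (symMap θ x) (symMap θ x) = (1 : ℝ) := by
  have := Real.sin_sq_add_cos_sq (θ (ell x))
  simp only [symMap, inner_add_left, inner_add_right, real_inner_smul_left, real_inner_smul_right,
    inner_Yv_Yv hx, inner_pole_Yv, inner_pole_pole, inner_Yv_pole]
  linarith

lemma symMap_mem_sphere {x : E n} (hx : x ≠ 0) (θ : ℝ → ℝ) :
    symMap θ x ∈ Metric.sphere (0 : E (n + 1)) 1 := by
  have h := symMap_inner_self hx θ
  rw [real_inner_self_eq_norm_sq] at h
  rw [mem_sphere_zero_iff_norm]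
  nlinarith [norm_nonneg (symMap θ x)]

/-! ### Tangential projection of the frame -/

lemma tanProj_add {m : ℕ} (y v w : E m) : tanProj y (v + w) = tanProj y v + tanProj y w := by
  simp only [tanProj, inner_add_right]; module

lemma tanProj_sub {m : ℕ} (y v w : E m) : tanProj y (v - w) = tanProj y v - tanProj y w := by
  simp only [tanProj, inner_sub_right]; module

lemma tanProj_smul {m : ℕ} (y v : E m) (c : ℝ) : tanProj y (c • v) = c • tanProj y v := by
  simp only [tanProj, inner_smul_right]; module

lemma tanProj_symMap {x : E n} (hx : x ≠ 0) (θ : ℝ → ℝ) :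
    tanProj (symMap θ x) (symMap θ x) = 0 := by
  rw [tanProj, symMap_inner_self hx, one_smul, sub_self]

lemma tanProj_Yv {x : E n} (hx : x ≠ 0) (θ : ℝ → ℝ) :
    tanProj (symMap θ x) (Yv x) = Real.cos (θ (ell x)) • nu θ x := by
  have h : inner ℝ (symMap θ x) (Yv x) = Real.sin (θ (ell x)) := by
    simp only [symMap, inner_add_left, real_inner_smul_left, inner_Yv_Yv hx, inner_pole_Yv]; ring
  rw [tanProj, h, symMap, nu]
  have h1 : Yv x = (Real.sin (θ (ell x)) ^ 2 + Real.cos (θ (ell x)) ^ 2) • Yv x := by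
    rw [Real.sin_sq_add_cos_sq, one_smul]
  nth_rewrite 1 [h1]
  module

lemma tanProj_nu {x : E n} (hx : x ≠ 0) (θ : ℝ → ℝ) :
    tanProj (symMap θ x) (nu θ x) = nu θ x := by
  have h : inner ℝ (symMap θ x) (nu θ x) = 0 := by
    simp only [symMap, nu, inner_add_left, inner_sub_right, real_inner_smul_left,
      real_inner_smul_right, inner_Yv_Yv hx, inner_pole_Yv, inner_pole_pole,
      inner_Yv_pole]; ring
  rw [tanProj, h, zero_smul, sub_zero]

lemma tanProj_tv {x : E n} (hx : x ≠ 0) (θ : ℝ → ℝ) (i : Fin n) :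
    tanProj (symMap θ x) (tv i x) = tv i x := by
  have h : inner ℝ (symMap θ x) (tv i x) = 0 := by
    simp only [symMap, inner_add_left, real_inner_smul_left, inner_Yv_tv hx, inner_pole_tv]; ring
  rw [tanProj, h, zero_smul, sub_zero]

/-! ### Derivatives of the frame -/

/-- `f` is differentiable at `x`, with `∂f/∂xᵢ = f'` there. -/
def HasPD {F : Type*} [NormedAddCommGroup F] [NormedSpace ℝ F] (i : Fin n) (f : E n → F) (f' : F)
    (x : E n) : Prop :=
  DifferentiableAt ℝ f x ∧ pd i f x = f'

section HasPD

variable {F : Type*} [NormedAddCommGroup F] [NormedSpace ℝ F] {i : Fin n} {x : E n} {f g : E n → F}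
  {f' g' : F}

lemma HasFDerivAt.hasPD {L : E n →L[ℝ] F} (h : HasFDerivAt f L x) :
    HasPD i f (L (EuclideanSpace.single i 1)) x :=
  ⟨h.differentiableAt, by rw [pd, h.fderiv]⟩

lemma HasPD.congr (h : HasPD i f f' x) (e : f' = g') : HasPD i f g' x := e ▸ h

lemma HasPD.add (hf : HasPD i f f' x) (hg : HasPD i g g' x) :
    HasPD i (fun y => f y + g y) (f' + g') x :=
  ⟨hf.1.add hg.1, by rw [pd, fderiv_fun_add hf.1 hg.1, ← hf.2, ← hg.2]; rfl⟩

lemma HasPD.sub (hf : HasPD i f f' x) (hg : HasPD i g g' x) :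
    HasPD i (fun y => f y - g y) (f' - g') x :=
  ⟨hf.1.sub hg.1, by rw [pd, fderiv_fun_sub hf.1 hg.1, ← hf.2, ← hg.2]; rfl⟩

lemma HasPD.smul {c : E n → ℝ} {c' : ℝ} (hc : HasPD i c c' x) (hf : HasPD i f f' x) :
    HasPD i (fun y => c y • f y) (c x • f' + c' • f x) x :=
  ⟨hc.1.smul hf.1, by rw [pd, fderiv_fun_smul hc.1 hf.1, ← hf.2, ← hc.2]; rfl⟩

lemma HasPD.const (v : F) : HasPD i (fun _ => v) 0 x :=
  ⟨differentiableAt_const _, by simp [pd]⟩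

lemma hasPD_ell (hx : x ≠ 0) : HasPD i ell (Real.exp (-ell x) * yc i x) x := by
  have h1 := (hasStrictFDerivAt_norm_sq x).hasFDerivAt
  have h2 := h1.log (by simpa using hx)
  have h3 : HasPD i (fun y : E n => (1 / 2 : ℝ) • Real.log (‖y‖ ^ 2)) _ x :=
    (HasPD.const (1 / 2 : ℝ)).smul (HasFDerivAt.hasPD (i := i) h2)
  have e : (fun y : E n => (1 / 2 : ℝ) • Real.log (‖y‖ ^ 2)) = ell := by
    funext y; simp [ell, Real.log_pow]
  rw [e] at h3
  refine h3.congr ?_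
  have h0 : ‖x‖ ≠ 0 := norm_ne_zero_iff.2 hx
  rw [exp_neg_ell hx, yc]
  simp [EuclideanSpace.inner_single_right]
  field_simp

lemma HasPD.comp_ell {c : ℝ → ℝ} (hc : Differentiable ℝ c) (hx : x ≠ 0) :
    HasPD i (fun y => c (ell y)) (deriv c (ell x) * (Real.exp (-ell x) * yc i x)) x := by
  have h := hasPD_ell (i := i) hx
  have h1 := (hc (ell x)).hasDerivAt.comp_hasFDerivAt x h.1.hasFDerivAt
  refine (HasFDerivAt.hasPD (i := i) h1).congr ?_
  rw [← h.2]; rfl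

lemma hasPD_inv_norm (hx : x ≠ 0) :
    HasPD i (fun y : E n => ‖y‖⁻¹) (-(‖x‖⁻¹ * (‖x‖⁻¹ * yc i x))) x := by
  have h : HasPD i (fun y : E n => Real.exp (-ell y)) _ x :=
    HasPD.comp_ell (c := fun t => Real.exp (-t)) (by fun_prop) hx
  have hev : (fun y : E n => Real.exp (-ell y)) =ᶠ[𝓝 x] fun y => ‖y‖⁻¹ := by
    filter_upwards [isOpen_ne.mem_nhds hx] with y hy using exp_neg_ell hy
  refine ⟨hev.differentiableAt_iff.1 h.1, ?_⟩
  rw [pd, ← hev.fderiv_eq, ← pd, h.2]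
  have : deriv (fun t : ℝ => Real.exp (-t)) (ell x) = -Real.exp (-ell x) := by
    simpa using (hasDerivAt_neg (ell x)).exp.deriv
  rw [this, exp_neg_ell hx]; ring

lemma hasPD_yc (hx : x ≠ 0) (j : Fin n) :
    HasPD i (yc j) (Real.exp (-ell x) * (krd i j - yc i x * yc j x)) x := by
  have h1 : HasPD i (fun y : E n => y j) (krd i j) x := by
    have := HasFDerivAt.hasPD (i := i)
      (EuclideanSpace.proj (𝕜 := ℝ) j : E n →L[ℝ] ℝ).hasFDerivAt (x := x)
    refine this.congr ?_
    simp [krd, eq_comm]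
  refine ((hasPD_inv_norm hx).smul h1).congr ?_
  rw [exp_neg_ell hx, yc, yc]
  simp only [smul_eq_mul]; ring

lemma hasPD_Yv (hx : x ≠ 0) : HasPD i Yv (Real.exp (-ell x) • tv i x) x := by
  have h1 : HasPD i (fun y : E n => incl n y) (incl n (EuclideanSpace.single i 1)) x :=
    HasFDerivAt.hasPD (incl n).hasFDerivAt
  have h2 : HasPD i (fun y : E n => ‖y‖⁻¹ • incl n y) _ x := (hasPD_inv_norm hx).smul h1
  have e : (fun y : E n => ‖y‖⁻¹ • incl n y) = Yv := by funext y; simp [Yv]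
  rw [e] at h2
  refine h2.congr ?_
  rw [exp_neg_ell hx, tv, Yv, map_smul]; module

lemma hasPD_tv (hx : x ≠ 0) (j : Fin n) :
    HasPD i (tv j) (-Real.exp (-ell x) • ((krd i j - yc i x * yc j x) • Yv x + yc j x • tv i x))
      x := by
  refine ((HasPD.const (incl n (EuclideanSpace.single j 1))).sub
    ((hasPD_yc hx j).smul (hasPD_Yv hx))).congr ?_
  module

lemma hasPD_nu {θ : ℝ → ℝ} (hθ : Differentiable ℝ θ) (hx : x ≠ 0) :
    HasPD i (nu θ) (Real.exp (-ell x) • (Real.cos (θ (ell x)) • tv i x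
      - (deriv θ (ell x) * yc i x) • symMap θ x)) x := by
  have h1 : HasPD i (fun y : E n => Real.cos (θ (ell y))) _ x :=
    HasPD.comp_ell (c := fun t => Real.cos (θ t)) (by fun_prop) hx
  have h2 : HasPD i (fun y : E n => Real.sin (θ (ell y))) _ x :=
    HasPD.comp_ell (c := fun t => Real.sin (θ t)) (by fun_prop) hx
  refine ((h1.smul (hasPD_Yv hx)).sub (h2.smul (HasPD.const (pole n)))).congr ?_
  rw [(hθ (ell x)).hasDerivAt.cos.deriv, (hθ (ell x)).hasDerivAt.sin.deriv, symMap]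
  module

lemma hasPD_symMap {θ : ℝ → ℝ} (hθ : Differentiable ℝ θ) (hx : x ≠ 0) :
    HasPD i (symMap θ) (Real.exp (-ell x) • (Real.sin (θ (ell x)) • tv i x
      + (deriv θ (ell x) * yc i x) • nu θ x)) x := by
  have h1 : HasPD i (fun y : E n => Real.cos (θ (ell y))) _ x :=
    HasPD.comp_ell (c := fun t => Real.cos (θ t)) (by fun_prop) hx
  have h2 : HasPD i (fun y : E n => Real.sin (θ (ell y))) _ x :=
    HasPD.comp_ell (c := fun t => Real.sin (θ t)) (by fun_prop) hx
  refine ((h2.smul (hasPD_Yv hx)).add (h1.smul (HasPD.const (pole n)))).congr ?_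
  rw [(hθ (ell x)).hasDerivAt.cos.deriv, (hθ (ell x)).hasDerivAt.sin.deriv, nu]
  module

end HasPD

/-! ### Radial profiles -/

/-- A profile of order `k`: a smooth function of `t = log |x|` which is a multiple of `e^{-kt}` for
`t` near `-∞`. -/
def IsPow (k : ℕ) (c : ℝ → ℝ) : Prop :=
  ContDiff ℝ ∞ c ∧ ∃ T b, ∀ t < T, c t = b * Real.exp (-(k * t))

lemma contDiffAt_ell {x : E n} (hx : x ≠ 0) : ContDiffAt ℝ ∞ (ell : E n → ℝ) x :=
  (contDiffAt_norm ℝ hx).log (norm_ne_zero_iff.2 hx)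

lemma IsPow.isHom {k : ℕ} {c : ℝ → ℝ} (hc : IsPow k c) : IsHom k (fun x : E n => c (ell x)) := by
  obtain ⟨h1, T, b, h2⟩ := hc
  refine ⟨fun x hx => h1.contDiffAt.comp x (contDiffAt_ell hx), Real.exp T, Real.exp_pos _,
    fun x hx hxd t ht ht1 => ?_⟩
  have hx0 : 0 < ‖x‖ := norm_pos_iff.2 hx
  have e1 : ell x < T := (Real.log_lt_iff_lt_exp hx0).2 hxd
  have e2 : ell (t • x) = Real.log t + ell x := by
    rw [ell, norm_smul, Real.norm_of_nonneg ht.le, Real.log_mul ht.ne' hx0.ne', ell]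
  have e3 : Real.log t ≤ 0 := Real.log_nonpos ht.le ht1
  have e4 : Real.exp (-(k * Real.log t)) = (t ^ k)⁻¹ := by
    rw [Real.exp_neg, mul_comm, ← Real.rpow_def_of_pos ht, Real.rpow_natCast]
  simp only [e2]
  rw [h2 _ e1, h2 _ (by linarith), mul_add, neg_add, Real.exp_add, e4, smul_eq_mul]
  field_simp

lemma IsHom.yc (i : Fin n) : IsHom 0 (yc i) := by
  refine ⟨fun x hx => ?_, 1, one_pos, fun x hx _ t ht _ => ?_⟩
  · exact (((contDiffAt_norm ℝ hx).inv (norm_ne_zero_iff.2 hx))).mul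
      (EuclideanSpace.proj (𝕜 := ℝ) i : E n →L[ℝ] ℝ).contDiff.contDiffAt
  · simp [PolyEnergy.yc, norm_smul, abs_of_pos ht]; field_simp

lemma IsHom.Yv : IsHom 0 (Yv : E n → E (n + 1)) := by
  refine ⟨fun x hx => ?_, 1, one_pos, fun x hx _ t ht _ => ?_⟩
  · exact (incl n).contDiff.contDiffAt.comp x
      (((contDiffAt_norm ℝ hx).inv (norm_ne_zero_iff.2 hx)).smul contDiffAt_id)
  · simp only [PolyEnergy.Yv, norm_smul, Real.norm_of_nonneg ht.le, smul_smul, pow_zero, one_smul]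
    congr 2; field_simp

lemma IsHom.tv (i : Fin n) : IsHom 0 (tv i) :=
  (IsHom.const _).sub ((IsHom.yc i).smul IsHom.Yv)

lemma IsPow.comp {θ : ℝ → ℝ} (hθ : IsPow 0 θ) {g : ℝ → ℝ} (hg : ContDiff ℝ ∞ g) :
    IsPow 0 (fun t => g (θ t)) := by
  obtain ⟨h1, T, b, h2⟩ := hθ
  exact ⟨hg.comp h1, T, g b, fun t ht => by simp [h2 t ht]⟩

lemma IsHom.nu {θ : ℝ → ℝ} (hθ : IsPow 0 θ) : IsHom 0 (nu θ : E n → E (n + 1)) :=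
  ((hθ.comp Real.contDiff_cos).isHom.smul IsHom.Yv).sub
    ((hθ.comp Real.contDiff_sin).isHom.smul (IsHom.const _))

lemma IsHom.symMap {θ : ℝ → ℝ} (hθ : IsPow 0 θ) : IsHom 0 (symMap θ : E n → E (n + 1)) :=
  ((hθ.comp Real.contDiff_sin).isHom.smul IsHom.Yv).add
    ((hθ.comp Real.contDiff_cos).isHom.smul (IsHom.const _))

end Frame

/-! ### The covariant calculus of rotationally symmetric forms -/

section Forms

variable {n : ℕ} {θ F p q w : ℝ → ℝ} {k : ℕ}

/-- The rotationally symmetric section `F ν`. -/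
def form0 (θ F : ℝ → ℝ) (x : E n) : E (n + 1) := F (ell x) • nu θ x

/-- The rotationally symmetric `1`-form with radial part `p ν` and spherical part `q`. -/
def form1 (θ p q : ℝ → ℝ) (j : Fin n) (x : E n) : E (n + 1) :=
  p (ell x) • (yc j x • nu θ x) + q (ell x) • tv j x

/-- The rotationally symmetric `2`-form, with radial-spherical components only. -/
def form2 (w : ℝ → ℝ) (j l : Fin n) (x : E n) : E (n + 1) :=
  w (ell x) • (yc j x • tv l x - yc l x • tv j x)

lemma IsPow.isHom_form0 (hθ : IsPow 0 θ) (hF : IsPow k F) :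
    IsHom k (form0 θ F : E n → E (n + 1)) := hF.isHom.smul (IsHom.nu hθ)

lemma IsPow.isHom_form1 (hθ : IsPow 0 θ) (hp : IsPow k p) (hq : IsPow k q) (j : Fin n) :
    IsHom k (form1 θ p q j) :=
  (hp.isHom.smul ((IsHom.yc j).smul (IsHom.nu hθ))).add (hq.isHom.smul (IsHom.tv j))

lemma IsPow.isHom_form2 (hw : IsPow k w) (j l : Fin n) : IsHom k (form2 w j l) :=
  hw.isHom.smul (((IsHom.yc j).smul (IsHom.tv l)).sub ((IsHom.yc l).smul (IsHom.tv j)))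

lemma IsPow.differentiable (hF : IsPow k F) : Differentiable ℝ F := hF.1.differentiable (by simp)

lemma IsHom.cov_ae_eq {V V' : E n → E (n + 1)} {φ : E n → E (n + 1)} {i : Fin n} (hV : IsHom k V)
    (hk : k + 1 < n) (h : ∀ x ≠ 0, HasPD i V (V' x) x) :
    cov φ i V =ᵐ[ballMeasure n] fun x => tanProj (φ x) (V' x) := by
  filter_upwards [hV.weakDeriv_ae_eq hk i, ae_ball_ne_zero (by omega : 0 < n)] with x h1 h2
  rw [cov, h1, (h x h2.1).2]

lemma cov_congr {φ V V' : E n → E (n + 1)} {i : Fin n} (h : V =ᵐ[ballMeasure n] V') :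
    cov φ i V = cov φ i V' := by
  unfold cov; rw [weakDeriv_congr h]

lemma weakDeriv_symMap (hθ : IsPow 0 θ) (hn : 1 < n) (i : Fin n) :
    weakDeriv i (symMap θ : E n → E (n + 1)) =ᵐ[ballMeasure n]
      form1 θ (fun t => Real.exp (-t) * deriv θ t) (fun t => Real.exp (-t) * Real.sin (θ t)) i := by
  filter_upwards [(IsHom.symMap hθ).weakDeriv_ae_eq hn i, ae_ball_ne_zero (by omega : 0 < n)]
    with x h1 h2
  rw [h1, (hasPD_symMap hθ.differentiable h2.1).2, form1]
  module

lemma cov_form0 (hθ : IsPow 0 θ) (hF : IsPow k F) (hk : k + 1 < n) (i : Fin n) :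
    cov (symMap θ) i (form0 θ F) =ᵐ[ballMeasure n]
      form1 θ (fun t => Real.exp (-t) * deriv F t)
        (fun t => Real.exp (-t) * (F t * Real.cos (θ t))) i := by
  filter_upwards [(hθ.isHom_form0 hF).cov_ae_eq (φ := symMap θ) hk (fun x hx =>
    (HasPD.comp_ell hF.differentiable hx).smul (hasPD_nu hθ.differentiable hx)),
    ae_ball_ne_zero (by omega : 0 < n)] with x h1 h2
  rw [h1]
  simp only [tanProj_add, tanProj_sub, tanProj_smul, tanProj_symMap h2.1, tanProj_nu h2.1,
    tanProj_tv h2.1, form1]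
  module

lemma cov_form1 (hθ : IsPow 0 θ) (hp : IsPow k p) (hq : IsPow k q) (hk : k + 1 < n) (i j : Fin n) :
    cov (symMap θ) i (form1 θ p q j) =ᵐ[ballMeasure n] fun x =>
      (Real.exp (-ell x) * (deriv p (ell x) * yc i x * yc j x
        + (p (ell x) - q (ell x) * Real.cos (θ (ell x))) * (krd i j - yc i x * yc j x))) • nu θ x
      + (Real.exp (-ell x) * (p (ell x) * Real.cos (θ (ell x)) - q (ell x))) • (yc j x • tv i x)
      + (Real.exp (-ell x) * deriv q (ell x)) • (yc i x • tv j x) := by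
  filter_upwards [(hθ.isHom_form1 hp hq j).cov_ae_eq (φ := symMap θ) hk (fun x hx =>
    ((HasPD.comp_ell hp.differentiable hx).smul
      ((hasPD_yc hx j).smul (hasPD_nu hθ.differentiable hx))).add
    ((HasPD.comp_ell hq.differentiable hx).smul (hasPD_tv hx j))),
    ae_ball_ne_zero (by omega : 0 < n)] with x h1 h2
  rw [h1]
  simp only [tanProj_add, tanProj_sub, tanProj_smul, tanProj_symMap h2.1, tanProj_nu h2.1,
    tanProj_tv h2.1, tanProj_Yv h2.1]
  module

lemma cov_form2 (hw : IsPow k w) (hk : k + 1 < n) (i j l : Fin n) :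
    cov (symMap θ) i (form2 w j l) =ᵐ[ballMeasure n] fun x =>
      (Real.exp (-ell x) * deriv w (ell x) * yc i x) • (yc j x • tv l x - yc l x • tv j x)
      + (Real.exp (-ell x) * w (ell x)) • ((krd i j - yc i x * yc j x) • tv l x
        - (krd i l - yc i x * yc l x) • tv j x
        + ((yc l x * krd i j - yc j x * krd i l) * Real.cos (θ (ell x))) • nu θ x) := by
  filter_upwards [(hw.isHom_form2 j l).cov_ae_eq (φ := symMap θ) hk (fun x hx =>
    (HasPD.comp_ell hw.differentiable hx).smul
      (((hasPD_yc hx j).smul (hasPD_tv hx l)).sub ((hasPD_yc hx l).smul (hasPD_tv hx j)))),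
    ae_ball_ne_zero (by omega : 0 < n)] with x h1 h2
  rw [h1]
  simp only [tanProj_add, tanProj_sub, tanProj_smul, tanProj_tv h2.1, tanProj_Yv h2.1]
  module

lemma cov_zero (hn : 1 < n) (i : Fin n) (φ : E n → E (n + 1)) :
    cov φ i 0 =ᵐ[ballMeasure n] 0 := by
  filter_upwards [weakDeriv_zero (m := n + 1) hn i] with x hx
  simp [cov, hx, tanProj]

lemma krd_self (i : Fin n) : krd i i = 1 := by simp [krd]

lemma krd_comm (i j : Fin n) : krd i j = krd j i := by simp [krd, eq_comm]

lemma sum_krd_smul {m : ℕ} (v : Fin n → E m) (j : Fin n) : ∑ l, krd l j • v l = v j := by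
  simp [krd, ite_smul]

lemma sum_yc_mul_krd (x : E n) (j : Fin n) : ∑ l, yc l x * krd l j = yc j x := by
  simp [krd]

/-- The profile of the divergence `-d*` of the `1`-form with profiles `p`, `q`. -/
def div1 (n : ℕ) (θ p q : ℝ → ℝ) (t : ℝ) : ℝ :=
  Real.exp (-t) * (deriv p t + (n - 1) * p t - (n - 1) * (q t * Real.cos (θ t)))

lemma sum_cov_form1 (hθ : IsPow 0 θ) (hp : IsPow k p) (hq : IsPow k q) (hk : k + 1 < n) :
    (fun x => ∑ l, cov (symMap θ) l (form1 θ p q l) x) =ᵐ[ballMeasure n]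
      form0 θ (div1 n θ p q) := by
  have h := fun l => cov_form1 hθ hp hq hk l l
  filter_upwards [eventually_all.2 h, ae_ball_ne_zero (by omega : 0 < n)] with x h1 h2
  simp only [h1, krd_self]
  have key : ∀ l : Fin n,
      (Real.exp (-ell x) * (deriv p (ell x) * yc l x * yc l x
        + (p (ell x) - q (ell x) * Real.cos (θ (ell x))) * (1 - yc l x * yc l x))) • nu θ x
      + (Real.exp (-ell x) * (p (ell x) * Real.cos (θ (ell x)) - q (ell x))) • (yc l x • tv l x)
      + (Real.exp (-ell x) * deriv q (ell x)) • (yc l x • tv l x)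
      = (yc l x * yc l x) • ((Real.exp (-ell x) * (deriv p (ell x)
          - (p (ell x) - q (ell x) * Real.cos (θ (ell x))))) • nu θ x)
        + (Real.exp (-ell x) * (p (ell x) - q (ell x) * Real.cos (θ (ell x)))) • nu θ x
        + (Real.exp (-ell x) * (p (ell x) * Real.cos (θ (ell x)) - q (ell x) + deriv q (ell x)))
          • (yc l x • tv l x) := fun l => by module
  simp only [key, Finset.sum_add_distrib, ← Finset.sum_smul, ← Finset.smul_sum, sum_yc_sq h2.1,
    sum_yc_smul_tv h2.1, Finset.sum_const, Finset.card_univ, Fintype.card_fin, form0, div1,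
    ← Nat.cast_smul_eq_nsmul ℝ]
  module

lemma sum_cov_form2 (hw : IsPow k w) (hk : k + 1 < n) (j : Fin n) :
    (fun x => ∑ l, cov (symMap θ) l (form2 w l j) x) =ᵐ[ballMeasure n]
      form1 θ (fun t => Real.exp (-t) * ((n - 1) * (w t * Real.cos (θ t))))
        (fun t => Real.exp (-t) * (deriv w t + (n - 2) * w t)) j := by
  have h := fun l => cov_form2 (θ := θ) hw hk l l j
  filter_upwards [eventually_all.2 h, ae_ball_ne_zero (by omega : 0 < n)] with x h1 h2
  simp only [h1, krd_self]
  have key : ∀ l : Fin n,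
      (Real.exp (-ell x) * deriv w (ell x) * yc l x) • (yc l x • tv j x - yc j x • tv l x)
      + (Real.exp (-ell x) * w (ell x)) • ((1 - yc l x * yc l x) • tv j x
        - (krd l j - yc l x * yc j x) • tv l x
        + ((yc j x * 1 - yc l x * krd l j) * Real.cos (θ (ell x))) • nu θ x)
      = (yc l x * yc l x) • ((Real.exp (-ell x) * (deriv w (ell x) - w (ell x))) • tv j x)
        + (Real.exp (-ell x) * w (ell x)) • (tv j x
          + (yc j x * Real.cos (θ (ell x))) • nu θ x)
        - (Real.exp (-ell x) * w (ell x)) • (krd l j • tv l x)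
        - (yc l x * krd l j) • ((Real.exp (-ell x) * w (ell x) * Real.cos (θ (ell x))) • nu θ x)
        + (Real.exp (-ell x) * (w (ell x) - deriv w (ell x)) * yc j x) • (yc l x • tv l x) :=
    fun l => by module
  simp only [key, Finset.sum_add_distrib, Finset.sum_sub_distrib, ← Finset.sum_smul,
    ← Finset.smul_sum, sum_yc_sq h2.1, sum_krd_smul, sum_yc_mul_krd,
    sum_yc_smul_tv h2.1, Finset.sum_const, Finset.card_univ, Fintype.card_fin, form1,
    ← Nat.cast_smul_eq_nsmul ℝ]
  module

/-- The exterior derivative of a rotationally symmetric `1`-form. -/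
lemma cov_form1_sub (hθ : IsPow 0 θ) (hp : IsPow k p) (hq : IsPow k q) (hk : k + 1 < n)
    (i j : Fin n) :
    (fun x => cov (symMap θ) i (form1 θ p q j) x - cov (symMap θ) j (form1 θ p q i) x)
      =ᵐ[ballMeasure n]
      form2 (fun t => Real.exp (-t) * (deriv q t + q t - p t * Real.cos (θ t))) i j := by
  filter_upwards [cov_form1 hθ hp hq hk i j, cov_form1 hθ hp hq hk j i] with x h1 h2
  rw [h1, h2, krd_comm j i, form2]
  module

/-- The exterior derivative of a rotationally symmetric `2`-form vanishes. -/
lemma cov_form2_cyclic (hw : IsPow k w) (hk : k + 1 < n) (i j l : Fin n) :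
    (fun x => cov (symMap θ) i (form2 w j l) x - cov (symMap θ) j (form2 w i l) x
      + cov (symMap θ) l (form2 w i j) x) =ᵐ[ballMeasure n] 0 := by
  filter_upwards [cov_form2 (θ := θ) hw hk i j l, cov_form2 (θ := θ) hw hk j i l,
    cov_form2 (θ := θ) hw hk l i j] with x h1 h2 h3
  rw [h1, h2, h3, krd_comm j i, krd_comm l i, krd_comm l j, Pi.zero_apply]
  module

/-! ### The operator `d* + d` on rotationally symmetric forms -/

/-- The rotationally symmetric form with components of degree at most two. -/
def symForm (n : ℕ) (θ F p q w : ℝ → ℝ) : MixedForm n (n + 1)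
  | 0 => fun _ => form0 θ F
  | 1 => fun I => form1 θ p q (I 0)
  | 2 => fun I => form2 w (I 0) (I 1)
  | _ => fun _ => 0

/-- Almost everywhere equality of all components. -/
def FormEq {n m : ℕ} (Θ Θ' : MixedForm n m) : Prop := ∀ d I, Θ d I =ᵐ[ballMeasure n] Θ' d I

lemma FormEq.dStarAddD {Θ Θ' : MixedForm n (n + 1)} (φ : E n → E (n + 1)) (h : FormEq Θ Θ') :
    dStarAddD φ Θ = dStarAddD φ Θ' := by
  have h1 : ∀ d, coD φ (Θ (d + 1)) = coD φ (Θ' (d + 1)) := fun d => by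
    funext I x
    simp only [coD, cov_congr (h (d + 1) _)]
  have h2 : ∀ d, extD φ (Θ d) = extD φ (Θ' d) := fun d => by
    funext I x
    simp only [extD, cov_congr (h d _)]
  funext d
  cases d with
  | zero => exact h1 0
  | succ d => simp only [PolyEnergy.dStarAddD, h1, h2]

lemma extD_of_zeroForm (φ V : E n → E (n + 1)) (I : Fin 1 → Fin n) (x : E n) :
    extD (p := 0) φ (fun _ => V) I x = cov φ (I 0) V x := by
  simp [extD]

lemma extD_of_oneForm (φ : E n → E (n + 1)) (V : Fin n → E n → E (n + 1)) (I : Fin 2 → Fin n)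
    (x : E n) : extD (p := 1) φ (fun J => V (J 0)) I x
      = cov φ (I 0) (V (I 1)) x - cov φ (I 1) (V (I 0)) x := by
  simp [extD, Fin.sum_univ_two, sub_eq_add_neg]

lemma extD_of_twoForm (φ : E n → E (n + 1)) (V : Fin n → Fin n → E n → E (n + 1))
    (I : Fin 3 → Fin n) (x : E n) : extD (p := 2) φ (fun J => V (J 0) (J 1)) I x
      = cov φ (I 0) (V (I 1) (I 2)) x - cov φ (I 1) (V (I 0) (I 2)) x
        + cov φ (I 2) (V (I 0) (I 1)) x := by
  have e1 : (1 : Fin 3).succAbove (0 : Fin 2) = 0 := by decide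
  have e2 : (1 : Fin 3).succAbove (1 : Fin 2) = 2 := by decide
  have e3 : (2 : Fin 3).succAbove (0 : Fin 2) = 0 := by decide
  have e4 : (2 : Fin 3).succAbove (1 : Fin 2) = 1 := by decide
  have e5 : (0 : Fin 3).succAbove (0 : Fin 2) = 1 := by decide
  have e6 : (0 : Fin 3).succAbove (1 : Fin 2) = 2 := by decide
  refine (Fin.sum_univ_three fun j : Fin 3 => (-1 : ℝ) ^ (j : ℕ) •
    cov φ (I j) (V (I (j.succAbove 0)) (I (j.succAbove 1))) x).trans ?_
  rw [e1, e2, e3, e4, e5, e6]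
  simp [sub_eq_add_neg]

/-- Forms with rotational symmetry are preserved by `d* + d`: no `3`-form appears, because the
exterior derivative of the `2`-form vanishes. -/
lemma dStarAddD_symForm (hθ : IsPow 0 θ) (hF : IsPow k F) (hp : IsPow k p) (hq : IsPow k q)
    (hw : IsPow k w) (hk : k + 1 < n) :
    FormEq (dStarAddD (symMap θ) (symForm n θ F p q w))
      (symForm n θ (fun t => -div1 n θ p q t)
        (fun t => Real.exp (-t) * (deriv F t - (n - 1) * (w t * Real.cos (θ t))))
        (fun t => Real.exp (-t) * (F t * Real.cos (θ t) - (deriv w t + (n - 2) * w t)))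
        (fun t => Real.exp (-t) * (deriv q t + q t - p t * Real.cos (θ t)))) := by
  have hcoz : ∀ d (I : Fin d → Fin n), coD (symMap θ) (fun (_ : Fin (d + 1) → Fin n) =>
      (0 : E n → E (n + 1))) I =ᵐ[ballMeasure n] 0 := fun d I => by
    filter_upwards [eventually_all.2 fun l => cov_zero (by omega : 1 < n) l (symMap θ)] with x hx
    simp [coD, hx]
  have hexz : ∀ d (I : Fin (d + 1) → Fin n), extD (symMap θ) (fun (_ : Fin d → Fin n) =>
      (0 : E n → E (n + 1))) I =ᵐ[ballMeasure n] 0 := fun d I => by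
    filter_upwards [eventually_all.2 fun l => cov_zero (by omega : 1 < n) l (symMap θ)] with x hx
    simp [extD, hx]
  intro d I
  match d with
  | 0 =>
    filter_upwards [sum_cov_form1 hθ hp hq hk] with x h1
    simp only [dStarAddD, coD, symForm, Fin.cons_zero, h1, form0]
    module
  | 1 =>
    filter_upwards [cov_form0 hθ hF hk (I 0), sum_cov_form2 (θ := θ) hw hk (I 0)] with x h1 h2
    have e2 : ∀ l : Fin n, (Fin.cons l I : Fin 2 → Fin n) 1 = I 0 := fun l => by
      rw [show (1 : Fin 2) = Fin.succ 0 from rfl, Fin.cons_succ]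
    simp only [dStarAddD, Pi.add_apply]
    have h1' : extD (symMap θ) (symForm n θ F p q w 0) I x = _ :=
      (extD_of_zeroForm (symMap θ) (form0 θ F) I x).trans h1
    rw [h1']
    simp only [coD, symForm, Fin.cons_zero, e2, h2, form1]
    module
  | 2 =>
    filter_upwards [hcoz 2 I, cov_form1_sub hθ hp hq hk (I 0) (I 1)] with x h1 h2
    simp only [dStarAddD, Pi.add_apply]
    have h1' : coD (symMap θ) (symForm n θ F p q w (1 + 2)) I x = 0 := h1
    have h2' : extD (symMap θ) (symForm n θ F p q w 1) I x = _ :=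
      (extD_of_oneForm (symMap θ) (form1 θ p q) I x).trans h2
    rw [h1', h2', zero_add]
    rfl
  | 3 =>
    filter_upwards [hcoz 3 I, cov_form2_cyclic (θ := θ) hw hk (I 0) (I 1) (I 2)] with x h1 h2
    simp only [dStarAddD, Pi.add_apply]
    have h1' : coD (symMap θ) (symForm n θ F p q w (2 + 2)) I x = 0 := h1
    have h2' : extD (symMap θ) (symForm n θ F p q w 2) I x = _ :=
      (extD_of_twoForm (symMap θ) (form2 w) I x).trans h2
    rw [h1', h2', zero_add]
    rfl
  | d + 4 =>
    filter_upwards [hcoz (d + 4) I, hexz (d + 3) I] with x h1 h2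
    simp only [dStarAddD, Pi.add_apply]
    have h1' : coD (symMap θ) (symForm n θ F p q w (d + 3 + 2)) I x = 0 := h1
    have h2' : extD (symMap θ) (symForm n θ F p q w (d + 3)) I x = 0 := h2
    rw [h1', h2', add_zero]
    rfl

lemma diffForm_symMap (hθ : IsPow 0 θ) (hn : 1 < n) :
    FormEq (diffForm (symMap θ : E n → E (n + 1)))
      (symForm n θ (fun _ => 0) (fun t => Real.exp (-t) * deriv θ t)
        (fun t => Real.exp (-t) * Real.sin (θ t)) (fun _ => 0)) := by
  intro d I
  match d with
  | 0 => exact Eventually.of_forall fun x => by simp [diffForm, symForm, form0]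
  | 1 => exact weakDeriv_symMap hθ hn (I 0)
  | 2 => exact Eventually.of_forall fun x => by simp [diffForm, symForm, form2]
  | d + 3 => exact Eventually.of_forall fun x => by simp [diffForm, symForm]

/-! ### Energy densities -/

lemma norm_nu_sq {x : E n} (hx : x ≠ 0) : inner ℝ (nu θ x) (nu θ x) = (1 : ℝ) := by
  have := Real.sin_sq_add_cos_sq (θ (ell x))
  simp only [nu, inner_sub_left, inner_sub_right, real_inner_smul_left, real_inner_smul_right,
    inner_Yv_Yv hx, inner_pole_Yv, inner_pole_pole, inner_Yv_pole]
  linarith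

lemma inner_nu_tv {x : E n} (hx : x ≠ 0) (i : Fin n) : inner ℝ (nu θ x) (tv i x) = 0 := by
  simp only [nu, inner_sub_left, real_inner_smul_left, inner_Yv_tv hx, inner_pole_tv]; ring

lemma norm_form0_sq {x : E n} (hx : x ≠ 0) : ‖form0 θ F x‖ ^ 2 = F (ell x) ^ 2 := by
  rw [← real_inner_self_eq_norm_sq, form0, real_inner_smul_left, real_inner_smul_right,
    norm_nu_sq hx]; ring

lemma sum_norm_form1_sq {x : E n} (hx : x ≠ 0) :
    ∑ j, ‖form1 θ p q j x‖ ^ 2 = p (ell x) ^ 2 + (n - 1) * q (ell x) ^ 2 := by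
  have key : ∀ j : Fin n, ‖form1 θ p q j x‖ ^ 2
      = (yc j x * yc j x) * (p (ell x) ^ 2 - q (ell x) ^ 2) + q (ell x) ^ 2 := fun j => by
    rw [← real_inner_self_eq_norm_sq]
    simp only [form1, inner_add_left, inner_add_right, real_inner_smul_left,
      real_inner_smul_right, norm_nu_sq hx, inner_nu_tv hx, real_inner_comm (nu θ x) (tv j x),
      inner_tv_tv hx, krd_self]
    ring
  simp only [key, Finset.sum_add_distrib, ← Finset.sum_mul, sum_yc_sq hx, Finset.sum_const,
    Finset.card_univ, Fintype.card_fin, nsmul_eq_mul]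
  ring

lemma sum_norm_form2_sq {x : E n} (hx : x ≠ 0) :
    ∑ i, ∑ j, ‖form2 w i j x‖ ^ 2 = 2 * ((n - 1) * w (ell x) ^ 2) := by
  have key : ∀ i j : Fin n, ‖form2 w i j x‖ ^ 2
      = w (ell x) ^ 2 * ((yc i x * yc i x) + (yc j x * yc j x)
        - 2 * yc i x * (yc j x * krd j i)) := fun i j => by
    rw [← real_inner_self_eq_norm_sq]
    simp only [form2, inner_sub_left, inner_sub_right, real_inner_smul_left,
      real_inner_smul_right, inner_tv_tv hx, krd_self, krd_comm i j]
    ring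
  have h2 : ∀ i : Fin n, 2 * yc i x * yc i x = 2 * (yc i x * yc i x) := fun i => by ring
  simp only [key, ← Finset.mul_sum, Finset.sum_add_distrib, Finset.sum_sub_distrib, sum_yc_sq hx,
    sum_yc_mul_krd, Finset.sum_const, Finset.card_univ, Fintype.card_fin, nsmul_eq_mul, h2]
  have h3 : ∑ i : Fin n, yc i x * (n * yc i x) = n := by
    simp only [mul_left_comm _ (n : ℝ), ← Finset.mul_sum, sum_yc_sq hx, mul_one]
  rw [h3]
  ring

lemma normSqForm_symForm (hn : 1 < n) {x : E n} (hx : x ≠ 0) :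
    normSqForm (symForm n θ F p q w) x = F (ell x) ^ 2 + p (ell x) ^ 2 + (n - 1) * q (ell x) ^ 2
      + (n - 1) * w (ell x) ^ 2 := by
  obtain ⟨m, rfl⟩ : ∃ m, n = m + 2 := ⟨n - 2, by omega⟩
  rw [normSqForm, Finset.sum_range_succ', Finset.sum_range_succ', Finset.sum_range_succ',
    Finset.sum_eq_zero]
  · have h0 : ∑ I : Fin 0 → Fin (m + 2), ‖symForm (m + 2) θ F p q w 0 I x‖ ^ 2 = F (ell x) ^ 2 := by
      simp [symForm, norm_form0_sq hx]
    have h1 : ∑ I : Fin 1 → Fin (m + 2), ‖symForm (m + 2) θ F p q w 1 I x‖ ^ 2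
        = p (ell x) ^ 2 + ((m + 2 : ℕ) - 1) * q (ell x) ^ 2 := by
      rw [← sum_norm_form1_sq (θ := θ) hx]
      exact Fintype.sum_equiv (Equiv.funUnique (Fin 1) _) _ _ fun I => rfl
    have h2 : ∑ I : Fin 2 → Fin (m + 2), ‖symForm (m + 2) θ F p q w 2 I x‖ ^ 2
        = 2 * (((m + 2 : ℕ) - 1) * w (ell x) ^ 2) := by
      rw [← sum_norm_form2_sq hx, ← Fintype.sum_prod_type']
      exact Fintype.sum_equiv (finTwoArrowEquiv _) _ _ fun I => rfl
    simp only [zero_add, Nat.reduceAdd, h0, h1, h2]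
    simp
    ring
  · intro d _
    simp [symForm]

end Forms

/-! ### Rescaled profiles -/

section Hat

/-- A smooth function of `(ε, σ, u)` which is constant for `u ∉ [-2, -1]`. -/
def IsAdm (G : ℝ × ℝ × ℝ → ℝ) : Prop :=
  ContDiff ℝ ∞ G ∧ ∃ c, ∀ p : ℝ × ℝ × ℝ, p.2.2 ∉ Icc (-2 : ℝ) (-1) → G p = c

/-- The profile `e^{-kt} G(ε, s e^{-t/2}, εt)`. -/
def prof (ε s : ℝ) (k : ℕ) (G : ℝ × ℝ × ℝ → ℝ) (t : ℝ) : ℝ :=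
  Real.exp (-(k * t)) * G (ε, s * Real.exp (-t / 2), ε * t)

/-- The operator on functions of `(ε, σ, u)` which corresponds to the derivative of profiles of
weight `k`. -/
def hatD (k : ℕ) (G : ℝ × ℝ × ℝ → ℝ) (p : ℝ × ℝ × ℝ) : ℝ :=
  -(k * G p) + fderiv ℝ G p (0, -p.2.1 / 2, p.1)

variable {G H : ℝ × ℝ × ℝ → ℝ} {k : ℕ} {ε s : ℝ}

lemma IsAdm.add (hG : IsAdm G) (hH : IsAdm H) : IsAdm (fun p => G p + H p) := by
  obtain ⟨h1, c, h2⟩ := hG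
  obtain ⟨h3, d, h4⟩ := hH
  exact ⟨h1.add h3, c + d, fun p hp => by simp only [h2 p hp, h4 p hp]⟩

lemma IsAdm.sub (hG : IsAdm G) (hH : IsAdm H) : IsAdm (fun p => G p - H p) := by
  obtain ⟨h1, c, h2⟩ := hG
  obtain ⟨h3, d, h4⟩ := hH
  exact ⟨h1.sub h3, c - d, fun p hp => by simp only [h2 p hp, h4 p hp]⟩

lemma IsAdm.mul (hG : IsAdm G) (hH : IsAdm H) : IsAdm (fun p => G p * H p) := by
  obtain ⟨h1, c, h2⟩ := hG
  obtain ⟨h3, d, h4⟩ := hH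
  exact ⟨h1.mul h3, c * d, fun p hp => by simp only [h2 p hp, h4 p hp]⟩

lemma IsAdm.const (c : ℝ) : IsAdm (fun _ => c) := ⟨contDiff_const, c, fun _ _ => rfl⟩

lemma IsAdm.neg (hG : IsAdm G) : IsAdm (fun p => -G p) := by
  obtain ⟨h1, c, h2⟩ := hG
  exact ⟨h1.neg, -c, fun p hp => by simp only [h2 p hp]⟩

lemma IsAdm.comp (hG : IsAdm G) {g : ℝ → ℝ} (hg : ContDiff ℝ ∞ g) : IsAdm (fun p => g (G p)) := by
  obtain ⟨h1, c, h2⟩ := hG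
  exact ⟨hg.comp h1, g c, fun p hp => by simp only [h2 p hp]⟩

lemma IsAdm.hatD (hG : IsAdm G) (k : ℕ) : IsAdm (hatD k G) := by
  obtain ⟨h1, c, h2⟩ := hG
  refine ⟨?_, -(k * c), fun p hp => ?_⟩
  · have h3 : ContDiff ℝ ∞ (fderiv ℝ G) := h1.fderiv_right (by simp)
    have h4 : ContDiff ℝ ∞ fun p : ℝ × ℝ × ℝ => ((0 : ℝ), -p.2.1 / 2, p.1) := by fun_prop
    exact (contDiff_const.mul h1).neg.add (h3.clm_apply h4)
  · have hev : G =ᶠ[𝓝 p] fun _ => c := by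
      have : IsOpen {q : ℝ × ℝ × ℝ | q.2.2 ∉ Icc (-2 : ℝ) (-1)} :=
        (isClosed_Icc.preimage (by fun_prop : Continuous fun q : ℝ × ℝ × ℝ => q.2.2)).isOpen_compl
      filter_upwards [this.mem_nhds hp] with q hq using h2 q hq
    simp [PolyEnergy.hatD, h2 p hp, hev.fderiv_eq]

lemma contDiff_prof (hG : ContDiff ℝ ∞ G) (ε s : ℝ) (k : ℕ) : ContDiff ℝ ∞ (prof ε s k G) := by
  unfold prof
  have h1 : ContDiff ℝ ∞ fun t : ℝ => (ε, s * Real.exp (-t / 2), ε * t) := by fun_prop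
  have h2 : ContDiff ℝ ∞ fun t : ℝ => Real.exp (-(k * t)) := by fun_prop
  exact h2.mul (hG.comp h1)

lemma IsAdm.isPow (hG : IsAdm G) (hε : 0 < ε) (s : ℝ) (k : ℕ) : IsPow k (prof ε s k G) := by
  refine ⟨contDiff_prof hG.1 ε s k, ?_⟩
  obtain ⟨h1, c, h2⟩ := hG
  refine ⟨-2 / ε, c, fun t ht => ?_⟩
  rw [lt_div_iff₀ hε] at ht
  rw [prof, h2 _ (fun h => by have := h.1; simp only at this; linarith), mul_comm]

lemma deriv_prof (hG : ContDiff ℝ ∞ G) (ε s : ℝ) (k : ℕ) :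
    deriv (prof ε s k G) = prof ε s k (hatD k G) := by
  funext t
  have h1 : HasDerivAt (fun t : ℝ => Real.exp (-(k * t))) (Real.exp (-(k * t)) * -(k * 1)) t :=
    ((hasDerivAt_id t).const_mul (k : ℝ)).neg.exp
  have h2 : HasDerivAt (fun t : ℝ => (ε, s * Real.exp (-t / 2), ε * t))
      (0, s * (Real.exp (-t / 2) * (-1 / 2)), ε * 1) t :=
    (hasDerivAt_const t ε).prodMk
      ((((hasDerivAt_id t).neg.div_const 2).exp.const_mul s).prodMk ((hasDerivAt_id t).const_mul ε))
  have h3 := ((hG.differentiable (by simp))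
    (ε, s * Real.exp (-t / 2), ε * t)).hasFDerivAt.comp_hasDerivAt t h2
  have h4 := (h1.mul h3).deriv
  have e : ((0 : ℝ), s * (Real.exp (-t / 2) * (-1 / 2)), ε * 1)
      = (0, -(s * Real.exp (-t / 2)) / 2, ε) := by
    ext <;> simp; ring
  rw [e] at h4
  have h5 : deriv (prof ε s k G) t = _ := h4
  rw [h5, prof, hatD]
  simp only [Function.comp]
  ring

lemma exp_mul_prof (ε s : ℝ) (k : ℕ) (G : ℝ × ℝ × ℝ → ℝ) (t : ℝ) :
    Real.exp (-t) * prof ε s k G t = prof ε s (k + 1) G t := by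
  rw [prof, prof, ← mul_assoc, ← Real.exp_add]
  push_cast
  congr 2; ring

/-- A cut-off function supported in `[-2, -1]`. -/
def cutoff : ContDiffBump (-3 / 2 : ℝ) := ⟨1 / 4, 1 / 2, by norm_num, by norm_num⟩

lemma cutoff_eq_zero {u : ℝ} (hu : u ∉ Icc (-2 : ℝ) (-1)) : cutoff u = 0 := by
  refine cutoff.zero_of_le_dist ?_
  rw [Real.dist_eq]
  by_contra h
  have h' : |u - -3 / 2| < 1 / 2 := not_le.1 h
  rw [abs_lt] at h'
  exact hu ⟨by linarith [h'.1], by linarith [h'.2]⟩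

/-- The varied latitude `a + σ χ(u)`. -/
def latHat (a : ℝ) (p : ℝ × ℝ × ℝ) : ℝ := a + p.2.1 * cutoff p.2.2

lemma isAdm_latHat (a : ℝ) : IsAdm (latHat a) := by
  refine ⟨?_, a, fun p hp => by simp [latHat, cutoff_eq_zero hp]⟩
  have h1 : ContDiff ℝ ∞ (cutoff : ℝ → ℝ) := cutoff.contDiff
  have h2 : ContDiff ℝ ∞ fun p : ℝ × ℝ × ℝ => p.2.1 := by fun_prop
  have h3 : ContDiff ℝ ∞ fun p : ℝ × ℝ × ℝ => p.2.2 := by fun_prop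
  exact contDiff_const.add (h2.mul (h1.comp h3))

/-- The latitude `a + s e^{-t/2} χ(εt)` of the variation. -/
def lat (a ε s : ℝ) : ℝ → ℝ := prof ε s 0 (latHat a)

lemma lat_apply (a ε s t : ℝ) :
    lat a ε s t = latHat a (ε, s * Real.exp (-t / 2), ε * t) := by
  simp [lat, prof]

/-! ### The iterated operators on rescaled profiles -/

/-- The rescaled profiles of a rotationally symmetric form of degree at most two. -/
structure HatForm where
  /-- degree zero -/
  F : ℝ × ℝ × ℝ → ℝ
  /-- degree one, radial part -/
  p : ℝ × ℝ × ℝ → ℝ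
  /-- degree one, spherical part -/
  q : ℝ × ℝ × ℝ → ℝ
  /-- degree two -/
  w : ℝ × ℝ × ℝ → ℝ

/-- The rescaled form of `-d*` on `1`-forms. -/
def hatDiv (n : ℕ) (a : ℝ) (k : ℕ) (p q : ℝ × ℝ × ℝ → ℝ) (z : ℝ × ℝ × ℝ) : ℝ :=
  hatD k p z + (n - 1) * p z - (n - 1) * (q z * Real.cos (latHat a z))

/-- The rescaled form of `d* + d`. -/
def hatStep (n : ℕ) (a : ℝ) (k : ℕ) (S : HatForm) : HatForm where
  F := fun z => -hatDiv n a k S.p S.q z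
  p := fun z => hatD k S.F z - (n - 1) * (S.w z * Real.cos (latHat a z))
  q := fun z => S.F z * Real.cos (latHat a z) - (hatD k S.w z + (n - 2) * S.w z)
  w := fun z => hatD k S.q z + S.q z - S.p z * Real.cos (latHat a z)

/-- The rescaled form of `(d* + d)^j dφ`. Its weight is `j + 1`. -/
def hatES (n : ℕ) (a : ℝ) : ℕ → HatForm
  | 0 => ⟨fun _ => 0, hatD 0 (latHat a), fun z => Real.sin (latHat a z), fun _ => 0⟩
  | j + 1 => hatStep n a (j + 1) (hatES n a j)

/-- The rescaled profile of the `j`-th iterate of the rough Laplacian on the tension field. Its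
weight is `2j + 2`. -/
def hatLap (n : ℕ) (a : ℝ) : ℕ → ℝ × ℝ × ℝ → ℝ
  | 0 => hatDiv n a 1 (hatD 0 (latHat a)) (fun z => Real.sin (latHat a z))
  | j + 1 => fun z => -hatDiv n a (2 * j + 3) (hatD (2 * j + 2) (hatLap n a j))
      (fun z => hatLap n a j z * Real.cos (latHat a z)) z

/-- All components are admissible. -/
def HatForm.IsAdm (S : HatForm) : Prop :=
  PolyEnergy.IsAdm S.F ∧ PolyEnergy.IsAdm S.p ∧ PolyEnergy.IsAdm S.q ∧ PolyEnergy.IsAdm S.w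

lemma isAdm_cos_latHat (a : ℝ) : IsAdm (fun z => Real.cos (latHat a z)) :=
  (isAdm_latHat a).comp Real.contDiff_cos

lemma IsAdm.hatDiv {p q : ℝ × ℝ × ℝ → ℝ} (n : ℕ) (a : ℝ) (k : ℕ) (hp : IsAdm p) (hq : IsAdm q) :
    IsAdm (hatDiv n a k p q) :=
  ((hp.hatD k).add ((IsAdm.const _).mul hp)).sub
    ((IsAdm.const _).mul (hq.mul (isAdm_cos_latHat a)))

lemma HatForm.IsAdm.hatStep {S : HatForm} (hS : S.IsAdm) (n : ℕ) (a : ℝ) (k : ℕ) :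
    (hatStep n a k S).IsAdm := by
  obtain ⟨hF, hp, hq, hw⟩ := hS
  have hc := isAdm_cos_latHat a
  exact ⟨(hp.hatDiv n a k hq).neg, (hF.hatD k).sub ((IsAdm.const _).mul (hw.mul hc)),
    (hF.mul hc).sub ((hw.hatD k).add ((IsAdm.const _).mul hw)),
    ((hq.hatD k).add hq).sub (hp.mul hc)⟩

lemma isAdm_hatES (n : ℕ) (a : ℝ) (j : ℕ) : (hatES n a j).IsAdm := by
  induction j with
  | zero => exact ⟨IsAdm.const 0, (isAdm_latHat a).hatD 0,
      (isAdm_latHat a).comp Real.contDiff_sin, IsAdm.const 0⟩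
  | succ j ih => exact ih.hatStep n a (j + 1)

lemma isAdm_hatLap (n : ℕ) (a : ℝ) (j : ℕ) : IsAdm (hatLap n a j) := by
  induction j with
  | zero => exact ((isAdm_latHat a).hatD 0).hatDiv n a 1 ((isAdm_latHat a).comp Real.contDiff_sin)
  | succ j ih =>
    exact ((ih.hatD _).hatDiv n a (2 * j + 3) (ih.mul (isAdm_cos_latHat a))).neg

/-- The symmetric form with the given rescaled profiles, of weight `k`. -/
def hatSymForm (n : ℕ) (a ε s : ℝ) (k : ℕ) (S : HatForm) : MixedForm n (n + 1) :=
  symForm n (lat a ε s) (prof ε s k S.F) (prof ε s k S.p) (prof ε s k S.q) (prof ε s k S.w)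

/-- The order `0` expresses that the latitude is constant near the origin. -/
lemma isPow_lat (a s : ℝ) (hε : 0 < ε) : IsPow 0 (lat a ε s) := (isAdm_latHat a).isPow hε s 0

lemma div1_prof {p q : ℝ × ℝ × ℝ → ℝ} (hp : IsAdm p) (n : ℕ) (a ε s : ℝ) (k : ℕ) :
    div1 n (lat a ε s) (prof ε s k p) (prof ε s k q) = prof ε s (k + 1) (hatDiv n a k p q) := by
  funext t
  rw [div1, deriv_prof hp.1, lat_apply, ← exp_mul_prof]
  simp only [prof, hatDiv]
  ring

lemma dStarAddD_hatSymForm {S : HatForm} (hS : S.IsAdm) {n : ℕ} (a s : ℝ) (hε : 0 < ε)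
    (hk : k + 1 < n) :
    FormEq (dStarAddD (symMap (lat a ε s)) (hatSymForm n a ε s k S))
      (hatSymForm n a ε s (k + 1) (hatStep n a k S)) := by
  obtain ⟨hF, hp, hq, hw⟩ := hS
  have h := dStarAddD_symForm (isPow_lat a s hε) (hF.isPow hε s k) (hp.isPow hε s k)
    (hq.isPow hε s k) (hw.isPow hε s k) hk
  have e1 : (fun t => -div1 n (lat a ε s) (prof ε s k S.p) (prof ε s k S.q) t)
      = prof ε s (k + 1) (hatStep n a k S).F := by
    funext t
    rw [div1_prof hp]
    simp only [prof, hatStep]; ring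
  have e2 : (fun t => Real.exp (-t) * (deriv (prof ε s k S.F) t
      - (n - 1) * (prof ε s k S.w t * Real.cos (lat a ε s t))))
      = prof ε s (k + 1) (hatStep n a k S).p := by
    funext t
    rw [deriv_prof hF.1, lat_apply, ← exp_mul_prof]
    simp only [prof, hatStep]; ring
  have e3 : (fun t => Real.exp (-t) * (prof ε s k S.F t * Real.cos (lat a ε s t)
      - (deriv (prof ε s k S.w) t + (n - 2) * prof ε s k S.w t)))
      = prof ε s (k + 1) (hatStep n a k S).q := by
    funext t
    rw [deriv_prof hw.1, lat_apply, ← exp_mul_prof]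
    simp only [prof, hatStep]; ring
  have e4 : (fun t => Real.exp (-t) * (deriv (prof ε s k S.q) t + prof ε s k S.q t
      - prof ε s k S.p t * Real.cos (lat a ε s t)))
      = prof ε s (k + 1) (hatStep n a k S).w := by
    funext t
    rw [deriv_prof hq.1, lat_apply, ← exp_mul_prof]
    simp only [prof, hatStep]; ring
  rw [e1, e2, e3, e4] at h
  exact h

lemma exp_mul_deriv_lat (a ε s : ℝ) : (fun t => Real.exp (-t) * deriv (lat a ε s) t)
    = prof ε s 1 (hatD 0 (latHat a)) := by
  funext t
  rw [lat, deriv_prof (isAdm_latHat a).1, exp_mul_prof]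

lemma exp_mul_sin_lat (a ε s : ℝ) : (fun t => Real.exp (-t) * Real.sin (lat a ε s t))
    = prof ε s 1 (fun z => Real.sin (latHat a z)) := by
  funext t
  rw [lat_apply, ← exp_mul_prof]; simp [prof]

lemma iterate_dStarAddD {n : ℕ} (a s : ℝ) (hε : 0 < ε) (j : ℕ) (hj : j + 1 < n) :
    FormEq ((dStarAddD (symMap (lat a ε s)))^[j] (diffForm (symMap (lat a ε s) : E n → E (n + 1))))
      (hatSymForm n a ε s (j + 1) (hatES n a j)) := by
  induction j with
  | zero =>
    have h := diffForm_symMap (n := n) (isPow_lat a s hε) hj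
    have e0 : (fun _ : ℝ => (0 : ℝ)) = prof ε s 1 (fun _ => 0) := by funext t; simp [prof]
    rw [exp_mul_deriv_lat, exp_mul_sin_lat, e0] at h
    exact h
  | succ j ih =>
    rw [Function.iterate_succ_apply', (ih (by omega)).dStarAddD]
    exact dStarAddD_hatSymForm (isAdm_hatES n a j) a s hε hj

/-- The rescaled Eells–Sampson energy density. -/
def hatESDensity (n : ℕ) (a : ℝ) (j : ℕ) (z : ℝ × ℝ × ℝ) : ℝ :=
  (hatES n a j).F z ^ 2 + (hatES n a j).p z ^ 2 + (n - 1) * (hatES n a j).q z ^ 2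
    + (n - 1) * (hatES n a j).w z ^ 2

lemma prof_sq (ε s : ℝ) (k : ℕ) (G : ℝ × ℝ × ℝ → ℝ) (t : ℝ) :
    prof ε s k G t ^ 2 = prof ε s (2 * k) (fun z => G z ^ 2) t := by
  rw [prof, prof, mul_pow, ← Real.exp_nat_mul]
  push_cast
  congr 2; ring

lemma esEnergy_symMap {n : ℕ} (a s : ℝ) (hε : 0 < ε) (j : ℕ) (hj : j + 1 < n) :
    esEnergy (j + 1) (symMap (lat a ε s) : E n → E (n + 1)) =
      (1 / 2) * ∫ x, prof ε s (2 * (j + 1)) (hatESDensity n a j) (ell x) ∂(ballMeasure n) := by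
  rw [esEnergy, Nat.add_sub_cancel]
  congr 1
  refine integral_congr_ae ?_
  have h := iterate_dStarAddD (n := n) a s hε j hj
  have h' : ∀ᵐ x ∂(ballMeasure n), ∀ d I, ((dStarAddD (symMap (lat a ε s)))^[j]
      (diffForm (symMap (lat a ε s) : E n → E (n + 1)))) d I x
      = hatSymForm n a ε s (j + 1) (hatES n a j) d I x :=
    ae_all_iff.2 fun d => eventually_all.2 fun I => h d I
  filter_upwards [h', ae_ball_ne_zero (by omega : 0 < n)] with x h1 h2
  have h3 : normSqForm ((dStarAddD (symMap (lat a ε s)))^[j]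
      (diffForm (symMap (lat a ε s) : E n → E (n + 1)))) x
      = normSqForm (hatSymForm n a ε s (j + 1) (hatES n a j)) x := by
    simp only [normSqForm, h1]
  rw [h3, hatSymForm, normSqForm_symForm (by omega) h2.1, prof_sq, prof_sq, prof_sq, prof_sq]
  simp only [prof, hatESDensity]; ring

/-! ### The `r`-energy -/

lemma tension_symMap {n : ℕ} (a s : ℝ) (hε : 0 < ε) (hn : 2 < n) :
    (tension (symMap (lat a ε s) : E n → E (n + 1))) =ᵐ[ballMeasure n]
      form0 (lat a ε s) (prof ε s 2 (hatLap n a 0)) := by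
  have h1 := fun i : Fin n => weakDeriv_symMap (isPow_lat a s hε) (by omega : 1 < n) i
  have h2 := sum_cov_form1 (isPow_lat a s hε) (((isAdm_latHat a).hatD 0).isPow hε s 1)
    (((isAdm_latHat a).comp Real.contDiff_sin).isPow hε s 1) (by omega : 1 + 1 < n)
  rw [div1_prof ((isAdm_latHat a).hatD 0)] at h2
  refine EventuallyEq.trans (Eventually.of_forall fun x => ?_) h2
  simp only [tension]
  refine Finset.sum_congr rfl fun i _ => ?_
  rw [cov_congr (h1 i), exp_mul_deriv_lat, exp_mul_sin_lat]

lemma cov_form0_prof {F : ℝ × ℝ × ℝ → ℝ} (hF : IsAdm F) {n : ℕ} (a s : ℝ) (hε : 0 < ε)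
    (hk : k + 1 < n) (i : Fin n) :
    cov (symMap (lat a ε s)) i (form0 (lat a ε s) (prof ε s k F)) =ᵐ[ballMeasure n]
      form1 (lat a ε s) (prof ε s (k + 1) (hatD k F))
        (prof ε s (k + 1) (fun z => F z * Real.cos (latHat a z))) i := by
  have h := cov_form0 (isPow_lat a s hε) (hF.isPow hε s k) hk i
  have e1 : (fun t => Real.exp (-t) * deriv (prof ε s k F) t) = prof ε s (k + 1) (hatD k F) := by
    funext t
    rw [deriv_prof hF.1, exp_mul_prof]
  have e2 : (fun t => Real.exp (-t) * (prof ε s k F t * Real.cos (lat a ε s t)))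
      = prof ε s (k + 1) (fun z => F z * Real.cos (latHat a z)) := by
    funext t
    rw [lat_apply, ← exp_mul_prof]; simp only [prof]; ring
  rwa [e1, e2] at h

lemma roughLap_symMap {F : ℝ × ℝ × ℝ → ℝ} (hF : IsAdm F) {n : ℕ} (a s : ℝ) (hε : 0 < ε)
    (hk : k + 2 < n) {V : E n → E (n + 1)}
    (hV : V =ᵐ[ballMeasure n] form0 (lat a ε s) (prof ε s k F)) :
    roughLap (symMap (lat a ε s)) V =ᵐ[ballMeasure n] form0 (lat a ε s) (prof ε s (k + 2)
      (fun z => -hatDiv n a (k + 1) (hatD k F) (fun z => F z * Real.cos (latHat a z)) z)) := by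
  have h1 := fun i : Fin n => cov_form0_prof hF a s hε (by omega : k + 1 < n) i
  have h2 := sum_cov_form1 (isPow_lat a s hε) ((hF.hatD k).isPow hε s (k + 1))
    ((hF.mul (isAdm_cos_latHat a)).isPow hε s (k + 1)) (by omega : k + 1 + 1 < n)
  rw [div1_prof (hF.hatD k)] at h2
  filter_upwards [h2] with x hx
  simp only [roughLap, cov_congr hV, fun i => cov_congr (φ := symMap (lat a ε s)) (i := i) (h1 i)]
  rw [hx, show k + 1 + 1 = k + 2 from rfl]
  simp only [form0, prof]; module

lemma iterate_roughLap_tension {n : ℕ} (a s : ℝ) (hε : 0 < ε) (j : ℕ) (hj : 2 * j + 2 < n) :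
    (roughLap (symMap (lat a ε s)))^[j] (tension (symMap (lat a ε s) : E n → E (n + 1)))
      =ᵐ[ballMeasure n] form0 (lat a ε s) (prof ε s (2 * j + 2) (hatLap n a j)) := by
  induction j with
  | zero => exact tension_symMap a s hε (by omega)
  | succ j ih =>
    rw [Function.iterate_succ_apply']
    exact roughLap_symMap (isAdm_hatLap n a j) a s hε (by omega) (ih (by omega))

lemma rEnergy_symMap_even {n : ℕ} (a s : ℝ) (hε : 0 < ε) (j : ℕ) (hj : 2 * j + 2 < n) :
    rEnergy (2 * j + 2) (symMap (lat a ε s) : E n → E (n + 1)) =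
      (1 / 2) * ∫ x, prof ε s (2 * (2 * j + 2)) (fun z => hatLap n a j z ^ 2) (ell x)
        ∂(ballMeasure n) := by
  rw [rEnergy, if_pos ⟨j + 1, by ring⟩, show (2 * j + 2) / 2 - 1 = j by omega]
  congr 1
  refine integral_congr_ae ?_
  filter_upwards [iterate_roughLap_tension a s hε j hj, ae_ball_ne_zero (by omega : 0 < n)]
    with x h1 h2
  rw [h1, norm_form0_sq h2.1, prof_sq]

lemma rEnergy_symMap_odd {n : ℕ} (a s : ℝ) (hε : 0 < ε) (j : ℕ) (hj : 2 * j + 3 < n) :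
    rEnergy (2 * j + 3) (symMap (lat a ε s) : E n → E (n + 1)) =
      (1 / 2) * ∫ x, prof ε s (2 * (2 * j + 3)) (fun z => hatD (2 * j + 2) (hatLap n a j) z ^ 2
        + (n - 1) * (hatLap n a j z * Real.cos (latHat a z)) ^ 2) (ell x) ∂(ballMeasure n) := by
  rw [rEnergy, if_neg (by rw [Nat.not_even_iff]; omega), show (2 * j + 3) / 2 - 1 = j by omega]
  congr 1
  refine integral_congr_ae ?_
  have h := fun i : Fin n => cov_form0_prof (isAdm_hatLap n a j) a s hε
    (by omega : 2 * j + 2 + 1 < n) i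
  have ht := iterate_roughLap_tension (n := n) a s hε j (by omega)
  filter_upwards [eventually_all.2 h, ae_ball_ne_zero (by omega : 0 < n)] with x h1 h2
  simp only [cov_congr ht, h1]
  rw [sum_norm_form1_sq h2.1, prof_sq, prof_sq]
  simp only [prof]; ring

end Hat

/-! ### The energy along the variation -/

section Energy

variable {n : ℕ}

/-- The factor relating integrals over the ball to integrals in the radial variable. -/
def ballConst (n : ℕ) : ℝ := n * (volume : Measure (E n)).real (Metric.ball 0 1)

lemma ballConst_pos (hn : 0 < n) : 0 < ballConst n := by
  have : 0 < (volume : Measure (E n)).real (Metric.ball 0 1) :=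
    ENNReal.toReal_pos (Metric.measure_ball_pos volume _ one_pos).ne' measure_ball_lt_top.ne
  exact mul_pos (by exact_mod_cast hn) this

/-- Polar coordinates, in the variable `log |x|`. -/
lemma integral_comp_ell (hn : 0 < n) (f : ℝ → ℝ) :
    ∫ x : E n, f (ell x) ∂(ballMeasure n)
      = ballConst n * ∫ t in Iio (0 : ℝ), Real.exp (n * t) * f t := by
  have : Nonempty (Fin n) := ⟨⟨0, hn⟩⟩
  have h1 : ∫ x : E n, f (ell x) ∂(ballMeasure n)
      = ∫ x : E n, (Iio (1 : ℝ)).indicator (fun y => f (Real.log y)) ‖x‖ := by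
    rw [ballMeasure, ← integral_indicator Metric.isOpen_ball.measurableSet]
    refine integral_congr_ae (Eventually.of_forall fun x => ?_)
    simp [indicator, ell]
  have h2 : ∫ y in Ioi (0 : ℝ), y ^ (n - 1) • (Iio (1 : ℝ)).indicator (fun y => f (Real.log y)) y
      = ∫ y in Ioo (0 : ℝ) 1, y ^ (n - 1) * f (Real.log y) := by
    rw [← Ioi_inter_Iio, ← setIntegral_indicator measurableSet_Iio]
    refine integral_congr_ae (Eventually.of_forall fun y => ?_)
    by_cases hy : y < 1 <;> simp [indicator, hy]
  have himg : Real.exp '' Iio 0 = Ioo 0 1 := by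
    ext y
    constructor
    · rintro ⟨t, ht, rfl⟩
      exact ⟨Real.exp_pos t, Real.exp_lt_one_iff.2 ht⟩
    · rintro ⟨h0, h1⟩
      exact ⟨Real.log y, Real.log_neg h0 h1, Real.exp_log h0⟩
  have h3 : ∫ y in Ioo (0 : ℝ) 1, y ^ (n - 1) * f (Real.log y)
      = ∫ t in Iio (0 : ℝ), Real.exp (n * t) * f t := by
    rw [← himg, integral_image_eq_integral_abs_deriv_smul measurableSet_Iio
      (fun t _ => (Real.hasDerivAt_exp t).hasDerivWithinAt) Real.exp_injective.injOn]
    refine setIntegral_congr_fun measurableSet_Iio fun t _ => ?_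
    obtain ⟨m, rfl⟩ : ∃ m, n = m + 1 := ⟨n - 1, by omega⟩
    simp only [Real.log_exp, abs_of_pos (Real.exp_pos t), smul_eq_mul, Nat.add_sub_cancel,
      ← Real.exp_nat_mul]
    rw [← mul_assoc, ← Real.exp_add]
    push_cast
    congr 2; ring
  rw [h1, integral_fun_norm_addHaar, finrank_euclideanSpace, Fintype.card_fin, h2, h3, ballConst]
  simp only [nsmul_eq_mul, smul_eq_mul]; ring

/-- The energy density, after the substitution `u = εt` and with the constant part removed. -/
def enK (ε c : ℝ) (G : ℝ × ℝ × ℝ → ℝ) (s u : ℝ) : ℝ :=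
  Real.exp (u / ε) * (G (ε, s * Real.exp (-(u / ε) / 2), u) - c)

lemma continuous_enK {G : ℝ × ℝ × ℝ → ℝ} (hG : Continuous G) (ε c : ℝ) :
    Continuous fun p : ℝ × ℝ => enK ε c G p.1 p.2 := by
  unfold enK
  have h1 : Continuous fun p : ℝ × ℝ => (ε, p.1 * Real.exp (-(p.2 / ε) / 2), p.2) := by
    fun_prop
  have h2 := hG.comp h1
  simp only [Function.comp_def] at h2
  fun_prop

/-- In dimension `n = 2r + 1` the volume factor `e^{nt}` and the weight `e^{-2rt}` of the density
leave `e^t`. -/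
lemma energy_eq {r : ℕ} {ε c : ℝ} (hε : 0 < ε) {G : ℝ × ℝ × ℝ → ℝ} (hG : Continuous G)
    (hc : ∀ p : ℝ × ℝ × ℝ, p.2.2 ∉ Icc (-2 : ℝ) (-1) → G p = c) (s : ℝ) :
    ∫ x : E (2 * r + 1), prof ε s (2 * r) G (ell x) ∂(ballMeasure (2 * r + 1))
      = ballConst (2 * r + 1) * ((∫ t in Iio (0 : ℝ), Real.exp t * c)
        + ε⁻¹ * ∫ u in (-3 : ℝ)..0, enK ε c G s u) := by
  rw [integral_comp_ell (by omega)]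
  congr 1
  have h1 : ∀ t, Real.exp ((2 * r + 1 : ℕ) * t) * prof ε s (2 * r) G t
      = Real.exp t * c + enK ε c G s (ε * t) := by
    intro t
    have e : ε * t / ε = t := by field_simp
    rw [prof, enK, e, ← mul_assoc, ← Real.exp_add]
    have : ((2 * r + 1 : ℕ) : ℝ) * t + -(((2 * r : ℕ) : ℝ) * t) = t := by push_cast; ring
    rw [this]; ring
  simp only [h1]
  have hk : Continuous fun t => enK ε c G s (ε * t) :=
    (continuous_enK hG ε c).comp (by fun_prop : Continuous fun t : ℝ => (s, ε * t))
  have hz : ∀ u, u ∉ Icc (-2 : ℝ) (-1) → enK ε c G s u = 0 := fun u hu => by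
    rw [enK, hc _ hu, sub_self, mul_zero]
  have hz' : ∀ t, t ∉ Icc (-2 / ε) (-1 / ε) → enK ε c G s (ε * t) = 0 := fun t ht => by
    refine hz _ fun h => ht ⟨?_, ?_⟩
    · rw [div_le_iff₀ hε]; linarith [h.1]
    · rw [le_div_iff₀ hε]; linarith [h.2]
  have hcs : HasCompactSupport fun t => enK ε c G s (ε * t) :=
    HasCompactSupport.intro isCompact_Icc hz'
  have hexp : IntegrableOn (fun t : ℝ => Real.exp t * c) (Iio 0) :=
    ((integrableOn_exp_Iic 0).mono_set Iio_subset_Iic_self).mul_const c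
  rw [integral_add hexp (hk.integrable_of_hasCompactSupport hcs).integrableOn]
  congr 1
  have hset : ∫ t in Iio (0 : ℝ), enK ε c G s (ε * t) = ∫ t, enK ε c G s (ε * t) :=
    setIntegral_eq_integral_of_forall_compl_eq_zero fun t ht => hz' t fun h => ht
      (h.2.trans_lt (by rw [div_lt_iff₀ hε]; norm_num))
  rw [hset, Measure.integral_comp_mul_left
      (fun u => enK ε c G s u), abs_of_pos (inv_pos.2 hε), smul_eq_mul]
  congr 1
  rw [intervalIntegral.integral_eq_integral_of_support_subset]
  intro u hu
  by_contra h
  refine hu (hz u fun h' => h ⟨?_, ?_⟩) <;> linarith [h'.1, h'.2]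

lemma hasDerivAt_integral_param {K K' : ℝ → ℝ → ℝ} (hK : Continuous fun p : ℝ × ℝ => K p.1 p.2)
    (hK' : Continuous fun p : ℝ × ℝ => K' p.1 p.2)
    (hd : ∀ s u, HasDerivAt (fun s => K s u) (K' s u) s) (α β s : ℝ) :
    HasDerivAt (fun s => ∫ u in α..β, K s u) (∫ u in α..β, K' s u) s := by
  have sl : ∀ {L : ℝ → ℝ → ℝ}, Continuous (fun p : ℝ × ℝ => L p.1 p.2) → ∀ s, Continuous (L s) :=
    fun hL s => hL.comp (by fun_prop : Continuous fun u : ℝ => (s, u))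
  obtain ⟨C, hC⟩ := (isCompact_Icc.prod isCompact_uIcc).exists_bound_of_continuousOn
    (s := Icc (s - 1) (s + 1) ×ˢ uIcc α β) hK'.continuousOn
  refine (intervalIntegral.hasDerivAt_integral_of_dominated_loc_of_deriv_le (bound := fun _ => C)
    (Icc_mem_nhds (by linarith : s - 1 < s) (by linarith : s < s + 1))
    (Eventually.of_forall fun s => (sl hK s).aestronglyMeasurable)
    ((sl hK s).intervalIntegrable _ _) (sl hK' s).aestronglyMeasurable
    (Eventually.of_forall fun u hu x hx => hC (x, u) ⟨hx, uIoc_subset_uIcc hu⟩)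
    (by simp) (Eventually.of_forall fun u _ x _ => hd x u)).2

/-- The partial derivative in `σ`. -/
def pdσ (G : ℝ × ℝ × ℝ → ℝ) (p : ℝ × ℝ × ℝ) : ℝ := fderiv ℝ G p (0, 1, 0)

lemma contDiff_pdσ {G : ℝ × ℝ × ℝ → ℝ} (hG : ContDiff ℝ ∞ G) : ContDiff ℝ ∞ (pdσ G) :=
  (hG.fderiv_right (by simp)).clm_apply contDiff_const

lemma hasDerivAt_slice {G : ℝ × ℝ × ℝ → ℝ} (hG : ContDiff ℝ ∞ G) (ε u σ : ℝ) :
    HasDerivAt (fun σ => G (ε, σ, u)) (pdσ G (ε, σ, u)) σ :=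
  ((hG.differentiable (by simp)) (ε, σ, u)).hasFDerivAt.comp_hasDerivAt σ
    ((hasDerivAt_const σ ε).prodMk ((hasDerivAt_id σ).prodMk (hasDerivAt_const σ u)))

lemma hasDerivAt_slice_mul {G : ℝ × ℝ × ℝ → ℝ} (hG : ContDiff ℝ ∞ G) (ε u b s : ℝ) :
    HasDerivAt (fun s => G (ε, s * b, u)) (pdσ G (ε, s * b, u) * b) s := by
  have := (hasDerivAt_slice hG ε u (s * b)).comp s ((hasDerivAt_id s).mul_const b)
  rw [one_mul] at this
  exact this

/-- The second derivative of the energy along the variation, in terms of the rescaled density. -/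
lemma energy_second_deriv {ε : ℝ} {G : ℝ × ℝ × ℝ → ℝ} (hG : ContDiff ℝ ∞ G) (c A B : ℝ) :
    ∃ F₁ : ℝ → ℝ,
      (∀ s, HasDerivAt (fun s => A + B * ∫ u in (-3 : ℝ)..0, enK ε c G s u) (F₁ s) s) ∧
      HasDerivAt F₁ (B * ∫ u in (-3 : ℝ)..0, pdσ (pdσ G) (ε, 0, u)) 0 := by
  have hG1 := contDiff_pdσ hG
  have hG2 := contDiff_pdσ hG1
  let K1 : ℝ → ℝ → ℝ := fun s u =>
    Real.exp (u / ε) * (pdσ G (ε, s * Real.exp (-(u / ε) / 2), u) * Real.exp (-(u / ε) / 2))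
  let K2 : ℝ → ℝ → ℝ := fun s u => pdσ (pdσ G) (ε, s * Real.exp (-(u / ε) / 2), u)
  have hin : Continuous fun p : ℝ × ℝ => (ε, p.1 * Real.exp (-(p.2 / ε) / 2), p.2) := by
    fun_prop
  have c1 : Continuous fun p : ℝ × ℝ => K1 p.1 p.2 := by
    have := hG1.continuous.comp hin
    simp only [Function.comp_def] at this
    simp only [K1]
    fun_prop
  have c2 : Continuous fun p : ℝ × ℝ => K2 p.1 p.2 := hG2.continuous.comp hin
  have d1 : ∀ s u, HasDerivAt (fun s => enK ε c G s u) (K1 s u) s := fun s u =>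
    ((hasDerivAt_slice_mul hG ε u _ s).sub_const c).const_mul _
  have d2 : ∀ s u, HasDerivAt (fun s => K1 s u) (K2 s u) s := fun s u => by
    refine (((hasDerivAt_slice_mul hG1 ε u (Real.exp (-(u / ε) / 2)) s).mul_const
      (Real.exp (-(u / ε) / 2))).const_mul (Real.exp (u / ε))).congr_deriv ?_
    -- the square of the factor `e^{-t/2}` in the variation compensates the remaining weight `e^t`
    have : Real.exp (u / ε) * (Real.exp (-(u / ε) / 2) * Real.exp (-(u / ε) / 2)) = 1 := by
      rw [← Real.exp_add, ← Real.exp_add, ← Real.exp_zero]; congr 1; ring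
    simp only [K2]
    linear_combination (pdσ (pdσ G) (ε, s * Real.exp (-(u / ε) / 2), u)) * this
  refine ⟨fun s => B * ∫ u in (-3 : ℝ)..0, K1 s u, fun s => ?_, ?_⟩
  · exact ((hasDerivAt_integral_param (continuous_enK hG.continuous ε c) c1 d1 _ _ s).const_mul
      B).const_add A
  · have := (hasDerivAt_integral_param c1 c2 d2 (-3) 0 0).const_mul B
    simpa [K2] using this

/-! ### Instability -/

lemma lat_zero (a ε t : ℝ) : lat a ε 0 t = a := by simp [lat_apply, latHat]

lemma phi_eq_symMap (a ε : ℝ) : phi n a = symMap (lat a ε 0) := by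
  funext x
  ext i
  refine Fin.lastCases ?_ (fun j => ?_) i
  · simp [phi, symMap, lat_zero, Yv, incl_last, pole]
  · simp [phi, symMap, lat_zero, Yv, incl_castSucc, pole, div_eq_inv_mul]

lemma isAnnularCurve_symMap (a : ℝ) {ε : ℝ} (hε : 0 < ε) :
    IsAnnularCurve (Real.exp (-2 / ε)) (Real.exp (-1 / ε)) (fun p : ℝ × E n =>
      symMap (lat a ε p.1) p.2 - symMap (lat a ε 0) p.2) := by
  have hz : ∀ s (x : E n), ‖x‖ ∉ Icc (Real.exp (-2 / ε)) (Real.exp (-1 / ε)) →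
      symMap (lat a ε s) x - symMap (lat a ε 0) x = 0 := by
    intro s x hx
    have : cutoff (ε * ell x) = 0 := by
      refine cutoff_eq_zero fun h => ?_
      rcases eq_or_ne x 0 with rfl | hx0
      · have := h.2
        simp only [ell, norm_zero, Real.log_zero, mul_zero] at this
        linarith
      · refine hx ⟨?_, ?_⟩
        · rw [← Real.le_log_iff_exp_le (norm_pos_iff.2 hx0), div_le_iff₀ hε]
          exact h.1.trans_eq (mul_comm _ _)
        · rw [← Real.log_le_iff_le_exp (norm_pos_iff.2 hx0), le_div_iff₀ hε]
          exact (mul_comm _ _).trans_le h.2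
    have e : lat a ε s (ell x) = lat a ε 0 (ell x) := by
      simp [lat_apply, latHat, this]
    simp [symMap, e]
  refine ⟨contDiff_iff_contDiffAt.2 fun p => ?_, hz⟩
  obtain ⟨s, x⟩ := p
  rcases eq_or_ne x 0 with rfl | hx
  · have : (fun p : ℝ × E n => symMap (lat a ε p.1) p.2 - symMap (lat a ε 0) p.2)
        =ᶠ[𝓝 (s, 0)] fun _ => 0 := by
      have ho : IsOpen {p : ℝ × E n | ‖p.2‖ < Real.exp (-2 / ε)} :=
        isOpen_lt (by fun_prop) continuous_const
      filter_upwards [ho.mem_nhds (by simp [Real.exp_pos])] with p hp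
      exact hz _ _ fun h => absurd h.1 (not_le.2 hp)
    exact contDiffAt_const.congr_of_eventuallyEq this
  · have hell : ContDiffAt ℝ ∞ (fun p : ℝ × E n => ell p.2) (s, x) :=
      ContDiffAt.comp (f := Prod.snd) (s, x) (contDiffAt_ell hx) contDiffAt_snd
    have hY : ContDiffAt ℝ ∞ (fun p : ℝ × E n => Yv p.2) (s, x) :=
      ContDiffAt.comp (f := Prod.snd) (s, x) (IsHom.Yv.1 x hx) contDiffAt_snd
    have hl : ∀ g : ℝ × E n → ℝ, ContDiffAt ℝ ∞ g (s, x) →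
        ContDiffAt ℝ ∞ (fun p : ℝ × E n => lat a ε (g p) (ell p.2)) (s, x) := by
      intro g hg
      simp only [lat_apply]
      refine (isAdm_latHat a).1.contDiffAt.comp (s, x) ?_
      exact contDiffAt_const.prodMk ((hg.mul ((hell.neg.div_const 2).exp)).prodMk
        (contDiffAt_const.mul hell))
    have hs : ∀ g : ℝ × E n → ℝ, ContDiffAt ℝ ∞ g (s, x) →
        ContDiffAt ℝ ∞ (fun p : ℝ × E n => symMap (lat a ε (g p)) p.2) (s, x) := fun g hg =>
      ((hl g hg).sin.smul hY).add ((hl g hg).cos.smul contDiffAt_const)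
    exact (hs _ contDiffAt_fst).sub (hs _ contDiffAt_const)

lemma isVariation_symMap {r : ℕ} (hr : 2 * r < n) (hn : 1 < n) (a : ℝ) {ε : ℝ} (hε : 0 < ε) :
    IsVariation r (phi n a) 1 (fun s => symMap (lat a ε s)) := by
  rw [phi_eq_symMap a ε]
  exact isVariation_of_annular (φ := fun s => symMap (lat a ε s)) (Real.exp_pos _)
    (by rw [Real.exp_lt_one_iff]; exact div_neg_of_neg_of_pos (by norm_num) hε) hn hr
    (IsHom.symMap (isPow_lat a 0 hε)) (isAnnularCurve_symMap a hε)
    (fun s x hx => symMap_mem_sphere hx _)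

/-- If the `σ`-Taylor coefficient of order two of the rescaled density at `ε = 0` is a negative
multiple of the square of the cut-off function, then slowly varying cut-off functions decrease the
energy to second order. -/
theorem not_isStable_of_density {r : ℕ} (hr : 0 < r) {a c₂ : ℝ}
    {𝓕 : (E (2 * r + 1) → E (2 * r + 1 + 1)) → ℝ} {G : ℝ × ℝ × ℝ → ℝ} (hG : IsAdm G)
    (h𝓕 : ∀ ε s, 0 < ε → 𝓕 (symMap (lat a ε s))
      = (1 / 2) * ∫ x, prof ε s (2 * r) G (ell x) ∂(ballMeasure (2 * r + 1)))
    (hjet : ∀ u, pdσ (pdσ G) (0, 0, u) = c₂ * cutoff u ^ 2) (hc₂ : c₂ < 0) :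
    ¬ IsStable r 𝓕 (phi (2 * r + 1) a) := by
  intro hst
  obtain ⟨hGs, c, hc⟩ := hG
  have hcont : Continuous fun ε : ℝ => ∫ u in (-3 : ℝ)..0, pdσ (pdσ G) (ε, 0, u) := by
    refine intervalIntegral.continuous_parametric_intervalIntegral_of_continuous' ?_ _ _
    have := (contDiff_pdσ (contDiff_pdσ hGs)).continuous
    exact this.comp (by fun_prop : Continuous fun p : ℝ × ℝ => (p.1, (0 : ℝ), p.2))
  have hcutc : Continuous fun u => (cutoff : ℝ → ℝ) u ^ 2 := cutoff.continuous.pow 2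
  have h0 : ∫ u in (-3 : ℝ)..0, pdσ (pdσ G) (0, 0, u) < 0 := by
    simp only [hjet, intervalIntegral.integral_const_mul]
    refine mul_neg_of_neg_of_pos hc₂ ?_
    refine intervalIntegral.integral_pos (by norm_num) hcutc.continuousOn
      (fun _ _ => sq_nonneg _) ⟨-3 / 2, ⟨by norm_num, by norm_num⟩, ?_⟩
    have : (cutoff : ℝ → ℝ) (-3 / 2) = 1 := cutoff.eventuallyEq_one.self_of_nhds
    rw [this]; norm_num
  obtain ⟨ε, hneg, hε⟩ : ∃ ε : ℝ, (∫ u in (-3 : ℝ)..0, pdσ (pdσ G) (ε, 0, u)) < 0 ∧ 0 < ε := by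
    have h1 : ∀ᶠ ε in 𝓝[>] (0 : ℝ), (∫ u in (-3 : ℝ)..0, pdσ (pdσ G) (ε, 0, u)) < 0 :=
      nhdsWithin_le_nhds (hcont.continuousAt.eventually_lt_const h0)
    exact (h1.and self_mem_nhdsWithin).exists
  have hE : ∀ s, 𝓕 (symMap (lat a ε s)) = (1 / 2) * (ballConst (2 * r + 1)
      * ∫ t in Iio (0 : ℝ), Real.exp t * c) + ((1 / 2) * (ballConst (2 * r + 1) * ε⁻¹))
        * ∫ u in (-3 : ℝ)..0, enK ε c G s u := fun s => by
    rw [h𝓕 ε s hε, energy_eq hε hGs.continuous hc]; ring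
  obtain ⟨F₁, hF₁, hF₂⟩ := energy_second_deriv (ε := ε) hGs c ((1 / 2) * (ballConst (2 * r + 1)
      * ∫ t in Iio (0 : ℝ), Real.exp t * c)) ((1 / 2) * (ballConst (2 * r + 1) * ε⁻¹))
  have hB : 0 < (1 / 2) * (ballConst (2 * r + 1) * ε⁻¹) := by
    have := ballConst_pos (n := 2 * r + 1) (by omega)
    positivity
  have := hst 1 _ (isVariation_symMap (by omega) (by omega) a hε) F₁ _
    (fun s _ => by simp only [hE]; exact (hF₁ s).hasDerivWithinAt) hF₂.hasDerivWithinAt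
  linarith [mul_neg_of_pos_of_neg hB hneg]

end Energy

/-! ### Taylor coefficients of rescaled profiles at `ε = 0` -/

section Jet

variable {G H : ℝ × ℝ × ℝ → ℝ} {b₀ b₁ b₂ c₀ c₁ c₂ : ℝ} {k : ℕ} {a : ℝ}

/-- At `ε = 0` the function `G` has the Taylor expansion
`c₀ + c₁ χ(u) σ + c₂ (χ(u) σ)² + O(σ³)` in `σ`. -/
def HasJet (G : ℝ × ℝ × ℝ → ℝ) (c₀ c₁ c₂ : ℝ) : Prop :=
  ContDiff ℝ ∞ G ∧ ∀ u, G (0, 0, u) = c₀ ∧ pdσ G (0, 0, u) = c₁ * cutoff u ∧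
    pdσ (pdσ G) (0, 0, u) = 2 * c₂ * cutoff u ^ 2

/-- Jets can be read off from derivatives along the lines `ε = 0`, `u` constant. -/
lemma hasJet_of_hasDerivAt (hG : ContDiff ℝ ∞ G) {g : ℝ → ℝ → ℝ}
    (h0 : ∀ u, G (0, 0, u) = c₀) (h1 : ∀ σ u, HasDerivAt (fun σ => G (0, σ, u)) (g σ u) σ)
    (h2 : ∀ u, g 0 u = c₁ * cutoff u)
    (h3 : ∀ u, HasDerivAt (fun σ => g σ u) (2 * c₂ * cutoff u ^ 2) 0) : HasJet G c₀ c₁ c₂ := by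
  have e : ∀ σ u, pdσ G (0, σ, u) = g σ u := fun σ u => (hasDerivAt_slice hG 0 u σ).unique (h1 σ u)
  refine ⟨hG, fun u => ⟨h0 u, by rw [e, h2], ?_⟩⟩
  have := hasDerivAt_slice (contDiff_pdσ hG) 0 u 0
  simp only [e] at this
  exact this.unique (h3 u)

lemma HasJet.congr (h : HasJet G b₀ b₁ b₂) (h0 : b₀ = c₀) (h1 : b₁ = c₁) (h2 : b₂ = c₂) :
    HasJet G c₀ c₁ c₂ := by subst h0 h1 h2; exact h

lemma HasJet.add (hG : HasJet G b₀ b₁ b₂) (hH : HasJet H c₀ c₁ c₂) :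
    HasJet (fun z => G z + H z) (b₀ + c₀) (b₁ + c₁) (b₂ + c₂) := by
  refine hasJet_of_hasDerivAt (hG.1.add hH.1) (fun u => by rw [(hG.2 u).1, (hH.2 u).1])
    (fun σ u => (hasDerivAt_slice hG.1 0 u σ).add (hasDerivAt_slice hH.1 0 u σ)) (fun u => ?_)
    (fun u => ((hasDerivAt_slice (contDiff_pdσ hG.1) 0 u 0).add
      (hasDerivAt_slice (contDiff_pdσ hH.1) 0 u 0)).congr_deriv ?_)
  · rw [(hG.2 u).2.1, (hH.2 u).2.1]; ring
  · rw [(hG.2 u).2.2, (hH.2 u).2.2]; ring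

lemma HasJet.mul (hG : HasJet G b₀ b₁ b₂) (hH : HasJet H c₀ c₁ c₂) :
    HasJet (fun z => G z * H z) (b₀ * c₀) (b₀ * c₁ + b₁ * c₀) (b₀ * c₂ + b₁ * c₁ + b₂ * c₀) := by
  refine hasJet_of_hasDerivAt (hG.1.mul hH.1) (fun u => by rw [(hG.2 u).1, (hH.2 u).1])
    (fun σ u => (hasDerivAt_slice hG.1 0 u σ).mul (hasDerivAt_slice hH.1 0 u σ)) (fun u => ?_)
    (fun u => (((hasDerivAt_slice (contDiff_pdσ hG.1) 0 u 0).mul (hasDerivAt_slice hH.1 0 u 0)).add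
      ((hasDerivAt_slice hG.1 0 u 0).mul
        (hasDerivAt_slice (contDiff_pdσ hH.1) 0 u 0))).congr_deriv ?_)
  · rw [(hG.2 u).1, (hG.2 u).2.1, (hH.2 u).1, (hH.2 u).2.1]; ring
  · rw [(hG.2 u).1, (hG.2 u).2.1, (hG.2 u).2.2, (hH.2 u).1, (hH.2 u).2.1, (hH.2 u).2.2]; ring

lemma HasJet.const (c : ℝ) : HasJet (fun _ => c) c 0 0 :=
  hasJet_of_hasDerivAt (g := fun _ _ => 0) contDiff_const (fun _ => rfl)
    (fun σ _ => hasDerivAt_const σ c) (fun _ => by ring)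
    (fun _ => (hasDerivAt_const _ _).congr_deriv (by ring))

lemma HasJet.const_mul (hG : HasJet G b₀ b₁ b₂) (c : ℝ) :
    HasJet (fun z => c * G z) (c * b₀) (c * b₁) (c * b₂) :=
  ((HasJet.const c).mul hG).congr rfl (by ring) (by ring)

lemma HasJet.neg (hG : HasJet G b₀ b₁ b₂) : HasJet (fun z => -G z) (-b₀) (-b₁) (-b₂) := by
  have := hG.const_mul (-1)
  simpa only [neg_one_mul] using this

lemma HasJet.sub (hG : HasJet G b₀ b₁ b₂) (hH : HasJet H c₀ c₁ c₂) :
    HasJet (fun z => G z - H z) (b₀ - c₀) (b₁ - c₁) (b₂ - c₂) := by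
  simpa only [sub_eq_add_neg] using hG.add hH.neg

/-- At `ε = 0` the operator `hatD k` is `-(k + σ∂_σ / 2)`. -/
lemma HasJet.hatD (hG : HasJet G b₀ b₁ b₂) (k : ℕ) :
    HasJet (hatD k G) (-k * b₀) (-(k + 1 / 2) * b₁) (-(k + 1) * b₂) := by
  have hs : ContDiff ℝ ∞ (PolyEnergy.hatD k G) := by
    have h3 : ContDiff ℝ ∞ (fderiv ℝ G) := hG.1.fderiv_right (by simp)
    have h4 : ContDiff ℝ ∞ fun p : ℝ × ℝ × ℝ => ((0 : ℝ), -p.2.1 / 2, p.1) := by fun_prop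
    exact (contDiff_const.mul hG.1).neg.add (h3.clm_apply h4)
  have e : ∀ σ u, PolyEnergy.hatD k G (0, σ, u)
      = -k * G (0, σ, u) + (-σ / 2) * pdσ G (0, σ, u) := fun σ u => by
    have : ((0 : ℝ), -σ / 2, (0 : ℝ)) = (-σ / 2) • ((0 : ℝ), (1 : ℝ), (0 : ℝ)) := by simp
    simp only [PolyEnergy.hatD, pdσ]
    rw [this, map_smul, smul_eq_mul]; ring
  have d1 := fun σ u => hasDerivAt_slice hG.1 0 u σ
  have d2 := fun σ u => hasDerivAt_slice (contDiff_pdσ hG.1) 0 u σ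
  have d3 := fun σ u => hasDerivAt_slice (contDiff_pdσ (contDiff_pdσ hG.1)) 0 u σ
  have dl : ∀ σ : ℝ, HasDerivAt (fun σ : ℝ => -σ / 2) (-1 / 2) σ := fun σ =>
    (hasDerivAt_id σ).neg.div_const 2
  refine hasJet_of_hasDerivAt (g := fun σ u => -k * pdσ G (0, σ, u)
    + ((-1 / 2) * pdσ G (0, σ, u) + (-σ / 2) * pdσ (pdσ G) (0, σ, u))) hs (fun u => ?_)
    (fun σ u => ?_) (fun u => ?_) (fun u => ?_)
  · rw [e, (hG.2 u).1]; ring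
  · simp only [e]
    exact ((d1 σ u).const_mul _).add ((dl σ).mul (d2 σ u))
  · rw [(hG.2 u).2.1, (hG.2 u).2.2]; ring
  · refine (((d2 0 u).const_mul _).add (((d2 0 u).const_mul _).add
      ((dl 0).mul (d3 0 u)))).congr_deriv ?_
    rw [(hG.2 u).2.2]; ring

lemma hasJet_comp_latHat {g g' g'' : ℝ → ℝ} (hg : ContDiff ℝ ∞ g)
    (h1 : ∀ t, HasDerivAt g (g' t) t) (h2 : ∀ t, HasDerivAt g' (g'' t) t) (a : ℝ) :
    HasJet (fun z => g (latHat a z)) (g a) (g' a) (g'' a / 2) := by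
  have dl : ∀ σ u : ℝ, HasDerivAt (fun σ => latHat a (0, σ, u)) (cutoff u) σ := fun σ u => by
    have := ((hasDerivAt_id σ).mul_const (cutoff u)).const_add a
    rw [one_mul] at this
    exact this
  have l0 : ∀ u, latHat a (0, 0, u) = a := fun u => by simp [latHat]
  refine hasJet_of_hasDerivAt (g := fun σ u => g' (latHat a (0, σ, u)) * cutoff u)
    (hg.comp (isAdm_latHat a).1) (fun u => by simp only [l0])
    (fun σ u => (h1 _).comp σ (dl σ u)) (fun u => by simp only [l0]) (fun u => ?_)
  refine (((h2 _).comp 0 (dl 0 u)).mul_const (cutoff u)).congr_deriv ?_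
  rw [l0]; ring

lemma hasJet_latHat (a : ℝ) : HasJet (latHat a) a 1 0 := by
  have := hasJet_comp_latHat (g := fun t => t) contDiff_id (fun t => hasDerivAt_id t)
    (fun t => hasDerivAt_const t 1) a
  exact this.congr rfl rfl (by simp)

lemma hasJet_sin_latHat (a : ℝ) :
    HasJet (fun z => Real.sin (latHat a z)) (Real.sin a) (Real.cos a) (-Real.sin a / 2) :=
  hasJet_comp_latHat Real.contDiff_sin Real.hasDerivAt_sin Real.hasDerivAt_cos a

lemma hasJet_cos_latHat (a : ℝ) :
    HasJet (fun z => Real.cos (latHat a z)) (Real.cos a) (-Real.sin a) (-Real.cos a / 2) :=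
  hasJet_comp_latHat Real.contDiff_cos Real.hasDerivAt_cos (fun t => (Real.hasDerivAt_sin t).neg) a

/-- The jet of a component along `ν`: the coefficients of even order carry the factor
`sin a cos a`, so that `c₀, c₁, c₂` are polynomials in `cos 2a` for all profiles considered. -/
def JetA (a : ℝ) (G : ℝ × ℝ × ℝ → ℝ) (c₀ c₁ c₂ : ℝ) : Prop :=
  HasJet G (c₀ * (Real.sin a * Real.cos a)) c₁ (c₂ * (Real.sin a * Real.cos a))

/-- The jet of a spherical component: the coefficients carry the factors `sin a`, `cos a`, `sin a`,
so that `c₀, c₁, c₂` are polynomials in `cos 2a` for all profiles considered. -/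
def JetB (a : ℝ) (G : ℝ × ℝ × ℝ → ℝ) (c₀ c₁ c₂ : ℝ) : Prop :=
  HasJet G (c₀ * Real.sin a) (c₁ * Real.cos a) (c₂ * Real.sin a)

lemma JetA.add (hG : JetA a G b₀ b₁ b₂) (hH : JetA a H c₀ c₁ c₂) :
    JetA a (fun z => G z + H z) (b₀ + c₀) (b₁ + c₁) (b₂ + c₂) :=
  (HasJet.add hG hH).congr (by ring) (by ring) (by ring)

lemma JetA.sub (hG : JetA a G b₀ b₁ b₂) (hH : JetA a H c₀ c₁ c₂) :
    JetA a (fun z => G z - H z) (b₀ - c₀) (b₁ - c₁) (b₂ - c₂) :=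
  (HasJet.sub hG hH).congr (by ring) (by ring) (by ring)

lemma JetA.neg (hG : JetA a G b₀ b₁ b₂) : JetA a (fun z => -G z) (-b₀) (-b₁) (-b₂) :=
  (HasJet.neg hG).congr (by ring) (by ring) (by ring)

lemma JetA.const_mul (hG : JetA a G b₀ b₁ b₂) (c : ℝ) :
    JetA a (fun z => c * G z) (c * b₀) (c * b₁) (c * b₂) :=
  (HasJet.const_mul hG c).congr (by ring) (by ring) (by ring)

lemma JetA.hatD (hG : JetA a G b₀ b₁ b₂) (k : ℕ) :
    JetA a (hatD k G) (-k * b₀) (-(k + 1 / 2) * b₁) (-(k + 1) * b₂) :=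
  (HasJet.hatD hG k).congr (by ring) (by ring) (by ring)

lemma JetB.add (hG : JetB a G b₀ b₁ b₂) (hH : JetB a H c₀ c₁ c₂) :
    JetB a (fun z => G z + H z) (b₀ + c₀) (b₁ + c₁) (b₂ + c₂) :=
  (HasJet.add hG hH).congr (by ring) (by ring) (by ring)

lemma JetB.sub (hG : JetB a G b₀ b₁ b₂) (hH : JetB a H c₀ c₁ c₂) :
    JetB a (fun z => G z - H z) (b₀ - c₀) (b₁ - c₁) (b₂ - c₂) :=
  (HasJet.sub hG hH).congr (by ring) (by ring) (by ring)

lemma JetB.const_mul (hG : JetB a G b₀ b₁ b₂) (c : ℝ) :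
    JetB a (fun z => c * G z) (c * b₀) (c * b₁) (c * b₂) :=
  (HasJet.const_mul hG c).congr (by ring) (by ring) (by ring)

lemma JetB.hatD (hG : JetB a G b₀ b₁ b₂) (k : ℕ) :
    JetB a (hatD k G) (-k * b₀) (-(k + 1 / 2) * b₁) (-(k + 1) * b₂) :=
  (HasJet.hatD hG k).congr (by ring) (by ring) (by ring)

lemma cos_sq_eq (a : ℝ) : Real.cos a ^ 2 = (1 + Real.cos (2 * a)) / 2 := by
  rw [Real.cos_two_mul]; ring

lemma sin_sq_eq (a : ℝ) : Real.sin a ^ 2 = (1 - Real.cos (2 * a)) / 2 := by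
  rw [Real.cos_two_mul, ← Real.sin_sq_add_cos_sq a]; ring

lemma JetA.mul_cos (hG : JetA a G b₀ b₁ b₂) :
    JetB a (fun z => G z * Real.cos (latHat a z)) (b₀ * ((1 + Real.cos (2 * a)) / 2))
      (b₁ - b₀ * ((1 - Real.cos (2 * a)) / 2))
      (b₂ * ((1 + Real.cos (2 * a)) / 2) - b₁ - b₀ * ((1 + Real.cos (2 * a)) / 4)) := by
  have e : (1 + Real.cos (2 * a)) / 4 = Real.cos a ^ 2 / 2 := by rw [cos_sq_eq]; ring
  rw [e, ← cos_sq_eq, ← sin_sq_eq]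
  exact (HasJet.mul hG (hasJet_cos_latHat a)).congr (by ring) (by ring) (by ring)

lemma JetB.mul_cos (hG : JetB a G b₀ b₁ b₂) :
    JetA a (fun z => G z * Real.cos (latHat a z)) b₀
      (b₁ * ((1 + Real.cos (2 * a)) / 2) - b₀ * ((1 - Real.cos (2 * a)) / 2))
      (b₂ - b₁ - b₀ / 2) := by
  rw [← cos_sq_eq, ← sin_sq_eq]
  exact (HasJet.mul hG (hasJet_cos_latHat a)).congr (by ring) (by ring) (by ring)

lemma JetA.sq (hG : JetA a G b₀ b₁ b₂) : ∃ d₀ d₁, HasJet (fun z => G z ^ 2) d₀ d₁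
    (b₀ * b₂ * ((1 - Real.cos (2 * a) ^ 2) / 2) + b₁ ^ 2) := by
  have e : (1 - Real.cos (2 * a) ^ 2) / 2 = 2 * (Real.sin a ^ 2 * Real.cos a ^ 2) := by
    rw [sin_sq_eq a, cos_sq_eq a]; ring
  rw [e]
  simp only [_root_.sq (G _)]
  exact ⟨_, _, (HasJet.mul hG hG).congr rfl rfl (by ring)⟩

lemma JetB.sq (hG : JetB a G b₀ b₁ b₂) : ∃ d₀ d₁, HasJet (fun z => G z ^ 2) d₀ d₁
    (b₀ * b₂ * (1 - Real.cos (2 * a)) + b₁ ^ 2 * ((1 + Real.cos (2 * a)) / 2)) := by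
  have e : 1 - Real.cos (2 * a) = 2 * Real.sin a ^ 2 := by rw [sin_sq_eq]; ring
  rw [← cos_sq_eq, e]
  simp only [_root_.sq (G _)]
  exact ⟨_, _, (HasJet.mul hG hG).congr rfl rfl (by ring)⟩

lemma jetA_hatD_latHat (a : ℝ) : JetA a (hatD 0 (latHat a)) 0 (-1 / 2) 0 :=
  ((hasJet_latHat a).hatD 0).congr (by simp) (by norm_num) (by simp)

lemma jetB_sin_latHat (a : ℝ) : JetB a (fun z => Real.sin (latHat a z)) 1 1 (-1 / 2) :=
  (hasJet_sin_latHat a).congr (by ring) (by ring) (by ring)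

lemma JetA.hatDiv {p q : ℝ × ℝ × ℝ → ℝ} (n : ℕ) (hp : JetA a p b₀ b₁ b₂) (hq : JetB a q c₀ c₁ c₂)
    (k : ℕ) :
    JetA a (hatDiv n a k p q) ((n - 1 - k) * b₀ - (n - 1) * c₀)
      ((n - 1 - k - 1 / 2) * b₁ - (n - 1) * (c₁ * ((1 + Real.cos (2 * a)) / 2)
        - c₀ * ((1 - Real.cos (2 * a)) / 2)))
      ((n - 1 - k - 1) * b₂ - (n - 1) * (c₂ - c₁ - c₀ / 2)) :=
  HasJet.congr (((hp.hatD k).add (hp.const_mul (n - 1))).sub (hq.mul_cos.const_mul (n - 1)))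
    (by ring) (by ring) (by ring)

/-- The jets of a form whose components of even degree have vanishing jets. The operator `d* + d`
exchanges these forms with those of `HatForm.EvenJet`. -/
def HatForm.OddJet (a : ℝ) (S : HatForm) (p₀ p₁ p₂ q₀ q₁ q₂ : ℝ) : Prop :=
  JetA a S.F 0 0 0 ∧ JetA a S.p p₀ p₁ p₂ ∧ JetB a S.q q₀ q₁ q₂ ∧ JetB a S.w 0 0 0

/-- The jets of a form whose components of odd degree have vanishing jets. -/
def HatForm.EvenJet (a : ℝ) (S : HatForm) (f₀ f₁ f₂ w₀ w₁ w₂ : ℝ) : Prop :=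
  JetA a S.F f₀ f₁ f₂ ∧ JetA a S.p 0 0 0 ∧ JetB a S.q 0 0 0 ∧ JetB a S.w w₀ w₁ w₂

lemma JetA.congr (h : JetA a G b₀ b₁ b₂) (h0 : b₀ = c₀) (h1 : b₁ = c₁) (h2 : b₂ = c₂) :
    JetA a G c₀ c₁ c₂ := by subst h0 h1 h2; exact h

lemma JetB.congr (h : JetB a G b₀ b₁ b₂) (h0 : b₀ = c₀) (h1 : b₁ = c₁) (h2 : b₂ = c₂) :
    JetB a G c₀ c₁ c₂ := by subst h0 h1 h2; exact h

lemma HatForm.OddJet.step {S : HatForm} {p₀ p₁ p₂ q₀ q₁ q₂ : ℝ} (n : ℕ) (k : ℕ)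
    (h : S.OddJet a p₀ p₁ p₂ q₀ q₁ q₂) :
    (hatStep n a k S).EvenJet a (-((n - 1 - k) * p₀ - (n - 1) * q₀))
      (-((n - 1 - k - 1 / 2) * p₁ - (n - 1) * (q₁ * ((1 + Real.cos (2 * a)) / 2)
        - q₀ * ((1 - Real.cos (2 * a)) / 2))))
      (-((n - 1 - k - 1) * p₂ - (n - 1) * (q₂ - q₁ - q₀ / 2)))
      ((1 - k) * q₀ - p₀ * ((1 + Real.cos (2 * a)) / 2))
      ((1 / 2 - k) * q₁ - (p₁ - p₀ * ((1 - Real.cos (2 * a)) / 2)))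
      (-k * q₂ - (p₂ * ((1 + Real.cos (2 * a)) / 2) - p₁ - p₀ * ((1 + Real.cos (2 * a)) / 4))) := by
  obtain ⟨hF, hp, hq, hw⟩ := h
  exact ⟨(hp.hatDiv n hq k).neg,
    ((hF.hatD k).sub (hw.mul_cos.const_mul (n - 1))).congr (by ring) (by ring) (by ring),
    (hF.mul_cos.sub ((hw.hatD k).add (hw.const_mul (n - 2)))).congr (by ring) (by ring) (by ring),
    (((hq.hatD k).add hq).sub hp.mul_cos).congr (by ring) (by ring) (by ring)⟩

lemma HatForm.EvenJet.step {S : HatForm} {f₀ f₁ f₂ w₀ w₁ w₂ : ℝ} (n : ℕ) (k : ℕ)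
    (h : S.EvenJet a f₀ f₁ f₂ w₀ w₁ w₂) :
    (hatStep n a k S).OddJet a (-k * f₀ - (n - 1) * w₀)
      (-(k + 1 / 2) * f₁ - (n - 1) * (w₁ * ((1 + Real.cos (2 * a)) / 2)
        - w₀ * ((1 - Real.cos (2 * a)) / 2)))
      (-(k + 1) * f₂ - (n - 1) * (w₂ - w₁ - w₀ / 2))
      (f₀ * ((1 + Real.cos (2 * a)) / 2) - (n - 2 - k) * w₀)
      (f₁ - f₀ * ((1 - Real.cos (2 * a)) / 2) - (n - 2 - k - 1 / 2) * w₁)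
      (f₂ * ((1 + Real.cos (2 * a)) / 2) - f₁ - f₀ * ((1 + Real.cos (2 * a)) / 4)
        - (n - 2 - k - 1) * w₂) := by
  obtain ⟨hF, hp, hq, hw⟩ := h
  exact ⟨(hp.hatDiv n hq k).neg.congr (by ring) (by ring) (by ring),
    (hF.hatD k).sub (hw.mul_cos.const_mul (n - 1)),
    (hF.mul_cos.sub ((hw.hatD k).add (hw.const_mul (n - 2)))).congr (by ring) (by ring) (by ring),
    (((hq.hatD k).add hq).sub hp.mul_cos).congr (by ring) (by ring) (by ring)⟩

lemma oddJet_hatES_zero (n : ℕ) (a : ℝ) : (hatES n a 0).OddJet a 0 (-1 / 2) 0 1 1 (-1 / 2) :=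
  ⟨(HasJet.const 0).congr (by ring) rfl (by ring), jetA_hatD_latHat a, jetB_sin_latHat a,
    (HasJet.const 0).congr (by ring) (by ring) (by ring)⟩

lemma HatForm.OddJet.density {n j : ℕ} {p₀ p₁ p₂ q₀ q₁ q₂ : ℝ}
    (h : (hatES n a j).OddJet a p₀ p₁ p₂ q₀ q₁ q₂) : ∃ d₀ d₁, HasJet (hatESDensity n a j) d₀ d₁
      (p₀ * p₂ * ((1 - Real.cos (2 * a) ^ 2) / 2) + p₁ ^ 2 + (n - 1) *
        (q₀ * q₂ * (1 - Real.cos (2 * a)) + q₁ ^ 2 * ((1 + Real.cos (2 * a)) / 2))) := by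
  obtain ⟨hF, hp, hq, hw⟩ := h
  obtain ⟨_, _, hF⟩ := hF.sq
  obtain ⟨_, _, hp⟩ := hp.sq
  obtain ⟨_, _, hq⟩ := hq.sq
  obtain ⟨_, _, hw⟩ := hw.sq
  exact ⟨_, _, (((hF.add hp).add (hq.const_mul (n - 1))).add (hw.const_mul (n - 1))).congr
    rfl rfl (by ring)⟩

lemma HatForm.EvenJet.density {n j : ℕ} {f₀ f₁ f₂ w₀ w₁ w₂ : ℝ}
    (h : (hatES n a j).EvenJet a f₀ f₁ f₂ w₀ w₁ w₂) : ∃ d₀ d₁, HasJet (hatESDensity n a j) d₀ d₁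
      (f₀ * f₂ * ((1 - Real.cos (2 * a) ^ 2) / 2) + f₁ ^ 2 + (n - 1) *
        (w₀ * w₂ * (1 - Real.cos (2 * a)) + w₁ ^ 2 * ((1 + Real.cos (2 * a)) / 2))) := by
  obtain ⟨hF, hp, hq, hw⟩ := h
  obtain ⟨_, _, hF⟩ := hF.sq
  obtain ⟨_, _, hp⟩ := hp.sq
  obtain ⟨_, _, hq⟩ := hq.sq
  obtain ⟨_, _, hw⟩ := hw.sq
  exact ⟨_, _, (((hF.add hp).add (hq.const_mul (n - 1))).add (hw.const_mul (n - 1))).congr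
    rfl rfl (by ring)⟩

lemma jetA_hatLap_zero (n : ℕ) (a : ℝ) : JetA a (hatLap n a 0) (-(n - 1))
    (-(n - 1 - 3 / 2) / 2 - (n - 1) * Real.cos (2 * a)) (2 * (n - 1)) :=
  ((jetA_hatD_latHat a).hatDiv n (jetB_sin_latHat a) 1).congr (by ring) (by push_cast; ring)
    (by ring)

lemma JetA.hatLap_succ {n j : ℕ} (h : JetA a (hatLap n a j) b₀ b₁ b₂) :
    JetA a (hatLap n a (j + 1))
      (-((n - 1 - (2 * j + 3)) * (-(2 * j + 2) * b₀)
        - (n - 1) * (b₀ * ((1 + Real.cos (2 * a)) / 2))))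
      (-((n - 1 - (2 * j + 3) - 1 / 2) * (-(2 * j + 2 + 1 / 2) * b₁)
        - (n - 1) * ((b₁ - b₀ * ((1 - Real.cos (2 * a)) / 2)) * ((1 + Real.cos (2 * a)) / 2)
          - b₀ * ((1 + Real.cos (2 * a)) / 2) * ((1 - Real.cos (2 * a)) / 2))))
      (-((n - 1 - (2 * j + 3) - 1) * (-(2 * j + 2 + 1) * b₂)
        - (n - 1) * (b₂ * ((1 + Real.cos (2 * a)) / 2) - b₁ - b₀ * ((1 + Real.cos (2 * a)) / 4)
          - (b₁ - b₀ * ((1 - Real.cos (2 * a)) / 2))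
          - b₀ * ((1 + Real.cos (2 * a)) / 2) / 2))) :=
  ((h.hatD (2 * j + 2)).hatDiv n h.mul_cos (2 * j + 3)).neg.congr (by push_cast; ring)
    (by push_cast; ring) (by push_cast; ring)

/-- The jet of the odd-order energy density, in terms of the iterated Laplacian of the tension
field. -/
lemma JetA.odd_density {n j : ℕ} (h : JetA a (hatLap n a j) b₀ b₁ b₂) :
    ∃ d₀ d₁, HasJet (fun z => PolyEnergy.hatD (2 * j + 2) (hatLap n a j) z ^ 2
        + (n - 1) * (hatLap n a j z * Real.cos (latHat a z)) ^ 2) d₀ d₁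
      ((2 * j + 2) * (2 * j + 3) * (b₀ * b₂) * ((1 - Real.cos (2 * a) ^ 2) / 2)
        + ((2 * j + 2 + 1 / 2) * b₁) ^ 2 + (n - 1) *
        (b₀ * ((1 + Real.cos (2 * a)) / 2)
          * (b₂ * ((1 + Real.cos (2 * a)) / 2) - b₁ - b₀ * ((1 + Real.cos (2 * a)) / 4))
            * (1 - Real.cos (2 * a))
          + (b₁ - b₀ * ((1 - Real.cos (2 * a)) / 2)) ^ 2 * ((1 + Real.cos (2 * a)) / 2))) := by
  obtain ⟨_, _, h1⟩ := (h.hatD (2 * j + 2)).sq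
  obtain ⟨_, _, h2⟩ := h.mul_cos.sq
  exact ⟨_, _, (h1.add (h2.const_mul (n - 1))).congr rfl rfl (by push_cast; ring)⟩

end Jet

/-! ### Instability of the two energies -/

lemma not_isStable_of_hasJet {r n : ℕ} (hr : 0 < r) (hn : n = 2 * r + 1) {a d₀ d₁ d₂ : ℝ}
    {𝓕 : (E n → E (n + 1)) → ℝ} {G : ℝ × ℝ × ℝ → ℝ} (hG : IsAdm G)
    (h𝓕 : ∀ ε s, 0 < ε → 𝓕 (symMap (lat a ε s))
      = (1 / 2) * ∫ x, prof ε s (2 * r) G (ell x) ∂(ballMeasure n))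
    (hjet : HasJet G d₀ d₁ d₂) (hneg : d₂ < 0) : ¬ IsStable r 𝓕 (phi n a) := by
  subst hn
  exact not_isStable_of_density hr hG h𝓕 (fun u => (hjet.2 u).2.2) (by linarith)

lemma IsAdm.sq {G : ℝ × ℝ × ℝ → ℝ} (hG : IsAdm G) : IsAdm (fun z => G z ^ 2) := by
  simpa only [_root_.sq] using hG.mul hG

lemma isAdm_hatESDensity (n : ℕ) (a : ℝ) (j : ℕ) : IsAdm (hatESDensity n a j) := by
  obtain ⟨hF, hp, hq, hw⟩ := isAdm_hatES n a j
  exact ((hF.sq.add hp.sq).add ((IsAdm.const (n - 1)).mul hq.sq)).add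
    ((IsAdm.const (n - 1)).mul hw.sq)

lemma not_isStable_esEnergy {j n : ℕ} (hn : n = 2 * (j + 1) + 1) {a d₂ : ℝ}
    (hjet : ∃ d₀ d₁, HasJet (hatESDensity n a j) d₀ d₁ d₂) (hneg : d₂ < 0) :
    ¬ IsStable (j + 1) (esEnergy (j + 1)) (phi n a) := by
  obtain ⟨d₀, d₁, h⟩ := hjet
  exact not_isStable_of_hasJet j.succ_pos hn (isAdm_hatESDensity n a j)
    (fun ε s hε => esEnergy_symMap a s hε j (by omega)) h hneg

lemma not_isStable_rEnergy_even {j n : ℕ} (hn : n = 2 * (2 * j + 2) + 1) {a d₂ : ℝ}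
    (hjet : ∃ d₀ d₁, HasJet (fun z => hatLap n a j z ^ 2) d₀ d₁ d₂) (hneg : d₂ < 0) :
    ¬ IsStable (2 * j + 2) (rEnergy (2 * j + 2)) (phi n a) := by
  obtain ⟨d₀, d₁, h⟩ := hjet
  exact not_isStable_of_hasJet (by omega) hn (isAdm_hatLap n a j).sq
    (fun ε s hε => rEnergy_symMap_even a s hε j (by omega)) h hneg

lemma not_isStable_rEnergy_odd {j n : ℕ} (hn : n = 2 * (2 * j + 3) + 1) {a d₂ : ℝ}
    (hjet : ∃ d₀ d₁, HasJet (fun z => hatD (2 * j + 2) (hatLap n a j) z ^ 2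
        + (n - 1) * (hatLap n a j z * Real.cos (latHat a z)) ^ 2) d₀ d₁ d₂) (hneg : d₂ < 0) :
    ¬ IsStable (2 * j + 3) (rEnergy (2 * j + 3)) (phi n a) := by
  obtain ⟨d₀, d₁, h⟩ := hjet
  exact not_isStable_of_hasJet (by omega) hn
    (((isAdm_hatLap n a j).hatD _).sq.add ((IsAdm.const (n - 1)).mul
      ((isAdm_hatLap n a j).mul (isAdm_cos_latHat a)).sq))
    (fun ε s hε => rEnergy_symMap_odd a s hε j (by omega)) h hneg

/-! ### The three critical latitudes

In each case `x = cos 2a` is a root of a quadratic polynomial. The second-order Taylor coefficient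
of the density is a polynomial in `x`, and the `linear_combination` certificates reduce it modulo
that quadratic polynomial to a linear function of `x`. -/

lemma not_isStable_rEnergy_7 {a : ℝ}
    (h : Real.cos (2 * a) ^ 2 + 22 / 9 * Real.cos (2 * a) + 1 = 0)
    (hx : Real.cos (2 * a) < -1 / 2) : ¬ IsStable 3 (rEnergy 3) (phi 7 a) := by
  refine not_isStable_rEnergy_odd (j := 0) (n := 7) rfl
    (jetA_hatLap_zero 7 a).odd_density
    (lt_of_eq_of_lt (b := 693/64 + 4847/16 * Real.cos (2 * a)) ?_ ?_)
  · push_cast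
    linear_combination ((-369) + 486 * Real.cos (2 * a)) * h
  · linarith

lemma not_isStable_esEnergy_7 {a : ℝ}
    (h : Real.cos (2 * a) ^ 2 + 22 / 9 * Real.cos (2 * a) + 1 = 0)
    (hx : Real.cos (2 * a) < -1 / 2) : ¬ IsStable 3 (esEnergy 3) (phi 7 a) := by
  refine not_isStable_esEnergy (j := 2) (n := 7) rfl
    (((oddJet_hatES_zero 7 a).step 7 1).step 7 2).density
    (lt_of_eq_of_lt (b := 693/64 + 4847/16 * Real.cos (2 * a)) ?_ ?_)
  · push_cast
    linear_combination ((-369) + 486 * Real.cos (2 * a)) * h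
  · linarith

lemma not_isStable_rEnergy_9 {a : ℝ}
    (h : Real.cos (2 * a) ^ 2 + 19 / 8 * Real.cos (2 * a) + 1 = 0)
    (hx : Real.cos (2 * a) < -1 / 2) : ¬ IsStable 4 (rEnergy 4) (phi 9 a) := by
  refine not_isStable_rEnergy_even (j := 1) (n := 9) rfl
    (jetA_hatLap_zero 9 a).hatLap_succ.sq
    (lt_of_eq_of_lt (b := -457871/256 + 8747/2 * Real.cos (2 * a)) ?_ ?_)
  · push_cast
    linear_combination ((-15151)
      + 17088 * Real.cos (2 * a)
      + 8192 * Real.cos (2 * a) ^ 2) * h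
  · linarith

lemma not_isStable_esEnergy_9 {a : ℝ}
    (h : Real.cos (2 * a) ^ 2 + 19 / 8 * Real.cos (2 * a) + 1 = 0)
    (hx : Real.cos (2 * a) < -1 / 2) : ¬ IsStable 4 (esEnergy 4) (phi 9 a) := by
  refine not_isStable_esEnergy (j := 3) (n := 9) rfl
    ((((oddJet_hatES_zero 9 a).step 9 1).step 9 2).step 9 3).density
    (lt_of_eq_of_lt (b := -439951/256 + 17879/4 * Real.cos (2 * a)) ?_ ?_)
  · push_cast
    linear_combination ((-15205)
      + 17104 * Real.cos (2 * a)
      + 8192 * Real.cos (2 * a) ^ 2) * h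
  · linarith

lemma not_isStable_rEnergy_11 {a : ℝ}
    (h : Real.cos (2 * a) ^ 2 + 58 / 25 * Real.cos (2 * a) + 1 = 0)
    (hx : Real.cos (2 * a) < -1 / 2) : ¬ IsStable 5 (rEnergy 5) (phi 11 a) := by
  refine not_isStable_rEnergy_odd (j := 1) (n := 11) rfl
    (jetA_hatLap_zero 11 a).hatLap_succ.odd_density
    (lt_of_eq_of_lt (b := -102077523/1024 + 1195273179/6400 * Real.cos (2 * a)) ?_ ?_)
  · push_cast
    linear_combination ((-78735997/64)
      + (16758025/16) * Real.cos (2 * a)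
      + 986250 * Real.cos (2 * a) ^ 2
      + 156250 * Real.cos (2 * a) ^ 3) * h
  · linarith

lemma not_isStable_esEnergy_11 {a : ℝ}
    (h : Real.cos (2 * a) ^ 2 + 58 / 25 * Real.cos (2 * a) + 1 = 0)
    (hx : Real.cos (2 * a) < -1 / 2) : ¬ IsStable 5 (esEnergy 5) (phi 11 a) := by
  refine not_isStable_esEnergy (j := 4) (n := 11) rfl
    (((((oddJet_hatES_zero 11 a).step 11 1).step 11 2).step 11 3).step 11 4).density
    (lt_of_eq_of_lt (b := -96070995/1024 + 248135967/1280 * Real.cos (2 * a)) ?_ ?_)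
  · push_cast
    linear_combination ((-78984905/64)
      + (8382375/8) * Real.cos (2 * a)
      + (3946875/4) * Real.cos (2 * a) ^ 2
      + 156250 * Real.cos (2 * a) ^ 3) * h
  · linarith

lemma cos_two_mul_half_arccos {y : ℝ} (h1 : -1 ≤ y) (h2 : y ≤ 1) :
    Real.cos (2 * ((1 / 2) * Real.arccos y)) = y := by
  rw [← mul_assoc]
  norm_num [Real.cos_arccos h1 h2]

end PolyEnergy

end

theorem mainTheorem2 (r n : ℕ) (a : ℝ)
    (h : (r = 3 ∧ n = 7 ∧ a = (1 / 2) * Real.arccos ((1 / 9) * (2 * √10 - 11))) ∨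
      (r = 4 ∧ n = 9 ∧ a = (1 / 2) * Real.arccos ((1 / 16) * (√105 - 19))) ∨
      (r = 5 ∧ n = 11 ∧ a = (1 / 2) * Real.arccos ((1 / 25) * (6 * √6 - 29)))) :
    ¬ PolyEnergy.IsStable r (PolyEnergy.rEnergy r) (PolyEnergy.phi n a) ∧
      ¬ PolyEnergy.IsStable r (PolyEnergy.esEnergy r) (PolyEnergy.phi n a) := by
  rcases h with ⟨rfl, rfl, ha⟩ | ⟨rfl, rfl, ha⟩ | ⟨rfl, rfl, ha⟩
  · have hs : √10 ^ 2 = 10 := Real.sq_sqrt (by norm_num)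
    have h1 : (√10 : ℝ) < 3.2 := by rw [Real.sqrt_lt' (by norm_num)]; norm_num
    have h2 : (3 : ℝ) ≤ √10 := by rw [Real.le_sqrt' (by norm_num)]; norm_num
    have hc : Real.cos (2 * a) = (1 / 9) * (2 * √10 - 11) := by
      rw [ha]; exact PolyEnergy.cos_two_mul_half_arccos (by linarith) (by linarith)
    have hq : Real.cos (2 * a) ^ 2 + 22 / 9 * Real.cos (2 * a) + 1 = 0 := by
      rw [hc]; linear_combination (4 / 81) * hs
    have hx : Real.cos (2 * a) < -1 / 2 := by rw [hc]; linarith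
    exact ⟨PolyEnergy.not_isStable_rEnergy_7 hq hx, PolyEnergy.not_isStable_esEnergy_7 hq hx⟩
  · have hs : √105 ^ 2 = 105 := Real.sq_sqrt (by norm_num)
    have h1 : (√105 : ℝ) < 10.5 := by rw [Real.sqrt_lt' (by norm_num)]; norm_num
    have h2 : (10 : ℝ) ≤ √105 := by rw [Real.le_sqrt' (by norm_num)]; norm_num
    have hc : Real.cos (2 * a) = (1 / 16) * (√105 - 19) := by
      rw [ha]; exact PolyEnergy.cos_two_mul_half_arccos (by linarith) (by linarith)
    have hq : Real.cos (2 * a) ^ 2 + 19 / 8 * Real.cos (2 * a) + 1 = 0 := by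
      rw [hc]; linear_combination (1 / 256) * hs
    have hx : Real.cos (2 * a) < -1 / 2 := by rw [hc]; linarith
    exact ⟨PolyEnergy.not_isStable_rEnergy_9 hq hx, PolyEnergy.not_isStable_esEnergy_9 hq hx⟩
  · have hs : √6 ^ 2 = 6 := Real.sq_sqrt (by norm_num)
    have h1 : (√6 : ℝ) < 2.5 := by rw [Real.sqrt_lt' (by norm_num)]; norm_num
    have h2 : (2 : ℝ) ≤ √6 := by rw [Real.le_sqrt' (by norm_num)]; norm_num
    have hc : Real.cos (2 * a) = (1 / 25) * (6 * √6 - 29) := by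
      rw [ha]; exact PolyEnergy.cos_two_mul_half_arccos (by linarith) (by linarith)
    have hq : Real.cos (2 * a) ^ 2 + 58 / 25 * Real.cos (2 * a) + 1 = 0 := by
      rw [hc]; linear_combination (36 / 625) * hs
    have hx : Real.cos (2 * a) < -1 / 2 := by rw [hc]; linarith
    exact ⟨PolyEnergy.not_isStable_rEnergy_11 hq hx, PolyEnergy.not_isStable_esEnergy_11 hq hx⟩
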